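/- **Conventions.** 2-categories are strict and small, $2\text{-}\mathbf{Cat}$ is the category of small 2-categories and (strict) 2-functors, and $\mathbf{Gray}(\mathcal P,\mathcal B)$ is the 2-category of 2-functors $\mathcal P\to\mathcal B$, pseudonatural transformations and modifications. The power of $\mathcal B$ by $\mathcal P$ is $\mathcal B^{\mathcal P}:=\mathbf{Gray}(\mathcal P,\mathcal B)$, and a 2-functor $i:\mathcal P\to\mathcal Q$ induces $\mathcal B^{i}:\mathcal B^{\mathcal Q}\to\mathcal B^{\mathcal P}$ by precomposition. For a category $X$, let $\mathbf 2[X]$ be the 2-category with objects $0,1$, $\mathbf 2[X](0,1)=X$, trivial endo-hom-categories and $\mathbf 2[X](1,0)=\emptyset$. The generating cofibrations of the Lack model structure on $2\text{-}\mathbf{Cat}$ are $i_1:\emptyset\to\mathbf 1$, $i_2=\mathbf 2[\emptyset\to\mathbf 1]$, $i_3=\mathbf 2[\mathbf 1+\mathbf 1\to\{0\to1\}]$ and $i_4=\mathbf 2[\{0\rightrightarrows1\}\to\{0\to1\}]$. Put $k=\mathbf 2[\mathbf 1+\mathbf 1\to\mathbb I]$ with $\mathbb I$ the free isomorphism. Let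 $F,G:\mathcal C\to\mathcal B$ be 2-functors, $\alpha,\beta:F\Rightarrow G$ pseudonatural transformations and $\Gamma,\Delta:\alpha\Rrightarrow\beta$ modifications. The *2-cell inserter* of $F,G$, the *iso-3-cell inserter* of $\alpha,\beta$ and the *3-cell equifier* of $\Gamma,\Delta$ are the pullbacks in $2\text{-}\mathbf{Cat}$ of $\mathcal B^{i_2}$, $\mathcal B^{k}$, $\mathcal B^{i_4}$ along the 2-functors $(F,G):\mathcal C\to\mathcal B\times\mathcal B\cong\mathcal B^{\mathbf 1+\mathbf 1}$, $(\alpha,\beta):\mathcal C\to\mathcal B^{\mathbf 2[\mathbf 1+\mathbf 1]}$, $(\Gamma,\Delta):\mathcal C\to\mathcal B^{\mathbf 2[\rightrightarrows]}$, each with its projection to $\mathcal C$. A 2-functor $F:\mathcal E\to\mathcal B$ is an *equiv-fibration* if (i) every functor $\mathcal E(x,y)\to\mathcal B(Fx,Fy)$ is an isofibration, and (ii) for every object $y$ of $\mathcal E$ and every adjoint equivalence $b\simeq Fy$ in $\mathcal B$ there is an adjoint equivalence $x\simeq y$ in $\mathcal E$ which $F$ sends to it (both 1-cells, unit and counit).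 A *pseudomonad* on a 2-category $\mathcal A$ consists of a 2-functor $S:\mathcal A\to\mathcal A$, pseudonatural transformations $\eta:1\Rightarrow S$, $\mu:S^2\Rightarrow S$ and invertible modifications $\lambda:1_S\Rrightarrow\mu.\eta_S$, $\rho:\mu.S\eta\Rrightarrow1_S$, $\alpha:\mu.S\mu\Rrightarrow\mu.\mu_S$ satisfying the two usual coherence axioms. Its 2-category $\mathcal A^S$ has as objects the *pseudoalgebras* $(X,\phi,u,m)$, with $\phi:SX\to X$ and invertible $u:1_X\Rightarrow\phi.\eta_X$, $m:\phi.S\phi\Rightarrow\phi.\mu_X$ such that * the two pastings $\phi.S\phi.S^2\phi\Rightarrow\phi.\mu_X.\mu_{SX}$ of $Sm,m,\alpha_X$ and of $m,\mu_\phi,m$ agree, and * the pasting of $Su,m,\rho_X$ is $1_\phi$. Its 1-cells are the pseudomorphisms $(f,\bar f)$ with $\bar f:\psi.Sf\Rightarrow f.\phi$ invertible and compatible with multiplications and units, and its 2-cells $(f,\bar f)\Rightarrow(g,\bar g)$ are the 2-cells $\gamma:f\Rightarrow g$ with $\bar g\circ(\psi.S\gamma)=(\gamma.\phi)\circ\bar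 f$. Let $U^S:\mathcal A^S\to\mathcal A$ be the forgetful 2-functor. **Proposition.** For every pseudomonad $(S,\eta,\mu,\lambda,\rho,\alpha)$ on a small 2-category $\mathcal A$: 1. $U^S$ is a composite $$\mathcal A^S\xrightarrow{p_5}\mathcal E_1\xrightarrow{p_4}\mathcal I_3\xrightarrow{p_3}\mathcal I_2\xrightarrow{p_2}\mathcal I_1\xrightarrow{p_1}\mathcal A$$ in which * $p_1$ is the 2-cell inserter of $S$ and $1_{\mathcal A}$; * $p_2$ is the iso-3-cell inserter of two pseudonatural transformations $p_1\Rightarrow p_1$; * $p_3$ is the iso-3-cell inserter of two pseudonatural transformations $S^2p_1p_2\Rightarrow p_1p_2$; * $p_4$ is the 3-cell equifier of two parallel modifications between pseudonatural transformations $Sp_1p_2p_3\Rightarrow p_1p_2p_3$; * $p_5$ is the 3-cell equifier of two parallel modifications between pseudonatural transformations $S^3p_1p_2p_3p_4\Rightarrow p_1p_2p_3p_4$. 2. $U^S$ is a finite composite of pullbacks in $2\text{-}\mathbf{Cat}$ of 2-functors of the form $\mathcal B^{i}$ with $\mathcal B$ a small 2-category and $i\in\{i_1,i_2,i_3,i_4\}$.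 3. $U^S$ is an equiv-fibration. -/

import Mathlib

open CategoryTheory Bicategory
open scoped Pseudofunctor.StrongTrans

universe u v w

namespace GrayPsAlg

/-! ### The 2-categories `2[X]` -/

/-- The 2-category `2[X]` of a category `X`: two objects `src`, `tgt`, hom-categories
`2[X](src, tgt) = X`, `2[X](src, src) = 2[X](tgt, tgt) = 1` and `2[X](tgt, src) = ∅`. -/
inductive Susp (X : Type) : Type
  | src
  | tgt

namespace Susp

variable {X Y : Type}

/-- The underlying types of the hom-categories of `2[X]`. -/
def Hom : Susp X → Susp X → Type
  | src, src => Discrete PUnit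
  | src, tgt => X
  | tgt, src => Discrete PEmpty
  | tgt, tgt => Discrete PUnit

/-- Identity 1-cells of `2[X]`. -/
def idHom : (a : Susp X) → Hom a a
  | src => ⟨⟨⟩⟩
  | tgt => ⟨⟨⟩⟩

/-- Composition of 1-cells of `2[X]`; one of the two factors is always an identity. -/
def compHom : {a b c : Susp X} → Hom a b → Hom b c → Hom a c
  | src, src, _, _, g => g
  | tgt, tgt, _, _, g => g
  | src, tgt, tgt, f, _ => f
  | src, tgt, src, _, g => g.as.elim
  | tgt, src, _, f, _ => f.as.elim

instance : CategoryStruct (Susp X) where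
  Hom := Hom
  id := idHom
  comp := compHom

instance homCategory [Category.{0} X] : (a b : Susp X) → Category.{0} (a ⟶ b)
  | src, src => inferInstanceAs (Category (Discrete PUnit))
  | src, tgt => inferInstanceAs (Category X)
  | tgt, src => inferInstanceAs (Category (Discrete PEmpty))
  | tgt, tgt => inferInstanceAs (Category (Discrete PUnit))

lemma id_comp' {a b : Susp X} (f : a ⟶ b) : 𝟙 a ≫ f = f := by
  cases a <;> cases b <;> rfl

lemma comp_id' {a b : Susp X} (f : a ⟶ b) : f ≫ 𝟙 b = f := by
  cases a <;> cases b <;> first | rfl | exact (f : Discrete PEmpty).as.elim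

lemma assoc' {a b c d : Susp X} (f : a ⟶ b) (g : b ⟶ c) (h : c ⟶ d) :
    (f ≫ g) ≫ h = f ≫ g ≫ h := by
  cases a <;> cases b <;> cases c <;> cases d <;>
    first
      | rfl
      | exact (f : Discrete PEmpty).as.elim
      | exact (g : Discrete PEmpty).as.elim

variable [Category.{0} X] [Category.{0} Y]

/-- Left whiskering in `2[X]`. -/
def whiskerL : {a b c : Susp X} → (f : a ⟶ b) → {g h : b ⟶ c} → (g ⟶ h) → (f ≫ g ⟶ f ≫ h)
  | src, src, _, _, _, _, η => η
  | tgt, tgt, _, _, _, _, η => η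
  | src, tgt, tgt, f, _, _, _ => 𝟙 f
  | src, tgt, src, _, g, _, _ => g.as.elim
  | tgt, src, _, f, _, _, _ => f.as.elim

/-- Right whiskering in `2[X]`. -/
def whiskerR : {a b c : Susp X} → {f g : a ⟶ b} → (f ⟶ g) → (h : b ⟶ c) → (f ≫ h ⟶ g ≫ h)
  | src, src, _, _, _, _, h => 𝟙 h
  | tgt, tgt, _, _, _, _, h => 𝟙 h
  | src, tgt, tgt, _, _, η, _ => η
  | src, tgt, src, _, _, _, h => h.as.elim
  | tgt, src, _, f, _, _, _ => f.as.elim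

/-- The associator of `2[X]` (an identity). -/
def assocIso : {a b c d : Susp X} → (f : a ⟶ b) → (g : b ⟶ c) → (h : c ⟶ d) →
    ((f ≫ g) ≫ h ≅ f ≫ g ≫ h)
  | src, src, _, _, _, g, h => Iso.refl (g ≫ h)
  | tgt, tgt, _, _, _, g, h => Iso.refl (g ≫ h)
  | src, tgt, tgt, _, f, _, h => Iso.refl (f ≫ h)
  | src, tgt, src, _, _, g, _ => g.as.elim
  | tgt, src, _, _, f, _, _ => f.as.elim

/-- The left unitor of `2[X]` (an identity). -/
def leftIso : {a b : Susp X} → (f : a ⟶ b) → (𝟙 a ≫ f ≅ f)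
  | src, _, f => Iso.refl f
  | tgt, _, f => Iso.refl f

/-- The right unitor of `2[X]` (an identity). -/
def rightIso : {a b : Susp X} → (f : a ⟶ b) → (f ≫ 𝟙 b ≅ f)
  | src, src, f => Iso.refl f
  | tgt, tgt, f => Iso.refl f
  | src, tgt, f => Iso.refl f
  | tgt, src, f => f.as.elim

instance : Bicategory (Susp X) where
  whiskerLeft := whiskerL
  whiskerRight := whiskerR
  associator := assocIso
  leftUnitor := leftIso
  rightUnitor := rightIso
  whiskerLeft_id {a b c} f g := by
    cases a <;> cases b <;> cases c <;>
    first
      | exact (f : Discrete PEmpty).as.elim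
      | exact (g : Discrete PEmpty).as.elim
      | rfl
  whiskerLeft_comp {a b c} f g h i η θ := by
    cases a <;> cases b <;> cases c <;>
    first
      | exact (f : Discrete PEmpty).as.elim
      | exact (g : Discrete PEmpty).as.elim
      | rfl
      | exact (Category.comp_id _).symm
  id_whiskerLeft {a b} f g η := by
    cases a <;> cases b <;>
    first
      | exact (f : Discrete PEmpty).as.elim
      | rfl
      | exact (Category.comp_id _).symm
      | exact (Category.id_comp _).symm
      | exact ((Category.id_comp _).trans (Category.comp_id _)).symm
  comp_whiskerLeft {a b c d} f g h h' η := by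
    cases a <;> cases b <;> cases c <;> cases d <;>
    first
      | exact (f : Discrete PEmpty).as.elim
      | exact (g : Discrete PEmpty).as.elim
      | exact (h : Discrete PEmpty).as.elim
      | rfl
      | exact (Category.comp_id _).symm
      | exact (Category.id_comp _).symm
      | exact ((Category.id_comp _).trans (Category.comp_id _)).symm
  id_whiskerRight {a b c} f g := by
    cases a <;> cases b <;> cases c <;>
    first
      | exact (f : Discrete PEmpty).as.elim
      | exact (g : Discrete PEmpty).as.elim
      | rfl
  comp_whiskerRight {a b c} f g h η θ i := by
    cases a <;> cases b <;> cases c <;>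
    first
      | exact (f : Discrete PEmpty).as.elim
      | exact (i : Discrete PEmpty).as.elim
      | rfl
      | exact (Category.comp_id _).symm
  whiskerRight_id {a b} f g η := by
    cases a <;> cases b <;>
    first
      | exact (f : Discrete PEmpty).as.elim
      | rfl
      | exact (Category.comp_id _).symm
      | exact (Category.id_comp _).symm
      | exact ((Category.id_comp _).trans (Category.comp_id _)).symm
  whiskerRight_comp {a b c d} f f' η g h := by
    cases a <;> cases b <;> cases c <;> cases d <;>
    first
      | exact (f : Discrete PEmpty).as.elim
      | exact (g : Discrete PEmpty).as.elim
      | exact (h : Discrete PEmpty).as.elim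
      | rfl
      | exact (Category.comp_id _).symm
      | exact (Category.id_comp _).symm
      | exact ((Category.id_comp _).trans (Category.comp_id _)).symm
  whisker_assoc {a b c d} f g g' η h := by
    cases a <;> cases b <;> cases c <;> cases d <;>
    first
      | exact (f : Discrete PEmpty).as.elim
      | exact (g : Discrete PEmpty).as.elim
      | exact (h : Discrete PEmpty).as.elim
      | rfl
      | exact (Category.comp_id _).symm
      | exact (Category.id_comp _).symm
      | exact ((Category.id_comp _).trans (Category.comp_id _)).symm
  whisker_exchange {a b c} f g h i η θ := by
    cases a <;> cases b <;> cases c <;>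
    first
      | exact (f : Discrete PEmpty).as.elim
      | exact (h : Discrete PEmpty).as.elim
      | rfl
      | exact (Category.comp_id _).symm
      | exact (Category.id_comp _).symm
      | exact ((Category.id_comp _).trans (Category.comp_id _)).symm
      | exact (Category.comp_id _).trans (Category.id_comp _).symm
      | exact (Category.id_comp _).trans (Category.comp_id _).symm
  pentagon {a b c d e} f g h i := by
    cases a <;> cases b <;> cases c <;> cases d <;> cases e <;>
    first
      | exact (f : Discrete PEmpty).as.elim
      | exact (g : Discrete PEmpty).as.elim
      | exact (h : Discrete PEmpty).as.elim
      | exact (i : Discrete PEmpty).as.elim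
      | rfl
      | exact (Category.comp_id _).symm
      | exact (Category.id_comp _).symm
      | exact ((Category.id_comp _).trans (Category.comp_id _)).symm
      | exact (Category.comp_id _).trans (Category.id_comp _).symm
      | exact (Category.id_comp _).trans (Category.comp_id _).symm
      | exact Category.id_comp _
  triangle {a b c} f g := by
    cases a <;> cases b <;> cases c <;>
    first
      | exact (f : Discrete PEmpty).as.elim
      | exact (g : Discrete PEmpty).as.elim
      | rfl
      | exact (Category.comp_id _).symm
      | exact (Category.id_comp _).symm
      | exact ((Category.id_comp _).trans (Category.comp_id _)).symm
      | exact (Category.comp_id _).trans (Category.id_comp _).symm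
      | exact (Category.id_comp _).trans (Category.comp_id _).symm
      | exact Category.id_comp _

instance : Strict (Susp X) where
  id_comp := id_comp'
  comp_id := comp_id'
  assoc := assoc'
  leftUnitor_eqToIso {a b} f := by
    cases a <;> cases b <;>
    first
      | rfl
  rightUnitor_eqToIso {a b} f := by
    cases a <;> cases b <;>
    first
      | rfl
      | exact (f : Discrete PEmpty).as.elim
  associator_eqToIso {a b c d} f g h := by
    cases a <;> cases b <;> cases c <;> cases d <;>
    first
      | rfl
      | exact (f : Discrete PEmpty).as.elim
      | exact (g : Discrete PEmpty).as.elim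

/-- The 2-functor `2[F] : 2[X] → 2[Y]` induced by a functor `F : X → Y`; it is the identity on
objects and `F` on the hom-category from `src` to `tgt`. -/
def map (F : X ⥤ Y) : StrictPseudofunctor (Susp X) (Susp Y) :=
  StrictPseudofunctor.mk''
    { obj := fun a => match a with
        | src => src
        | tgt => tgt
      map := fun {a b} => match a, b with
        | src, src => fun f => f
        | src, tgt => fun f => F.obj f
        | tgt, src => fun f => f
        | tgt, tgt => fun f => f
      map₂ := fun {a b f g} => match a, b, f, g with
        | src, src, _, _ => fun η => η
        | src, tgt, _, _ => fun η => F.map η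
        | tgt, src, _, _ => fun η => η
        | tgt, tgt, _, _ => fun η => η
      map₂_id := fun {a b} f => by
        cases a <;> cases b <;> first | rfl | exact F.map_id _
      map₂_comp := fun {a b f g h} η θ => by
        cases a <;> cases b <;> first | rfl | exact F.map_comp _ _
      map_id := fun a => by cases a <;> rfl
      map_comp := fun {a b c} f g => by
        cases a <;> cases b <;> cases c <;>
        first
          | rfl
      map₂_whisker_left := fun {a b c} f {g h} η => by
        cases a <;> cases b <;> cases c <;>
        first
          | rfl
          | exact (f : Discrete PEmpty).as.elim
          | exact (g : Discrete PEmpty).as.elim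
          | exact ((Category.id_comp _).trans (Category.comp_id _)).symm
          | exact (F.map_id _).trans ((Category.id_comp _).trans (Category.comp_id _)).symm
      map₂_whisker_right := fun {a b c f g} η h => by
        cases a <;> cases b <;> cases c <;>
        first
          | rfl
          | exact (f : Discrete PEmpty).as.elim
          | exact (h : Discrete PEmpty).as.elim
          | exact ((Category.id_comp _).trans (Category.comp_id _)).symm
          | exact (F.map_id _).trans ((Category.id_comp _).trans (Category.comp_id _)).symm }

end Susp

/-! ### The category of 2-categories and 2-functors -/

/-- A small 2-category: a strict bicategory with objects, 1-cells and 2-cells in `Type u`. -/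
structure TwoCat : Type (u + 1) where
  /-- The type of objects. -/
  carrier : Type u
  [bicategory : Bicategory.{u, u} carrier]
  [strict : Strict carrier]

namespace TwoCat

instance : CoeSort TwoCat.{u} (Type u) := ⟨carrier⟩

attribute [instance] bicategory strict

/-- 2-functors are equal as soon as they agree on objects, 1-cells and 2-cells. -/
lemma functor_ext {A B : Type u} [Bicategory.{u, u} A] [Bicategory.{u, u} B]
    {F G : StrictPseudofunctor A B}
    (h : F.toPrelaxFunctor = G.toPrelaxFunctor) : F = G := by
  obtain ⟨⟨⟨F0, Fi, Fc, _, _, _, _, _⟩, h1, h2⟩, h3, h4⟩ := F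
  obtain ⟨⟨⟨G0, Gi, Gc, _, _, _, _, _⟩, k1, k2⟩, k3, k4⟩ := G
  change F0 = G0 at h
  subst h
  obtain rfl : Fi = Gi := by
    funext x
    exact (h2 x).trans (k2 x).symm
  obtain rfl : @Fc = @Gc := by
    funext a b c f g
    exact (h4 f g).trans (k4 f g).symm
  rfl

/-- The category `2-Cat` of small 2-categories and (strict) 2-functors. -/
instance : Category TwoCat.{u} where
  Hom A B := StrictPseudofunctor A B
  id A := StrictPseudofunctor.id A
  comp F G := F.comp G
  id_comp _ := functor_ext rfl
  comp_id _ := functor_ext rfl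
  assoc _ _ _ := functor_ext rfl

end TwoCat

/-! ### The internal hom `Gray(P, B)` and powers -/

section Gray
variable {P : Type v} [Bicategory.{v, v} P] {B : Type u} [Bicategory.{u, u} B]

lemma strongTrans_eq {F G : Pseudofunctor P B} {η θ : F ⟶ G} (h : ∀ x, η.app x = θ.app x)
    (Γ : η ⟶ θ) (hΓ : ∀ x, Γ.as.app x = eqToHom (h x)) : η = θ := by
  obtain ⟨η0, η1, _, _, _⟩ := η
  obtain ⟨θ0, θ1, _, _, _⟩ := θ
  obtain rfl : η0 = θ0 := funext h
  obtain rfl : @η1 = @θ1 := by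
    funext a b f
    have := Γ.as.naturality f
    ext
    simpa [hΓ] using this.symm
  rfl

lemma eqToHom_as_app {F G : Pseudofunctor P B} {η θ : F ⟶ G} (h : η = θ) (x : P) :
    (eqToHom h).as.app x = eqToHom (by rw [h]) := by
  subst h; rfl

instance [Strict B] : Strict (Pseudofunctor P B) where
  id_comp η := strongTrans_eq (fun x => Strict.id_comp _) (λ_ η).hom
    (fun x => by simp [Strict.leftUnitor_eqToIso]; rfl)
  comp_id η := strongTrans_eq (fun x => Strict.comp_id _) (ρ_ η).hom
    (fun x => by simp [Strict.rightUnitor_eqToIso]; rfl)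
  assoc η θ ι := strongTrans_eq (fun x => Strict.assoc _ _ _) (α_ η θ ι).hom
    (fun x => by simp [Strict.associator_eqToIso])
  leftUnitor_eqToIso η := by
    ext x
    simp [Strict.leftUnitor_eqToIso, eqToHom_as_app]; rfl
  rightUnitor_eqToIso η := by
    ext x
    simp [Strict.rightUnitor_eqToIso, eqToHom_as_app]; rfl
  associator_eqToIso η θ ι := by
    ext x
    simp [Strict.associator_eqToIso, eqToHom_as_app]

variable (P B) in
/-- `Gray(P, B)`: objects are the (strict) 2-functors `P → B`, 1-cells are pseudonatural
transformations, 2-cells are modifications. -/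
abbrev Gray : Type _ :=
  InducedBicategory (Pseudofunctor P B) (fun F : StrictPseudofunctor P B => F.toPseudofunctor)

/-- A 2-functor `P → B`, as an object of `Gray(P, B)`. -/
abbrev Gray.of (F : StrictPseudofunctor P B) : Gray P B := F

end Gray

section precomp
variable {P : Type v} [Bicategory.{v, v} P] {Q : Type w} [Bicategory.{w, w} Q]
  {B : Type u} [Bicategory.{u, u} B]

lemma eq_conj_id {C : Type u} [Category.{w} C] {X Y : C} (f : X ⟶ Y) : f = 𝟙 X ≫ f ≫ 𝟙 Y := by
  simp

/-- Whiskering a pseudonatural transformation with a 2-functor `i` at its source. -/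
def precompTrans (i : StrictPseudofunctor P Q) {F G : StrictPseudofunctor Q B}
    (η : F.toPseudofunctor ⟶ G.toPseudofunctor) :
    (i.comp F).toPseudofunctor ⟶ (i.comp G).toPseudofunctor where
  app x := η.app (i.obj x)
  naturality f := η.naturality (i.map f)
  naturality_naturality θ := η.naturality_naturality (i.map₂ θ)
  naturality_id x := by
    change (η.naturality (i.map (𝟙 x))).hom ≫
        η.app (i.obj x) ◁ (G.map₂ (i.mapId x).hom ≫ (G.mapId _).hom) =
      (F.map₂ (i.mapId x).hom ≫ (F.mapId _).hom) ▷ _ ≫ _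
    rw [whiskerLeft_comp, ← η.naturality_naturality_assoc, η.naturality_id, comp_whiskerRight]
    exact (Category.assoc _ _ _).symm
  naturality_comp f g := by
    change (η.naturality (i.map (f ≫ g))).hom ≫
        η.app _ ◁ (G.map₂ (i.mapComp f g).hom ≫ (G.mapComp _ _).hom) =
      (F.map₂ (i.mapComp f g).hom ≫ (F.mapComp _ _).hom) ▷ _ ≫ _
    rw [whiskerLeft_comp, ← η.naturality_naturality_assoc, η.naturality_comp, comp_whiskerRight]
    exact (Category.assoc _ _ _).symm

/-- The 2-functor `Gray(i, B) : Gray(Q, B) → Gray(P, B)` given by precomposition with `i`. -/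
def precomp (i : StrictPseudofunctor P Q) : StrictPseudofunctor (Gray Q B) (Gray P B) :=
  StrictPseudofunctor.mk'
    { obj := fun F => Gray.of (i.comp F)
      map := fun η => InducedBicategory.mkHom (precompTrans i η.hom)
      map₂ := fun Γ => InducedBicategory.mkHom₂
        ⟨{ app := fun x => Γ.hom.as.app (i.obj x)
           naturality := fun f => Γ.hom.as.naturality (i.map f) }⟩
      map_id := fun _ => rfl
      map_comp := fun _ _ => rfl
      map₂_whisker_left := fun _ _ _ _ => eq_conj_id _
      map₂_whisker_right := fun _ _ => eq_conj_id _
      map₂_left_unitor := fun _ => (Category.id_comp _).symm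
      map₂_right_unitor := fun _ => (Category.id_comp _).symm
      map₂_associator := fun _ _ _ => eq_conj_id _ }

/-- Evaluation `Gray(P, B) → B` at an object of `P`. -/
def evalAt (x : P) : StrictPseudofunctor (Gray P B) B :=
  StrictPseudofunctor.mk'
    { obj := fun F => F.obj x
      map := fun η => η.hom.app x
      map₂ := fun Γ => Γ.hom.as.app x
      map_id := fun _ => rfl
      map_comp := fun _ _ => rfl
      map₂_whisker_left := fun _ _ _ _ => eq_conj_id _
      map₂_whisker_right := fun _ _ => eq_conj_id _
      map₂_left_unitor := fun _ => (Category.id_comp _).symm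
      map₂_right_unitor := fun _ => (Category.id_comp _).symm
      map₂_associator := fun _ _ _ => eq_conj_id _ }
end precomp

namespace TwoCat

/-- The power `B^P = Gray(P, B)` of a 2-category `B` by a 2-category `P`. -/
def power (B : TwoCat.{u}) (P : TwoCat.{0}) : TwoCat.{u} where
  carrier := Gray P B

/-- The 2-functor `B^i : B^Q → B^P` for a 2-functor `i : P → Q`. -/
def powerMap (B : TwoCat.{u}) {P Q : TwoCat.{0}} (i : P ⟶ Q) : B.power Q ⟶ B.power P :=
  precomp (B := B) (show StrictPseudofunctor P Q from i)

/-- Evaluation `B^P → B` at an object `x` of `P`. -/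
def powerEval (B : TwoCat.{u}) {P : TwoCat.{0}} (x : P) : B.power P ⟶ B :=
  evalAt (P := P) (B := B) x

/-! ### Generating cofibrations of the Lack model structure -/

/-- The 2-category `2[X]`, as an object of `2-Cat`. -/
def two (X : Type) [Category.{0} X] : TwoCat.{0} where
  carrier := Susp X

/-- The 2-functor `2[F] : 2[X] → 2[Y]`, as a morphism of `2-Cat`. -/
def twoMap {X Y : Type} [Category.{0} X] [Category.{0} Y] (F : X ⥤ Y) : two X ⟶ two Y :=
  Susp.map F

/-- The empty 2-category. -/
def empty : TwoCat.{0} where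
  carrier := LocallyDiscrete (Discrete PEmpty)

/-- The terminal 2-category. -/
def point : TwoCat.{0} where
  carrier := LocallyDiscrete (Discrete PUnit)

/-- `i₁`: the unique 2-functor from the empty 2-category to the terminal one. -/
def i₁ : empty ⟶ point :=
  StrictPseudofunctor.mk''
    { obj := fun x => x.as.as.elim
      map := fun {x _} _ => x.as.as.elim
      map₂ := fun {x _ _ _} _ => x.as.as.elim
      map₂_id := fun {x _} _ => x.as.as.elim
      map₂_comp := fun {x _ _ _ _} _ _ => x.as.as.elim
      map_id := fun x => x.as.as.elim
      map_comp := fun {x _ _} _ _ => x.as.as.elim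
      map₂_whisker_left := fun {x _ _} _ _ _ _ => x.as.as.elim
      map₂_whisker_right := fun {x _ _ _ _} _ _ => x.as.as.elim }

/-- `i₂ = 2[∅ → 1]`: the inclusion of two objects into the free 1-cell. -/
def i₂ : two (Discrete PEmpty) ⟶ two (Discrete PUnit) :=
  twoMap (Functor.empty (Discrete PUnit))

/-- `i₃ = 2[1 + 1 → (0 → 1)]`: the inclusion of a free parallel pair of 1-cells into the free
2-cell. -/
def i₃ : two (Discrete (Fin 2)) ⟶ two (Fin 2) :=
  twoMap (Discrete.functor fun j => j)

/-- `i₄`: the 2-functor from the free parallel pair of 2-cells to the free 2-cell which identifies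
the two 2-cells. -/
def i₄ : two Limits.WalkingParallelPair ⟶ two (Fin 2) :=
  twoMap (Limits.parallelPair (homOfLE (Fin.zero_le (1 : Fin 2))) (homOfLE (Fin.zero_le 1)))

/-- `k = 2[1 + 1 → 𝕀]`, with `𝕀` the free isomorphism: the inclusion of a free parallel pair of
1-cells into the free invertible 2-cell. -/
def k : two (Discrete (Fin 2)) ⟶ two (Codiscrete (Fin 2)) :=
  twoMap (Discrete.functor Codiscrete.mk)

/-- The generating cofibrations `i₁, i₂, i₃, i₄` of the Lack model structure on `2-Cat`. -/
inductive generatingCofibrations : MorphismProperty TwoCat.{0}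
  | mk₁ : generatingCofibrations i₁
  | mk₂ : generatingCofibrations i₂
  | mk₃ : generatingCofibrations i₃
  | mk₄ : generatingCofibrations i₄

/-- The 2-functors `B^i : B^Q → B^P` for a 2-category `B` and a generating cofibration
`i : P → Q`. -/
inductive powersOfGeneratingCofibrations : MorphismProperty TwoCat.{u}
  | mk (B : TwoCat.{u}) {P Q : TwoCat.{0}} (i : P ⟶ Q) (hi : generatingCofibrations i) :
      powersOfGeneratingCofibrations (B.powerMap i)

/-- Finite composites of pullbacks (in `2-Cat`) of powers of generating cofibrations. -/
def finiteCompositesOfPullbacks : MorphismProperty TwoCat.{u} :=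
  powersOfGeneratingCofibrations.pullbacks.multiplicativeClosure

/-! ### Inserters and equifiers -/

/-- For a category `X`, a 2-functor `c : A → B^{2[X]}` amounts to a pair of 2-functors
`F, G : A → B` with an `X`-shaped diagram of pseudonatural transformations `F ⇒ G` and
modifications between them. This says that the two 2-functors are `F` and `G`. -/
def Between {X : Type} [Category.{0} X] {A B : TwoCat.{u}} (c : A ⟶ B.power (two X))
    (F G : A ⟶ B) : Prop :=
  c ≫ B.powerEval (P := two X) Susp.src = F ∧ c ≫ B.powerEval (P := two X) Susp.tgt = G

/-- `p : I → A` is the 2-cell inserter of `F, G : A → B`, that is, the pullback of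
`B^{i₂} : B^{2[1]} → B^{1 + 1} ≅ B × B` along `(F, G) : A → B × B`. -/
def IsTwoCellInserter {A B I : TwoCat.{u}} (F G : A ⟶ B) (p : I ⟶ A) : Prop :=
  ∃ (FG : A ⟶ B.power (two (Discrete PEmpty))) (φ : I ⟶ B.power (two (Discrete PUnit))),
    Between FG F G ∧ IsPullback φ p (B.powerMap i₂) FG

/-- `p : I → A` is the iso-3-cell inserter of a parallel pair of pseudonatural transformations
`α, β : F ⇒ G` between 2-functors `A → B`, that is, the pullback of `B^k` along the 2-functor
`(α, β) : A → B^{2[1 + 1]}`. -/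
def IsIsoThreeCellInserter {A B I : TwoCat.{u}} (F G : A ⟶ B) (p : I ⟶ A) : Prop :=
  ∃ (αβ : A ⟶ B.power (two (Discrete (Fin 2)))) (Γ : I ⟶ B.power (two (Codiscrete (Fin 2)))),
    Between αβ F G ∧ IsPullback Γ p (B.powerMap k) αβ

/-- `p : I → A` is the 3-cell equifier of a parallel pair of modifications `Γ, Δ : α ⇛ β` between
pseudonatural transformations `α, β : F ⇒ G` of 2-functors `A → B`, that is, the pullback of
`B^{i₄}` along the 2-functor `(Γ, Δ) : A → B^{2[⇉]}`. -/
def IsThreeCellEquifier {A B I : TwoCat.{u}} (F G : A ⟶ B) (p : I ⟶ A) : Prop :=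
  ∃ (ΓΔ : A ⟶ B.power (two Limits.WalkingParallelPair)) (Θ : I ⟶ B.power (two (Fin 2))),
    Between ΓΔ F G ∧ IsPullback Θ p (B.powerMap i₄) ΓΔ

/-! ### Equiv-fibrations -/

/-- Equiv-fibrations: 2-functors that are isofibrations on hom-categories and lift adjoint
equivalences. -/
structure IsEquivFibration {E B : TwoCat.{u}} (F : E ⟶ B) : Prop where
  lift_iso {x y : E} (f : x ⟶ y) (g : F.obj x ⟶ F.obj y) (θ : F.map f ≅ g) :
    ∃ (g' : x ⟶ y) (θ' : f ≅ g'), F.map g' = g ∧ HEq (F.map₂ θ'.hom) θ.hom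
  lift_equivalence (y : E) (b : B) (e : Bicategory.Equivalence b (F.obj y)) :
    ∃ (x : E) (e' : Bicategory.Equivalence x y), F.obj x = b ∧
      HEq (F.map e'.hom) e.hom ∧ HEq (F.map e'.inv) e.inv ∧
      HEq (F.map₂ e'.unit.hom) e.unit.hom ∧ HEq (F.map₂ e'.counit.hom) e.counit.hom

end TwoCat

/-! ### Squares in a bicategory

A square with top `f`, left side `k`, right side `k'` and bottom `g` is a 2-cell
`f ≫ k' ⟶ k ≫ g`. -/

section squares
variable {A : Type u} [Bicategory.{w, v} A]

/-- Vertical pasting of two squares: the square with left side `k ≫ l` and right side `k' ≫ l'`. -/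
def vpaste {a a' b b' c c' : A} {f : a ⟶ a'} {g : b ⟶ b'} {h : c ⟶ c'} {k : a ⟶ b} {k' : a' ⟶ b'}
    {l : b ⟶ c} {l' : b' ⟶ c'} (s : f ≫ k' ⟶ k ≫ g) (t : g ≫ l' ⟶ l ≫ h) :
    f ≫ k' ≫ l' ⟶ (k ≫ l) ≫ h :=
  (α_ f k' l').inv ≫ s ▷ l' ≫ (α_ k g l').hom ≫ k ◁ t ≫ (α_ k l h).inv

/-- Horizontal pasting of two squares: the square with top `f ≫ f'` and bottom `g ≫ g'`. -/
def hpaste {a a' a'' b b' b'' : A} {f : a ⟶ a'} {f' : a' ⟶ a''} {g : b ⟶ b'} {g' : b' ⟶ b''}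
    {k : a ⟶ b} {k' : a' ⟶ b'} {k'' : a'' ⟶ b''} (s : f ≫ k' ⟶ k ≫ g) (t : f' ≫ k'' ⟶ k' ≫ g') :
    (f ≫ f') ≫ k'' ⟶ k ≫ g ≫ g' :=
  (α_ f f' k'').hom ≫ f ◁ t ≫ (α_ f k' g').inv ≫ s ▷ g' ≫ (α_ k g g').hom

lemma hpaste_cell {a a' a'' b b' b'' : A} {f : a ⟶ a'} {f' : a' ⟶ a''} {g : b ⟶ b'} {g' : b' ⟶ b''}
    {k l : a ⟶ b} {k' l' : a' ⟶ b'} {k'' l'' : a'' ⟶ b''}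
    {s : f ≫ k' ⟶ k ≫ g} {t : f' ≫ k'' ⟶ k' ≫ g'}
    {p : f ≫ l' ⟶ l ≫ g} {q : f' ≫ l'' ⟶ l' ≫ g'}
    {Γ : k ⟶ l} {Γ' : k' ⟶ l'} {Γ'' : k'' ⟶ l''}
    (h : f ◁ Γ' ≫ p = s ≫ Γ ▷ g) (h' : f' ◁ Γ'' ≫ q = t ≫ Γ' ▷ g') :
    (f ≫ f') ◁ Γ'' ≫ hpaste p q = hpaste s t ≫ Γ ▷ (g ≫ g') := by
  unfold hpaste
  calc
    _ = 𝟙 _ ⊗≫ f ◁ (f' ◁ Γ'' ≫ q) ⊗≫ p ▷ g' ⊗≫ 𝟙 _ := by bicategory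
    _ = 𝟙 _ ⊗≫ f ◁ t ⊗≫ (f ◁ Γ' ≫ p) ▷ g' ⊗≫ 𝟙 _ := by rw [h']; bicategory
    _ = _ := by rw [h]; bicategory

lemma vpaste_hpaste {a a' a'' b b' b'' c c' c'' : A}
    {f : a ⟶ a'} {f' : a' ⟶ a''} {g : b ⟶ b'} {g' : b' ⟶ b''} {h : c ⟶ c'} {h' : c' ⟶ c''}
    {k : a ⟶ b} {k' : a' ⟶ b'} {k'' : a'' ⟶ b''}
    {l : b ⟶ c} {l' : b' ⟶ c'} {l'' : b'' ⟶ c''}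
    (s : f ≫ k' ⟶ k ≫ g) (s' : f' ≫ k'' ⟶ k' ≫ g')
    (t : g ≫ l' ⟶ l ≫ h) (t' : g' ≫ l'' ⟶ l' ≫ h') :
    vpaste (hpaste s s') (hpaste t t') = hpaste (vpaste s t) (vpaste s' t') := by
  unfold vpaste hpaste
  calc
    _ = 𝟙 _ ⊗≫ f ◁ s' ▷ l'' ⊗≫ (s ▷ (g' ≫ l'') ≫ (k ≫ g) ◁ t') ⊗≫ k ◁ t ▷ h' ⊗≫ 𝟙 _ := by
      bicategory
    _ = _ := by rw [← whisker_exchange]; bicategory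


lemma vpaste_whisker {a a' b b' c c' : A} {f e : a ⟶ a'} {g : b ⟶ b'} {h : c ⟶ c'}
    {k : a ⟶ b} {k' : a' ⟶ b'} {l : b ⟶ c} {l' : b' ⟶ c'} (x : e ⟶ f) (s : f ≫ k' ⟶ k ≫ g)
    (t : g ≫ l' ⟶ l ≫ h) :
    vpaste (x ▷ k' ≫ s) t = x ▷ (k' ≫ l') ≫ vpaste s t := by
  unfold vpaste
  bicategory

lemma vpaste_slide {a a' b b' c c' : A} {f : a ⟶ a'} {g d : b ⟶ b'} {h : c ⟶ c'}
    {k : a ⟶ b} {k' : a' ⟶ b'} {l : b ⟶ c} {l' : b' ⟶ c'} (s : f ≫ k' ⟶ k ≫ g)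
    (y : g ⟶ d) (t : d ≫ l' ⟶ l ≫ h) :
    vpaste s (y ▷ l' ≫ t) = vpaste (s ≫ k ◁ y) t := by
  unfold vpaste
  bicategory

/-- The square with identity vertical sides. -/
def idSq {a b : A} (f : a ⟶ b) : f ≫ 𝟙 b ⟶ 𝟙 a ≫ f := (ρ_ f).hom ≫ (λ_ f).inv

/-- The square with identity horizontal sides. -/
def vidSq {a b : A} (k : a ⟶ b) : 𝟙 a ≫ k ⟶ k ≫ 𝟙 b := (λ_ k).hom ≫ (ρ_ k).inv

lemma hpaste_idSq {a b c : A} (f : a ⟶ b) (g : b ⟶ c) :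
    hpaste (idSq f) (idSq g) = idSq (f ≫ g) := by
  unfold hpaste idSq
  bicategory

lemma vpaste_vidSq {a b c : A} (k : a ⟶ b) (l : b ⟶ c) :
    vpaste (vidSq k) (vidSq l) = vidSq (k ≫ l) := by
  unfold vpaste vidSq
  bicategory

lemma vidSq_cell {a b : A} {k l : a ⟶ b} (Γ : k ⟶ l) :
    𝟙 a ◁ Γ ≫ vidSq l = vidSq k ≫ Γ ▷ 𝟙 b := by
  simp [vidSq]

/-- The image of a square under a 2-functor. -/
def mapSq (S : StrictPseudofunctor A A) {a a' b b' : A} {f : a ⟶ a'} {g : b ⟶ b'} {k : a ⟶ b}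
    {k' : a' ⟶ b'} (s : f ≫ k' ⟶ k ≫ g) : S.map f ≫ S.map k' ⟶ S.map k ≫ S.map g :=
  (S.mapComp f k').inv ≫ S.map₂ s ≫ (S.mapComp k g).hom

/-- The image of a 2-cell `𝟙 ⟶ f ≫ g` under a 2-functor. -/
def mapTri (S : StrictPseudofunctor A A) {a b : A} {f : a ⟶ b} {g : b ⟶ a}
    (t : 𝟙 a ⟶ f ≫ g) : 𝟙 (S.obj a) ⟶ S.map f ≫ S.map g :=
  (S.mapId a).inv ≫ S.map₂ t ≫ (S.mapComp f g).hom

lemma mapSq_hpaste (S : StrictPseudofunctor A A) {a a' a'' b b' b'' : A} {f : a ⟶ a'}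
    {f' : a' ⟶ a''} {g : b ⟶ b'} {g' : b' ⟶ b''}
    {k : a ⟶ b} {k' : a' ⟶ b'} {k'' : a'' ⟶ b''} (s : f ≫ k' ⟶ k ≫ g) (t : f' ≫ k'' ⟶ k' ≫ g')
    {e : a ⟶ a''} (x : e ⟶ f ≫ f') :
    mapSq S (x ▷ k'' ≫ hpaste s t) ≫ S.map k ◁ (S.mapComp g g').hom =
      (S.map₂ x ≫ (S.mapComp f f').hom) ▷ S.map k'' ≫ hpaste (mapSq S s) (mapSq S t) := by
  have h : (S.mapComp f (k' ≫ g')).inv ≫ S.map₂ (α_ f k' g').inv ≫ (S.mapComp (f ≫ k') g').hom =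
      S.map f ◁ (S.mapComp k' g').hom ≫ (α_ (S.map f) (S.map k') (S.map g')).inv ≫
        (S.mapComp f k').inv ▷ S.map g' := by
    rw [Iso.inv_comp_eq, Pseudofunctor.mapComp_assoc_right_hom_assoc]
    simp
  unfold mapSq hpaste
  simp [reassoc_of% h]

lemma mapSq_vidSq (S : StrictPseudofunctor A A) {a b : A} (k : a ⟶ b) {e : a ⟶ a}
    (x : e ⟶ 𝟙 a) :
    mapSq S (x ▷ k ≫ vidSq k) ≫ S.map k ◁ (S.mapId b).hom =
      (S.map₂ x ≫ (S.mapId a).hom) ▷ S.map k ≫ vidSq (S.map k) := by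
  have h : S.map₂ (ρ_ k).inv ≫ (S.mapComp k (𝟙 b)).hom ≫ S.map k ◁ (S.mapId b).hom =
      (ρ_ (S.map k)).inv := by
    have e : (S.mapComp k (𝟙 b)).hom ≫ S.map k ◁ (S.mapId b).hom =
        S.map₂ (ρ_ k).hom ≫ (ρ_ (S.map k)).inv := by
      rw [S.map₂_right_unitor]
      simp
    rw [e, ← S.map₂_comp_assoc]
    simp
  unfold mapSq vidSq
  simp [h]

end squares

/-! ### Pseudomonads -/

/-- A 2-functor `S : A → A` with pseudonatural transformations `η : 1 ⇒ S` and `μ : S² ⇒ S`. -/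
structure PseudomonadData (A : Type u) [Bicategory.{w, v} A] where
  S : StrictPseudofunctor A A
  unitTrans : Pseudofunctor.id A ⟶ S.toPseudofunctor
  multTrans : (S.comp S).toPseudofunctor ⟶ S.toPseudofunctor

namespace PseudomonadData
variable {A : Type u} [Bicategory.{w, v} A] (T : PseudomonadData A)

/-- The 1-cell `η_x : x ⟶ S x`. -/
def η (x : A) : x ⟶ T.S.obj x := T.unitTrans.app x
/-- The 1-cell `μ_x : S² x ⟶ S x`. -/
def μ (x : A) : T.S.obj (T.S.obj x) ⟶ T.S.obj x := T.multTrans.app x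
/-- The invertible 2-cell `f ≫ η_y ⟶ η_x ≫ S f` of the pseudonaturality of `η`. -/
def ηSq {x y : A} (f : x ⟶ y) : f ≫ T.η y ⟶ T.η x ≫ T.S.map f := (T.unitTrans.naturality f).hom
/-- The invertible 2-cell `S² f ≫ μ_y ⟶ μ_x ≫ S f` of the pseudonaturality of `μ`. -/
def μSq {x y : A} (f : x ⟶ y) : T.S.map (T.S.map f) ≫ T.μ y ⟶ T.μ x ≫ T.S.map f :=
  (T.multTrans.naturality f).hom

lemma ηSq_comp {x y z : A} (f : x ⟶ y) (g : y ⟶ z) :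
    T.ηSq (f ≫ g) ≫ T.η x ◁ (T.S.mapComp f g).hom = hpaste (T.ηSq f) (T.ηSq g) := by
  have := T.unitTrans.naturality_comp f g
  refine this.trans ?_
  exact (congrArg (· ≫ _) (id_whiskerRight _ _)).trans (Category.id_comp _)

lemma ηSq_id (x : A) :
    T.ηSq (𝟙 x) ≫ T.η x ◁ (T.S.mapId x).hom = vidSq (T.η x) := by
  have := T.unitTrans.naturality_id x
  refine this.trans ?_
  exact (congrArg (· ≫ _) (id_whiskerRight _ _)).trans (Category.id_comp _)

lemma μSq_comp {x y z : A} (f : x ⟶ y) (g : y ⟶ z) :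
    T.μSq (f ≫ g) ≫ T.μ x ◁ (T.S.mapComp f g).hom =
      (T.S.map₂ (T.S.mapComp f g).hom ≫ (T.S.mapComp _ _).hom) ▷ T.μ z ≫
        hpaste (T.μSq f) (T.μSq g) :=
  T.multTrans.naturality_comp f g

lemma μSq_id (x : A) :
    T.μSq (𝟙 x) ≫ T.μ x ◁ (T.S.mapId x).hom =
      (T.S.map₂ (T.S.mapId x).hom ≫ (T.S.mapId _).hom) ▷ T.μ x ≫ vidSq (T.μ x) :=
  T.multTrans.naturality_id x


/-- The associativity coherence for `a : S x ⟶ x` and `m : S a ≫ a ⟶ μ ≫ a`: the composites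
`S²a ≫ S a ≫ a ⟶ Sμ ≫ S a ≫ a ⟶ Sμ ≫ μ ≫ a ⟶ μ_S ≫ μ ≫ a` of `S m`, `m`, `α` and
`S²a ≫ S a ≫ a ⟶ S²a ≫ μ ≫ a ⟶ μ_S ≫ S a ≫ a ⟶ μ_S ≫ μ ≫ a` of `m`, `μ_a`, `m` agree. -/
def AssocCoh (α : ∀ x, T.S.map (T.μ x) ≫ T.μ x ⟶ T.μ (T.S.obj x) ≫ T.μ x)
    {x : A} (a : T.S.obj x ⟶ x) (m : T.S.map a ≫ a ⟶ T.μ x ≫ a) : Prop :=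
  mapSq T.S m ▷ a ≫ (α_ (T.S.map (T.μ x)) (T.S.map a) a).hom ≫ T.S.map (T.μ x) ◁ m ≫
      (α_ (T.S.map (T.μ x)) (T.μ x) a).inv ≫ α x ▷ a =
    (α_ (T.S.map (T.S.map a)) (T.S.map a) a).hom ≫ T.S.map (T.S.map a) ◁ m ≫
      (α_ (T.S.map (T.S.map a)) (T.μ x) a).inv ≫ T.μSq a ▷ a ≫
      (α_ (T.μ (T.S.obj x)) (T.S.map a) a).hom ≫ T.μ (T.S.obj x) ◁ m ≫
      (α_ (T.μ (T.S.obj x)) (T.μ x) a).inv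

/-- The unit coherence for `a : S x ⟶ x`, `u : 𝟙 ⟶ η ≫ a`, `m : S a ≫ a ⟶ μ ≫ a`: the composite
`a ⟶ Sη ≫ S a ≫ a ⟶ Sη ≫ μ ≫ a ⟶ a` of `S u`, `m` and `ρ` is the identity. -/
def UnitCoh (ρ : ∀ x, T.S.map (T.η x) ≫ T.μ x ⟶ 𝟙 (T.S.obj x))
    {x : A} (a : T.S.obj x ⟶ x) (u : 𝟙 x ⟶ T.η x ≫ a) (m : T.S.map a ≫ a ⟶ T.μ x ≫ a) : Prop :=
  (λ_ a).inv ≫ mapTri T.S u ▷ a ≫ (α_ (T.S.map (T.η x)) (T.S.map a) a).hom ≫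
      T.S.map (T.η x) ◁ m ≫ (α_ (T.S.map (T.η x)) (T.μ x) a).inv ≫ ρ x ▷ a ≫ (λ_ a).hom = 𝟙 a

end PseudomonadData

/-- A pseudomonad on `A` whose underlying endomorphism is a 2-functor: `S`, `η`, `μ` with
invertible modifications `λ : 1_S ⇛ μ.η_S`, `ρ : μ.Sη ⇛ 1_S`, `α : μ.Sμ ⇛ μ.μ_S` satisfying the
associativity (pentagon) and unit coherence conditions. -/
structure Pseudomonad (A : Type u) [Bicategory.{w, v} A] extends PseudomonadData A where
  lam (x : A) : 𝟙 (S.obj x) ≅ toPseudomonadData.η (S.obj x) ≫ toPseudomonadData.μ x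
  rho (x : A) : S.map (toPseudomonadData.η x) ≫ toPseudomonadData.μ x ≅ 𝟙 (S.obj x)
  assoc (x : A) : S.map (toPseudomonadData.μ x) ≫ toPseudomonadData.μ x ≅
    toPseudomonadData.μ (S.obj x) ≫ toPseudomonadData.μ x
  lam_modification {x y : A} (f : x ⟶ y) :
    S.map f ◁ (lam y).hom ≫ vpaste (toPseudomonadData.ηSq (S.map f)) (toPseudomonadData.μSq f) =
      idSq (S.map f) ≫ (lam x).hom ▷ S.map f
  rho_modification {x y : A} (f : x ⟶ y) :
    S.map f ◁ (rho y).hom ≫ idSq (S.map f) =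
      vpaste (mapSq S (toPseudomonadData.ηSq f)) (toPseudomonadData.μSq f) ≫
        (rho x).hom ▷ S.map f
  assoc_modification {x y : A} (f : x ⟶ y) :
    S.map (S.map (S.map f)) ◁ (assoc y).hom ≫
        vpaste (toPseudomonadData.μSq (S.map f)) (toPseudomonadData.μSq f) =
      vpaste (mapSq S (toPseudomonadData.μSq f)) (toPseudomonadData.μSq f) ≫
        (assoc x).hom ▷ S.map f
  assocCoh (x : A) : toPseudomonadData.AssocCoh (fun x => (assoc x).hom) (toPseudomonadData.μ x)
    (assoc x).hom
  unitCoh (x : A) : toPseudomonadData.UnitCoh (fun x => (rho x).hom) (toPseudomonadData.μ x)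
    (lam x).hom (assoc x).hom

variable {A : Type u} [Bicategory.{w, v} A]

/-! ### The 2-category of pseudoalgebras -/

/-- A pseudoalgebra `(X, φ, u, m)` with `φ : S X ⟶ X` and invertible 2-cells `u : 1 ⇒ φ.η_X` and
`m : φ.Sφ ⇒ φ.μ_X` satisfying the associativity and unit coherence conditions. -/
structure Pseudoalgebra (T : Pseudomonad A) where
  obj : A
  act : T.S.obj obj ⟶ obj
  unit : 𝟙 obj ≅ T.η obj ≫ act
  mult : T.S.map act ≫ act ≅ T.μ obj ≫ act
  assocCoh : T.AssocCoh (fun x => (T.assoc x).hom) act mult.hom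
  unitCoh : T.UnitCoh (fun x => (T.rho x).hom) act unit.hom mult.hom

namespace Pseudoalgebra
variable {T : Pseudomonad A}

/-- A pseudomorphism `(f, f̄)` with `f̄ : ψ.Sf ⇒ f.φ` invertible, compatible with the
multiplications and the units of the pseudoalgebras. -/
structure Hom (X Y : Pseudoalgebra T) where
  hom : X.obj ⟶ Y.obj
  cell : T.S.map hom ≫ Y.act ≅ X.act ≫ hom
  mult_coh : T.S.map (T.S.map hom) ◁ Y.mult.hom ≫ vpaste (T.μSq hom) cell.hom =
    vpaste (mapSq T.S cell.hom) cell.hom ≫ X.mult.hom ▷ hom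
  unit_coh : hom ◁ Y.unit.hom ≫ vpaste (T.ηSq hom) cell.hom = idSq hom ≫ X.unit.hom ▷ hom

/-- A 2-cell of pseudoalgebras `(f, f̄) ⇒ (g, ḡ)`: a 2-cell `γ : f ⇒ g` compatible with `f̄` and
`ḡ`. -/
@[ext]
structure Hom₂ {X Y : Pseudoalgebra T} (f g : Hom X Y) where
  hom : f.hom ⟶ g.hom
  coh : T.S.map₂ hom ▷ Y.act ≫ g.cell.hom = f.cell.hom ≫ X.act ◁ hom

/-- The identity pseudomorphism. -/
def Hom.id (X : Pseudoalgebra T) : Hom X X where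
  hom := 𝟙 X.obj
  cell := whiskerRightIso (T.S.mapId X.obj) X.act ≪≫ λ_ X.act ≪≫ (ρ_ X.act).symm
  mult_coh := by
    simp only [Iso.trans_hom, whiskerRightIso_hom, Iso.symm_hom]
    change _ ≫ vpaste _ (_ ≫ vidSq X.act) = vpaste (mapSq _ (_ ≫ vidSq X.act)) (_ ≫ vidSq X.act) ≫ _
    rw [vpaste_slide, vpaste_slide, T.μSq_id, mapSq_vidSq, vpaste_whisker, vpaste_whisker,
      vpaste_vidSq, vpaste_vidSq, whisker_exchange_assoc, Category.assoc, vidSq_cell]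
  unit_coh := by
    simp only [Iso.trans_hom, whiskerRightIso_hom, Iso.symm_hom]
    change _ ≫ vpaste _ (_ ≫ vidSq X.act) = _
    rw [vpaste_slide, T.ηSq_id, vpaste_vidSq, vidSq_cell]
    simp [vidSq, idSq]

/-- Composition of pseudomorphisms; the 2-cell is the horizontal pasting of the two 2-cells. -/
def Hom.comp {X Y Z : Pseudoalgebra T} (f : Hom X Y) (g : Hom Y Z) : Hom X Z where
  hom := f.hom ≫ g.hom
  cell := whiskerRightIso (T.S.mapComp f.hom g.hom) Z.act ≪≫ α_ _ _ _ ≪≫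
    whiskerLeftIso (T.S.map f.hom) g.cell ≪≫ (α_ _ _ _).symm ≪≫
    whiskerRightIso f.cell g.hom ≪≫ α_ _ _ _
  mult_coh := by
    simp only [Iso.trans_hom, whiskerRightIso_hom, Iso.symm_hom, whiskerLeftIso_hom]
    change _ ≫ vpaste _ (_ ≫ hpaste f.cell.hom g.cell.hom) =
      vpaste (mapSq _ (_ ≫ hpaste f.cell.hom g.cell.hom)) (_ ≫ hpaste f.cell.hom g.cell.hom) ≫ _
    rw [vpaste_slide, vpaste_slide, T.μSq_comp, mapSq_hpaste, vpaste_whisker, vpaste_whisker,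
      vpaste_hpaste, vpaste_hpaste, whisker_exchange_assoc, Category.assoc,
      hpaste_cell f.mult_coh g.mult_coh]
  unit_coh := by
    simp only [Iso.trans_hom, whiskerRightIso_hom, Iso.symm_hom, whiskerLeftIso_hom]
    change _ ≫ vpaste _ (_ ≫ hpaste f.cell.hom g.cell.hom) = _
    rw [vpaste_slide, T.ηSq_comp, vpaste_hpaste, hpaste_cell f.unit_coh g.unit_coh, hpaste_idSq]

instance : CategoryStruct (Pseudoalgebra T) where
  Hom := Hom
  id := Hom.id
  comp := Hom.comp

@[simps]
instance homCategory (X Y : Pseudoalgebra T) : Category (X ⟶ Y) where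
  Hom f g := Hom₂ f g
  id f := ⟨𝟙 f.hom, by simp⟩
  comp γ δ := ⟨γ.hom ≫ δ.hom, by simp [δ.coh, reassoc_of% γ.coh]⟩

@[ext]
lemma hom₂_ext {X Y : Pseudoalgebra T} {f g : X ⟶ Y} {γ δ : f ⟶ g} (h : γ.hom = δ.hom) : γ = δ :=
  Hom₂.ext h

/-- An invertible 2-cell of `A` satisfying the coherence is an invertible 2-cell of pseudoalgebras. -/
def isoMk {X Y : Pseudoalgebra T} {f g : X ⟶ Y} (γ : f.hom ≅ g.hom)
    (h : T.S.map₂ γ.hom ▷ Y.act ≫ g.cell.hom = f.cell.hom ≫ X.act ◁ γ.hom) : f ≅ g where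
  hom := ⟨γ.hom, h⟩
  inv := ⟨γ.inv, by
    rw [← cancel_mono (X.act ◁ γ.hom), Category.assoc, ← h]
    simp [← comp_whiskerRight_assoc, ← whiskerLeft_comp]⟩

@[simp] lemma id_hom (X : Pseudoalgebra T) : (𝟙 X : X ⟶ X).hom = 𝟙 X.obj := rfl
@[simp] lemma comp_hom {X Y Z : Pseudoalgebra T} (f : X ⟶ Y) (g : Y ⟶ Z) :
    (f ≫ g).hom = f.hom ≫ g.hom := rfl
lemma id_cell_hom (X : Pseudoalgebra T) : (𝟙 X : X ⟶ X).cell.hom =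
    (T.S.mapId X.obj).hom ▷ X.act ≫ (λ_ X.act).hom ≫ (ρ_ X.act).inv := rfl
lemma comp_cell_hom {X Y Z : Pseudoalgebra T} (f : X ⟶ Y) (g : Y ⟶ Z) :
    (f ≫ g).cell.hom = (T.S.mapComp f.hom g.hom).hom ▷ Z.act ≫
      hpaste f.cell.hom g.cell.hom := rfl

/-- Left whiskering. -/
def whiskerLeft {X Y Z : Pseudoalgebra T} (f : X ⟶ Y) {g h : Y ⟶ Z} (γ : g ⟶ h) :
    f ≫ g ⟶ f ≫ h :=
  Hom₂.mk (f.hom ◁ γ.hom) (by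
    have e := γ.coh
    rw [comp_cell_hom, comp_cell_hom]
    simp only [hpaste, comp_hom]
    simp
    calc
      _ = (T.S.mapComp f.hom g.hom).hom ▷ Z.act ⊗≫
          T.S.map f.hom ◁ (T.S.map₂ γ.hom ▷ Z.act ≫ h.cell.hom) ⊗≫ f.cell.hom ▷ h.hom ⊗≫ 𝟙 _ := by
        bicategory
      _ = (T.S.mapComp f.hom g.hom).hom ▷ Z.act ⊗≫ T.S.map f.hom ◁ g.cell.hom ⊗≫
          ((T.S.map f.hom ≫ Y.act) ◁ γ.hom ≫ f.cell.hom ▷ h.hom) ⊗≫ 𝟙 _ := by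
        rw [e]; bicategory
      _ = _ := by rw [whisker_exchange]; bicategory)

/-- Right whiskering. -/
def whiskerRight {X Y Z : Pseudoalgebra T} {f g : X ⟶ Y} (γ : f ⟶ g) (h : Y ⟶ Z) :
    f ≫ h ⟶ g ≫ h :=
  Hom₂.mk (γ.hom ▷ h.hom) (by
    have e := γ.coh
    rw [comp_cell_hom, comp_cell_hom]
    simp only [hpaste, comp_hom]
    simp
    calc
      _ = (T.S.mapComp f.hom h.hom).hom ▷ Z.act ⊗≫
          (T.S.map₂ γ.hom ▷ (T.S.map h.hom ≫ Z.act) ≫ T.S.map g.hom ◁ h.cell.hom) ⊗≫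
          g.cell.hom ▷ h.hom ⊗≫ 𝟙 _ := by bicategory
      _ = (T.S.mapComp f.hom h.hom).hom ▷ Z.act ⊗≫ T.S.map f.hom ◁ h.cell.hom ⊗≫
          (T.S.map₂ γ.hom ▷ Y.act ≫ g.cell.hom) ▷ h.hom ⊗≫ 𝟙 _ := by
        rw [← whisker_exchange]; bicategory
      _ = _ := by rw [e]; bicategory)

/-- The associator, that of `A`. -/
def associator {W X Y Z : Pseudoalgebra T} (f : W ⟶ X) (g : X ⟶ Y) (h : Y ⟶ Z) :
    (f ≫ g) ≫ h ≅ f ≫ g ≫ h :=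
  isoMk (α_ f.hom g.hom h.hom) (by
    rw [comp_cell_hom, comp_cell_hom, comp_cell_hom, comp_cell_hom]
    simp only [hpaste, comp_hom]
    simp
    symm
    calc
      _ = (T.S.mapComp (f.hom ≫ g.hom) h.hom).hom ▷ Z.act ⊗≫
          (T.S.map (f.hom ≫ g.hom) ◁ h.cell.hom ≫
            (T.S.mapComp f.hom g.hom).hom ▷ (Y.act ≫ h.hom)) ⊗≫
          T.S.map f.hom ◁ g.cell.hom ▷ h.hom ⊗≫ f.cell.hom ▷ g.hom ▷ h.hom ⊗≫ 𝟙 _ := by bicategory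
      _ = _ := by rw [whisker_exchange]; bicategory)

/-- The left unitor, that of `A`. -/
def leftUnitor {X Y : Pseudoalgebra T} (f : X ⟶ Y) : 𝟙 X ≫ f ≅ f :=
  isoMk (λ_ f.hom) (by
    rw [comp_cell_hom, id_cell_hom]
    simp only [hpaste, id_hom]
    simp
    symm
    calc
      _ = (T.S.mapComp (𝟙 X.obj) f.hom).hom ▷ Y.act ⊗≫
          (T.S.map (𝟙 X.obj) ◁ f.cell.hom ≫ (T.S.mapId X.obj).hom ▷ (X.act ≫ f.hom)) ⊗≫ 𝟙 _ := by
        bicategory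
      _ = _ := by rw [whisker_exchange]; bicategory)

/-- The right unitor, that of `A`. -/
def rightUnitor {X Y : Pseudoalgebra T} (f : X ⟶ Y) : f ≫ 𝟙 Y ≅ f :=
  isoMk (ρ_ f.hom) (by
    rw [comp_cell_hom, id_cell_hom]
    simp only [hpaste, id_hom]
    simp)

/-- The 2-category of pseudoalgebras, pseudomorphisms and 2-cells of pseudoalgebras. -/
instance : Bicategory (Pseudoalgebra T) where
  whiskerLeft := whiskerLeft
  whiskerRight := whiskerRight
  associator := associator
  leftUnitor := leftUnitor
  rightUnitor := rightUnitor
  whiskerLeft_id _ _ := hom₂_ext (whiskerLeft_id _ _)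
  whiskerLeft_comp _ _ _ _ _ _ := hom₂_ext (whiskerLeft_comp _ _ _)
  id_whiskerLeft _ := hom₂_ext (id_whiskerLeft _)
  comp_whiskerLeft _ _ _ _ _ := hom₂_ext (comp_whiskerLeft _ _ _)
  id_whiskerRight _ _ := hom₂_ext (id_whiskerRight _ _)
  comp_whiskerRight _ _ _ := hom₂_ext (comp_whiskerRight _ _ _)
  whiskerRight_id _ := hom₂_ext (whiskerRight_id _)
  whiskerRight_comp _ _ _ := hom₂_ext (whiskerRight_comp _ _ _)
  whisker_assoc _ _ _ _ _ := hom₂_ext (whisker_assoc _ _ _)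
  whisker_exchange _ _ := hom₂_ext (whisker_exchange _ _)
  pentagon _ _ _ _ := hom₂_ext (pentagon _ _ _ _)
  triangle _ _ := hom₂_ext (triangle _ _)

lemma hom_eq {X Y : Pseudoalgebra T} {f g : X ⟶ Y} (h : f.hom = g.hom) (Γ : f ⟶ g)
    (hΓ : Γ.hom = eqToHom h) : f = g := by
  obtain ⟨f, c, _, _⟩ := f
  obtain ⟨g, d, _, _⟩ := g
  obtain rfl : f = g := h
  obtain rfl : c = d := by
    have e := Γ.coh
    rw [hΓ] at e
    ext
    simpa using e.symm
  rfl

lemma eqToIso_hom_hom {X Y : Pseudoalgebra T} {f g : X ⟶ Y} (h : f = g) :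
    (eqToIso h).hom.hom = (eqToIso (congrArg Hom.hom h)).hom := by
  subst h; rfl

instance [Strict A] : Strict (Pseudoalgebra T) where
  id_comp f := hom_eq (Strict.id_comp f.hom) (leftUnitor f).hom
    (congrArg Iso.hom (Strict.leftUnitor_eqToIso f.hom))
  comp_id f := hom_eq (Strict.comp_id f.hom) (rightUnitor f).hom
    (congrArg Iso.hom (Strict.rightUnitor_eqToIso f.hom))
  assoc f g h := hom_eq (Strict.assoc f.hom g.hom h.hom) (associator f g h).hom
    (congrArg Iso.hom (Strict.associator_eqToIso f.hom g.hom h.hom))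
  leftUnitor_eqToIso f := by
    ext
    rw [eqToIso_hom_hom]
    exact (congrArg Iso.hom (Strict.leftUnitor_eqToIso f.hom))
  rightUnitor_eqToIso f := by
    ext
    rw [eqToIso_hom_hom]
    exact (congrArg Iso.hom (Strict.rightUnitor_eqToIso f.hom))
  associator_eqToIso f g h := by
    ext
    rw [eqToIso_hom_hom]
    exact (congrArg Iso.hom (Strict.associator_eqToIso f.hom g.hom h.hom))

variable (T) in
/-- The forgetful 2-functor from pseudoalgebras to `A`. -/
def forget : StrictPseudofunctor (Pseudoalgebra T) A :=
  StrictPseudofunctor.mk'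
    { obj := fun X => X.obj
      map := fun f => f.hom
      map₂ := fun γ => γ.hom
      map_id := fun _ => rfl
      map_comp := fun _ _ => rfl
      map₂_whisker_left := fun _ _ _ _ => ((Category.id_comp _).trans (Category.comp_id _)).symm
      map₂_whisker_right := fun _ _ => ((Category.id_comp _).trans (Category.comp_id _)).symm
      map₂_left_unitor := fun _ => (Category.id_comp _).symm
      map₂_right_unitor := fun _ => (Category.id_comp _).symm
      map₂_associator := fun _ _ _ => ((Category.id_comp _).trans (Category.comp_id _)).symm }

end Pseudoalgebra

/-- The 2-category `A^S` of pseudoalgebras, as an object of `2-Cat`. -/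
def TwoCat.algebras {A : TwoCat.{u}} (T : Pseudomonad A) : TwoCat.{u} where
  carrier := Pseudoalgebra T

/-- The underlying endo-2-functor `S : A → A` of a pseudomonad, as a morphism of `2-Cat`. -/
def TwoCat.endo {A : TwoCat.{u}} (T : Pseudomonad A) : A ⟶ A :=
  T.S

/-- The forgetful 2-functor `U^S : A^S → A`, as a morphism of `2-Cat`. -/
def TwoCat.forget {A : TwoCat.{u}} (T : Pseudomonad A) : algebras T ⟶ A :=
  Pseudoalgebra.forget T

end GrayPsAlg

open GrayPsAlg

/-!
The forgetful 2-functor `U : A^S → A` of a pseudomonad is exhibited as a tower of limits in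
`2-Cat`, obtained by adding the data and the axioms of a pseudoalgebra one at a time.

A 2-functor `C → B^{2[X]}` amounts to an `X`-shaped diagram of pseudonatural transformations
`F ⇒ G : C → B` and modifications (`curry`). A square of 2-categories is a pullback as soon as its
0-cells, 1-cells and 2-cells are (`IsCellwisePullback.isPullback`), so a pullback of
`B^{2[X → Y]}` along such a diagram can be recognised concretely: over an object `c` of `C` lie the
extensions to `Y` of the diagram of components at `c`, over a 1-cell lie the naturality
isomorphisms for such extensions, and a 2-cell lifts, uniquely, if it is compatible with these
(`isCellwisePullback_curry`). Consequently

* the 2-cell inserter of `S` and the identity is the 2-category `PreAlgebra S` of actions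
  `S x ⟶ x` and pseudomorphisms (`PreAlgebra.isCellwisePullback_forget`);
* the inserter, or iso-inserter, of pseudonatural transformations `α`, `β` is the locally full
  2-category of objects `c` with a 2-cell, or an invertible 2-cell, `α_c ⟶ β_c`, and 1-cells at
  which these are natural (`isCellwisePullback_inserter`, `isCellwisePullback_isoInserter`);
* the equifier of modifications is the full sub-2-category on the objects at which they agree
  (`IsEquifierMap.isCellwisePullback`).

The tower starts with `PreAlgebra S`, adjoins an invertible unit `𝟙 ⟶ η ≫ a` and an invertible
multiplication `S a ≫ a ⟶ μ ≫ a` (`Pseudomonad.unital`, `Pseudomonad.multiplicative`), and then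
imposes the unit and the associativity coherence (`Pseudomonad.unitCoherent`,
`Pseudomonad.isEquifierMap_toUnitCoherent`). For the last two steps the sides of the coherence
axioms have to be modifications (`Pseudomonad.unitLeft`, `Pseudomonad.assocLeft`,
`Pseudomonad.assocRight`). They are composed from the universal unit and multiplication, the
modifications `ρ` and `α` of the pseudomonad, and the pseudonaturality squares of `μ` at the
action (`PseudomonadData.muMod`).

The 2-functor `k = 2[1 + 1 → 𝕀]` is not a generating cofibration, but an isomorphism is a pair of
2-cells in opposite directions whose two composites are identities. Hence an iso-inserter is an
inserter, followed by an inserter and two equifiers (`isoInserterToRetract_comp`,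
`isEquifierMap_isoInserterToRetract`), and `U` is a finite composite of pullbacks of powers of
generating cofibrations.

Equiv-fibrations compose (`TwoCat.IsEquivFibration.comp`), and every stage of the tower is one.
Postcomposition with an equivalence is an equivalence of hom-categories (`postcompEquivalence`).
Therefore the 2-cell required on a new object is determined by naturality at the given
equivalence (`NaturalAt.exists_equivalence`), an equation of modifications transports along
equivalences (`as_app_eq_of_equivalence`), and an action transported along an equivalence makes
the latter an adjoint equivalence of algebras (`PreAlgebra.exists_equivalence`).
-/
namespace GrayPsAlg

/-! ### Heterogeneous equality of cells -/

section heq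

variable {A : Type u} [Bicategory.{w, v} A]

lemma comp_heq_comp {a b c a' b' c' : A} (ha : a = a') (hb : b = b') (hc : c = c')
    {f : a ⟶ b} {f' : a' ⟶ b'} {g : b ⟶ c} {g' : b' ⟶ c'} (hf : HEq f f') (hg : HEq g g') :
    HEq (f ≫ g) (f' ≫ g') := by
  subst ha hb hc; cases hf; cases hg; rfl

lemma id_heq_id {a a' : A} (ha : a = a') : HEq (𝟙 a) (𝟙 a') := by
  subst ha; rfl

lemma vcomp_heq_vcomp {a b a' b' : A} (ha : a = a') (hb : b = b')
    {f g h : a ⟶ b} {f' g' h' : a' ⟶ b'} (hf : HEq f f') (hg : HEq g g') (hh : HEq h h')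
    {γ : f ⟶ g} {γ' : f' ⟶ g'} {δ : g ⟶ h} {δ' : g' ⟶ h'} (hγ : HEq γ γ') (hδ : HEq δ δ') :
    HEq (γ ≫ δ) (γ' ≫ δ') := by
  subst ha hb; cases hf; cases hg; cases hh; cases hγ; cases hδ; rfl

lemma vid_heq_vid {a b a' b' : A} (ha : a = a') (hb : b = b')
    {f : a ⟶ b} {f' : a' ⟶ b'} (hf : HEq f f') : HEq (𝟙 f) (𝟙 f') := by
  subst ha hb; cases hf; rfl

lemma whiskerLeft_heq {a b c a' b' c' : A} (ha : a = a') (hb : b = b') (hc : c = c')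
    {f : a ⟶ b} {f' : a' ⟶ b'} (hf : HEq f f') {g h : b ⟶ c} {g' h' : b' ⟶ c'} (hg : HEq g g')
    (hh : HEq h h') {γ : g ⟶ h} {γ' : g' ⟶ h'} (hγ : HEq γ γ') : HEq (f ◁ γ) (f' ◁ γ') := by
  subst ha hb hc; cases hf; cases hg; cases hh; cases hγ; rfl

lemma whiskerRight_heq {a b c a' b' c' : A} (ha : a = a') (hb : b = b') (hc : c = c')
    {f g : a ⟶ b} {f' g' : a' ⟶ b'} (hf : HEq f f') (hg : HEq g g') {γ : f ⟶ g} {γ' : f' ⟶ g'}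
    (hγ : HEq γ γ') {h : b ⟶ c} {h' : b' ⟶ c'} (hh : HEq h h') : HEq (γ ▷ h) (γ' ▷ h') := by
  subst ha hb hc; cases hf; cases hg; cases hh; cases hγ; rfl

lemma eqToHom_conj_heq {C : Type u} [Category.{v} C] {a b c d : C} (h : a = b) (f : b ⟶ c)
    (h' : c = d) : HEq (eqToHom h ≫ f ≫ eqToHom h') f := by
  subst h h'; simp

lemma eqToHom_conj_eq {C : Type u} [Category.{v} C] {a b c d : C} (h : a = b) (f : b ⟶ c)
    (h' : c = d) {g : a ⟶ d} (hg : HEq g f) : g = eqToHom h ≫ f ≫ eqToHom h' :=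
  eq_of_heq (hg.trans (eqToHom_conj_heq h f h').symm)

variable {B : Type*} [Bicategory B]

lemma map₂_heq_map₂ (F : StrictPseudofunctor A B) {a b a' b' : A} (ha : a = a') (hb : b = b')
    {f g : a ⟶ b} {f' g' : a' ⟶ b'} (hf : HEq f f') (hg : HEq g g') {γ : f ⟶ g} {γ' : f' ⟶ g'}
    (hγ : HEq γ γ') : HEq (F.map₂ γ) (F.map₂ γ') := by
  subst ha hb; cases hf; cases hg; cases hγ; rfl

/-- A 2-functor preserves left whiskering, its coherence 2-cells being identities. -/
lemma map₂_whiskerLeft_heq (F : StrictPseudofunctor A B) {a b c : A} (f : a ⟶ b) {g h : b ⟶ c}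
    (γ : g ⟶ h) : HEq (F.map₂ (f ◁ γ)) (F.map f ◁ F.map₂ γ) := by
  rw [F.map₂_whisker_left, F.mapComp_eq_eqToIso, F.mapComp_eq_eqToIso]
  exact eqToHom_conj_heq (F.map_comp f g) _ (F.map_comp f h).symm

/-- A 2-functor preserves right whiskering, its coherence 2-cells being identities. -/
lemma map₂_whiskerRight_heq (F : StrictPseudofunctor A B) {a b c : A} {f g : a ⟶ b}
    (γ : f ⟶ g) (h : b ⟶ c) : HEq (F.map₂ (γ ▷ h)) (F.map₂ γ ▷ F.map h) := by
  rw [F.map₂_whisker_right, F.mapComp_eq_eqToIso, F.mapComp_eq_eqToIso]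
  exact eqToHom_conj_heq (F.map_comp f h) _ (F.map_comp g h).symm

/-- 2-functors are equal as soon as they agree on 0-cells, 1-cells and 2-cells. -/
lemma strictPseudofunctor_ext {F G : StrictPseudofunctor A B} (h₀ : ∀ x, F.obj x = G.obj x)
    (h₁ : ∀ {x y : A} (f : x ⟶ y), HEq (F.map f) (G.map f))
    (h₂ : ∀ {x y : A} {f g : x ⟶ y} (γ : f ⟶ g), HEq (F.map₂ γ) (G.map₂ γ)) : F = G := by
  obtain ⟨⟨⟨⟨⟨⟨Fo, Fm⟩, Ft⟩, _, _⟩, Fi, Fc, _, _, _, _, _⟩, e1, e2⟩, e3, e4⟩ := F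
  obtain ⟨⟨⟨⟨⟨⟨Go, Gm⟩, Gt⟩, _, _⟩, Gi, Gc, _, _, _, _, _⟩, k1, k2⟩, k3, k4⟩ := G
  obtain rfl : Fo = Go := funext h₀
  obtain rfl : @Fm = @Gm := by
    funext x y f
    exact eq_of_heq (h₁ f)
  obtain rfl : @Ft = @Gt := by
    funext x y f g γ
    exact eq_of_heq (h₂ γ)
  -- The coherence 2-cells of a 2-functor are determined: they come from equalities of 1-cells.
  obtain rfl : Fi = Gi := by
    funext x
    exact (e2 x).trans (k2 x).symm
  obtain rfl : @Fc = @Gc := by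
    funext a b c f g
    exact (e4 f g).trans (k4 f g).symm
  rfl

lemma obj_eq_of_eq {F G : StrictPseudofunctor A B} (h : F = G) (x : A) : F.obj x = G.obj x := by
  rw [h]

lemma map_heq_of_eq {F G : StrictPseudofunctor A B} (h : F = G) {x y : A} (f : x ⟶ y) :
    HEq (F.map f) (G.map f) := by
  subst h; rfl

lemma map₂_heq_of_eq {F G : StrictPseudofunctor A B} (h : F = G) {x y : A} {f g : x ⟶ y}
    (γ : f ⟶ g) : HEq (F.map₂ γ) (G.map₂ γ) := by
  subst h; rfl

end heq

/-! ### Recognising pullbacks of 2-categories -/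

section pullback

variable {I D C E : Type u} [Bicategory.{u, u} I] [Bicategory.{u, u} D] [Bicategory.{u, u} C]
  [Bicategory.{u, u} E]

/-- A commutative square of 2-functors whose sets of 0-cells, of 1-cells between given 0-cells
and of 2-cells between given 1-cells are pullbacks. -/
structure IsCellwisePullback (Φ : StrictPseudofunctor I D) (P : StrictPseudofunctor I C)
    (U : StrictPseudofunctor D E) (V : StrictPseudofunctor C E) : Prop where
  comm : Φ.comp U = P.comp V
  inj₀ (x x' : I) : Φ.obj x = Φ.obj x' → P.obj x = P.obj x' → x = x'
  surj₀ (d : D) (c : C) : U.obj d = V.obj c → ∃ x, Φ.obj x = d ∧ P.obj x = c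
  inj₁ {x y : I} (h h' : x ⟶ y) : Φ.map h = Φ.map h' → P.map h = P.map h' → h = h'
  surj₁ {x y : I} (f : Φ.obj x ⟶ Φ.obj y) (g : P.obj x ⟶ P.obj y) :
    HEq (U.map f) (V.map g) → ∃ h : x ⟶ y, Φ.map h = f ∧ P.map h = g
  inj₂ {x y : I} {h k : x ⟶ y} (γ γ' : h ⟶ k) :
    Φ.map₂ γ = Φ.map₂ γ' → P.map₂ γ = P.map₂ γ' → γ = γ'
  surj₂ {x y : I} {h k : x ⟶ y} (α : Φ.map h ⟶ Φ.map k) (β : P.map h ⟶ P.map k) :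
    HEq (U.map₂ α) (V.map₂ β) → ∃ γ : h ⟶ k, Φ.map₂ γ = α ∧ P.map₂ γ = β

namespace IsCellwisePullback

variable {Φ : StrictPseudofunctor I D} {P : StrictPseudofunctor I C}
  {U : StrictPseudofunctor D E} {V : StrictPseudofunctor C E} (h : IsCellwisePullback Φ P U V)

include h

lemma exists_map {x y : I} {d d' : D} {c c' : C} (hd : Φ.obj x = d) (hd' : Φ.obj y = d')
    (hc : P.obj x = c) (hc' : P.obj y = c') (f : d ⟶ d') (g : c ⟶ c')
    (hfg : HEq (U.map f) (V.map g)) :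
    ∃ k : x ⟶ y, HEq (Φ.map k) f ∧ HEq (P.map k) g := by
  subst hd hd' hc hc'
  obtain ⟨k, rfl, rfl⟩ := h.surj₁ f g hfg
  exact ⟨k, HEq.rfl, HEq.rfl⟩

lemma exists_map₂ {x y : I} {d d' : D} {c c' : C} (hd : Φ.obj x = d) (hd' : Φ.obj y = d')
    (hc : P.obj x = c) (hc' : P.obj y = c') {k l : x ⟶ y} {f f' : d ⟶ d'} {g g' : c ⟶ c'}
    (hf : HEq (Φ.map k) f) (hf' : HEq (Φ.map l) f') (hg : HEq (P.map k) g)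
    (hg' : HEq (P.map l) g') (α : f ⟶ f') (β : g ⟶ g') (hαβ : HEq (U.map₂ α) (V.map₂ β)) :
    ∃ γ : k ⟶ l, HEq (Φ.map₂ γ) α ∧ HEq (P.map₂ γ) β := by
  subst hd hd' hc hc'
  cases hf; cases hf'; cases hg; cases hg'
  obtain ⟨γ, rfl, rfl⟩ := h.surj₂ α β hαβ
  exact ⟨γ, HEq.rfl, HEq.rfl⟩

lemma map_ext {x y x' y' : I} (hx : x = x') (hy : y = y') (f : x ⟶ y) (f' : x' ⟶ y')
    (h₁ : HEq (Φ.map f) (Φ.map f')) (h₂ : HEq (P.map f) (P.map f')) : HEq f f' := by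
  subst hx hy
  exact heq_of_eq (h.inj₁ _ _ (eq_of_heq h₁) (eq_of_heq h₂))

lemma map₂_ext {x y x' y' : I} (hx : x = x') (hy : y = y') {f g : x ⟶ y} {f' g' : x' ⟶ y'}
    (hf : HEq f f') (hg : HEq g g') (γ : f ⟶ g) (γ' : f' ⟶ g')
    (h₁ : HEq (Φ.map₂ γ) (Φ.map₂ γ')) (h₂ : HEq (P.map₂ γ) (P.map₂ γ')) : HEq γ γ' := by
  subst hx hy; cases hf; cases hg
  exact heq_of_eq (h.inj₂ _ _ (eq_of_heq h₁) (eq_of_heq h₂))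

/-- The universal property of a cellwise pullback: the cells of the lift are chosen by
surjectivity, and its functoriality follows from joint injectivity. -/
lemma exists_lift {Z : Type u} [Bicategory.{u, u} Z] [Strict Z] [Strict I]
    (s : StrictPseudofunctor Z D)
    (t : StrictPseudofunctor Z C) (hst : s.comp U = t.comp V) :
    ∃ L : StrictPseudofunctor Z I, L.comp Φ = s ∧ L.comp P = t := by
  choose o ho ho' using fun z => h.surj₀ (s.obj z) (t.obj z) (obj_eq_of_eq hst z)
  choose m hm hm' using fun {z z' : Z} (f : z ⟶ z') =>
    h.exists_map (ho z) (ho z') (ho' z) (ho' z') (s.map f) (t.map f) (map_heq_of_eq hst f)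
  choose n hn hn' using fun {z z' : Z} {f g : z ⟶ z'} (γ : f ⟶ g) =>
    h.exists_map₂ (ho z) (ho z') (ho' z) (ho' z') (hm f) (hm g) (hm' f) (hm' g) (s.map₂ γ)
      (t.map₂ γ) (map₂_heq_of_eq hst γ)
  have hid (z : Z) : m (𝟙 z) = 𝟙 (o z) := by
    refine eq_of_heq (h.map_ext rfl rfl _ _ ?_ ?_)
    · rw [Φ.map_id]
      exact (hm _).trans ((heq_of_eq (s.map_id z)).trans (id_heq_id (ho z).symm))
    · rw [P.map_id]
      exact (hm' _).trans ((heq_of_eq (t.map_id z)).trans (id_heq_id (ho' z).symm))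
  have hcomp {x y z : Z} (f : x ⟶ y) (g : y ⟶ z) : m (f ≫ g) = m f ≫ m g := by
    refine eq_of_heq (h.map_ext rfl rfl _ _ ?_ ?_)
    · rw [Φ.map_comp]
      exact (hm _).trans ((heq_of_eq (s.map_comp f g)).trans
        (comp_heq_comp (ho _) (ho _) (ho _) (hm f) (hm g)).symm)
    · rw [P.map_comp]
      exact (hm' _).trans ((heq_of_eq (t.map_comp f g)).trans
        (comp_heq_comp (ho' _) (ho' _) (ho' _) (hm' f) (hm' g)).symm)
  let L : StrictPseudofunctor Z I := StrictPseudofunctor.mk''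
    { obj := o
      map := m
      map₂ := n
      map₂_id := fun {x y} f => by
        refine eq_of_heq (h.map₂_ext rfl rfl HEq.rfl HEq.rfl _ _ ?_ ?_)
        · rw [Φ.map₂_id]
          exact (hn _).trans ((heq_of_eq (s.map₂_id f)).trans
            (vid_heq_vid (ho _) (ho _) (hm f)).symm)
        · rw [P.map₂_id]
          exact (hn' _).trans ((heq_of_eq (t.map₂_id f)).trans
            (vid_heq_vid (ho' _) (ho' _) (hm' f)).symm)
      map₂_comp := fun {x y f g k} γ δ => by
        refine eq_of_heq (h.map₂_ext rfl rfl HEq.rfl HEq.rfl _ _ ?_ ?_)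
        · rw [Φ.map₂_comp]
          exact (hn _).trans ((heq_of_eq (s.map₂_comp γ δ)).trans
            (vcomp_heq_vcomp (ho _) (ho _) (hm _) (hm _) (hm _) (hn γ) (hn δ)).symm)
        · rw [P.map₂_comp]
          exact (hn' _).trans ((heq_of_eq (t.map₂_comp γ δ)).trans
            (vcomp_heq_vcomp (ho' _) (ho' _) (hm' _) (hm' _) (hm' _) (hn' γ) (hn' δ)).symm)
      map_id := hid
      map_comp := hcomp
      map₂_whisker_left := fun {x y z} f {g k} γ => by
        refine eqToHom_conj_eq _ _ _ (h.map₂_ext rfl rfl (heq_of_eq (hcomp _ _))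
          (heq_of_eq (hcomp _ _)) _ _ ?_ ?_)
        · exact (hn _).trans ((map₂_whiskerLeft_heq s f γ).trans
            ((map₂_whiskerLeft_heq Φ _ _).trans
              (whiskerLeft_heq (ho _) (ho _) (ho _) (hm _) (hm _) (hm _) (hn γ))).symm)
        · exact (hn' _).trans ((map₂_whiskerLeft_heq t f γ).trans
            ((map₂_whiskerLeft_heq P _ _).trans
              (whiskerLeft_heq (ho' _) (ho' _) (ho' _) (hm' _) (hm' _) (hm' _) (hn' γ))).symm)
      map₂_whisker_right := fun {x y z f g} γ k => by
        refine eqToHom_conj_eq _ _ _ (h.map₂_ext rfl rfl (heq_of_eq (hcomp _ _))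
          (heq_of_eq (hcomp _ _)) _ _ ?_ ?_)
        · exact (hn _).trans ((map₂_whiskerRight_heq s γ k).trans
            ((map₂_whiskerRight_heq Φ _ _).trans
              (whiskerRight_heq (ho _) (ho _) (ho _) (hm _) (hm _) (hn γ) (hm _))).symm)
        · exact (hn' _).trans ((map₂_whiskerRight_heq t γ k).trans
            ((map₂_whiskerRight_heq P _ _).trans
              (whiskerRight_heq (ho' _) (ho' _) (ho' _) (hm' _) (hm' _) (hn' γ) (hm' _))).symm) }
  exact ⟨L, strictPseudofunctor_ext ho (fun f => hm f) (fun γ => hn γ),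
    strictPseudofunctor_ext ho' (fun f => hm' f) (fun γ => hn' γ)⟩

lemma lift_unique {Z : Type u} [Bicategory.{u, u} Z] {L L' : StrictPseudofunctor Z I}
    (h₁ : L.comp Φ = L'.comp Φ) (h₂ : L.comp P = L'.comp P) : L = L' := by
  have e₀ (z : Z) : L.obj z = L'.obj z :=
    h.inj₀ _ _ (obj_eq_of_eq h₁ z) (obj_eq_of_eq h₂ z)
  have e₁ {x y : Z} (f : x ⟶ y) : HEq (L.map f) (L'.map f) :=
    h.map_ext (e₀ _) (e₀ _) _ _ (map_heq_of_eq h₁ f) (map_heq_of_eq h₂ f)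
  exact strictPseudofunctor_ext e₀ e₁ fun γ =>
    h.map₂_ext (e₀ _) (e₀ _) (e₁ _) (e₁ _) _ _ (map₂_heq_of_eq h₁ γ) (map₂_heq_of_eq h₂ γ)

end IsCellwisePullback

end pullback

/-- A cellwise pullback is a pullback in `2-Cat`. -/
lemma IsCellwisePullback.isPullback {I D C E : TwoCat.{u}} {Φ : I ⟶ D} {P : I ⟶ C} {U : D ⟶ E}
    {V : C ⟶ E}
    (h : IsCellwisePullback (I := I) (D := D) (C := C) (E := E) Φ P U V) :
    IsPullback Φ P U V := by
  refine ⟨⟨h.comm⟩, ⟨Limits.PullbackCone.IsLimit.mk h.comm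
    (fun s => (h.exists_lift (Z := s.pt) s.fst s.snd s.condition).choose)
    (fun s => (h.exists_lift (Z := s.pt) s.fst s.snd s.condition).choose_spec.1)
    (fun s => (h.exists_lift (Z := s.pt) s.fst s.snd s.condition).choose_spec.2)
    (fun s m hm hm' => h.lift_unique
      (hm.trans (h.exists_lift (Z := s.pt) s.fst s.snd s.condition).choose_spec.1.symm)
      (hm'.trans (h.exists_lift (Z := s.pt) s.fst s.snd s.condition).choose_spec.2.symm))⟩⟩

/-! ### Diagrams of shape `2[X]` -/

section diagrams

variable {X : Type} [Category.{0} X] {B : Type u} [Bicategory.{u, u} B]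

lemma id_whiskerLeft_heq [Strict B] {a b : B} {f g : a ⟶ b} (γ : f ⟶ g) : HEq (𝟙 a ◁ γ) γ := by
  rw [id_whiskerLeft, Strict.leftUnitor_eqToIso, Strict.leftUnitor_eqToIso]
  exact eqToHom_conj_heq (Strict.id_comp f) _ (Strict.id_comp g).symm

lemma whiskerRight_id_heq [Strict B] {a b : B} {f g : a ⟶ b} (γ : f ⟶ g) : HEq (γ ▷ 𝟙 b) γ := by
  rw [whiskerRight_id, Strict.rightUnitor_eqToIso, Strict.rightUnitor_eqToIso]
  exact eqToHom_conj_heq (Strict.comp_id f) _ (Strict.comp_id g).symm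

/-- The naturality of a modification is automatic at identity 1-cells. -/
lemma modification_naturality_id {Q : Type v} [Bicategory.{v, v} Q] {H K : StrictPseudofunctor Q B}
    (η θ : H.toPseudofunctor ⟶ K.toPseudofunctor) {x : Q} (γ : η.app x ⟶ θ.app x) :
    H.map (𝟙 x) ◁ γ ≫ (θ.naturality (𝟙 x)).hom = (η.naturality (𝟙 x)).hom ≫ γ ▷ K.map (𝟙 x) := by
  rw [Pseudofunctor.StrongTrans.naturality_id_hom, Pseudofunctor.StrongTrans.naturality_id_hom,
    whisker_exchange_assoc, Category.assoc, Category.assoc, Category.assoc, whisker_exchange]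
  simp

namespace Susp

/-- An object `x` of `X`, as a 1-cell from `src` to `tgt` in `2[X]`. -/
abbrev arr (x : X) : (src : Susp X) ⟶ tgt := x

/-- A morphism of `X`, as a 2-cell of `2[X]`. -/
abbrev arr₂ {x y : X} (m : x ⟶ y) : arr x ⟶ arr y := m

/-- The 2-functor `2[X] → B` that sends `src` and `tgt` to `a` and `b` and is the functor `E` on
the hom-category from `src` to `tgt`. -/
def ofDiagram [Strict B] (a b : B) (E : X ⥤ (a ⟶ b)) : StrictPseudofunctor (Susp X) B :=
  StrictPseudofunctor.mk''
    { obj := fun x => match x with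
        | src => a
        | tgt => b
      map := fun {x y} => match x, y with
        | src, src => fun _ => 𝟙 a
        | src, tgt => fun f => E.obj f
        | tgt, src => fun f => (f : Discrete PEmpty).as.elim
        | tgt, tgt => fun _ => 𝟙 b
      map₂ := fun {x y f g} => match x, y, f, g with
        | src, src, _, _ => fun _ => 𝟙 (𝟙 a)
        | src, tgt, _, _ => fun γ => E.map γ
        | tgt, src, f, _ => fun _ => (f : Discrete PEmpty).as.elim
        | tgt, tgt, _, _ => fun _ => 𝟙 (𝟙 b)
      map₂_id := fun {x y} f => by
        cases x <;> cases y <;>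
        first
          | rfl
          | exact E.map_id _
          | exact (f : Discrete PEmpty).as.elim
      map₂_comp := fun {x y f g h} γ δ => by
        cases x <;> cases y <;>
        first
          | exact E.map_comp _ _
          | exact (Category.id_comp _).symm
          | exact (f : Discrete PEmpty).as.elim
      map_id := fun x => by cases x <;> rfl
      map_comp := fun {x y z} f g => by
        cases x <;> cases y <;> cases z <;>
        first
          | exact (f : Discrete PEmpty).as.elim
          | exact (g : Discrete PEmpty).as.elim
          | exact (Strict.id_comp _).symm
          | exact (Strict.comp_id _).symm
      map₂_whisker_left := fun {x y z} f {g h} γ => by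
        refine eqToHom_conj_eq _ _ _ ?_
        cases x <;> cases y <;> cases z <;>
        first
          | exact (f : Discrete PEmpty).as.elim
          | exact (g : Discrete PEmpty).as.elim
          | exact (id_whiskerLeft_heq _).symm
          | exact (heq_of_eq (E.map_id f)).trans ((vid_heq_vid rfl rfl
              (heq_of_eq (Strict.comp_id _).symm)).trans (heq_of_eq (whiskerLeft_id _ _).symm))
      map₂_whisker_right := fun {x y z f g} γ h => by
        refine eqToHom_conj_eq _ _ _ ?_
        cases x <;> cases y <;> cases z <;>
        first
          | exact (f : Discrete PEmpty).as.elim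
          | exact (h : Discrete PEmpty).as.elim
          | exact (whiskerRight_id_heq _).symm
          | exact (heq_of_eq (E.map_id h)).trans ((vid_heq_vid rfl rfl
              (heq_of_eq (Strict.id_comp _).symm)).trans (heq_of_eq (id_whiskerRight _ _).symm)) }

/-- The diagram of shape `X` underlying a 2-functor `2[X] → B`. -/
def toDiagram (H : StrictPseudofunctor (Susp X) B) : X ⥤ (H.obj src ⟶ H.obj tgt) where
  obj x := H.map (arr x)
  map m := H.map₂ (arr₂ m)
  map_id x := H.map₂_id (arr x)
  map_comp m n := H.map₂_comp (arr₂ m) (arr₂ n)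

/-- 2-functors `2[X] → B` are equal as soon as they have the same underlying diagram. -/
lemma functor_ext {H K : StrictPseudofunctor (Susp X) B} (h₀ : H.obj src = K.obj src)
    (h₁ : H.obj tgt = K.obj tgt) (h : HEq (toDiagram H) (toDiagram K)) : H = K := by
  have aux {a a' b b' : B} (ha : a = a') (hb : b = b') {E : X ⥤ (a ⟶ b)} {E' : X ⥤ (a' ⟶ b')}
      (hE : HEq E E') : (∀ x, HEq (E.obj x) (E'.obj x)) ∧
        ∀ {x y : X} (m : x ⟶ y), HEq (E.map m) (E'.map m) := by
    subst ha hb; cases hE; exact ⟨fun _ => HEq.rfl, fun _ => HEq.rfl⟩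
  have key := aux h₀ h₁ h
  have hid : ∀ x : Susp X, H.obj x = K.obj x := fun x => by
    cases x
    · exact h₀
    · exact h₁
  have hidm (x : Susp X) : HEq (H.map (𝟙 x)) (K.map (𝟙 x)) := by
    rw [H.map_id, K.map_id]
    exact id_heq_id (hid x)
  have hidm₂ (x : Susp X) : HEq (H.map₂ (𝟙 (𝟙 x))) (K.map₂ (𝟙 (𝟙 x))) := by
    rw [H.map₂_id, K.map₂_id]
    exact vid_heq_vid (hid x) (hid x) (hidm x)
  refine strictPseudofunctor_ext hid (fun {x y} f => ?_) (fun {x y f g} γ => ?_)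
  -- Outside the hom-category `X` of `2[X]` there are only identities.
  · cases x <;> cases y
    · exact hidm src
    · exact key.1 f
    · exact (f : Discrete PEmpty).as.elim
    · exact hidm tgt
  · cases x <;> cases y
    · exact hidm₂ src
    · exact key.2 γ
    · exact (f : Discrete PEmpty).as.elim
    · exact hidm₂ tgt

lemma ofDiagram_toDiagram [Strict B] (H : StrictPseudofunctor (Susp X) B) :
    ofDiagram _ _ (toDiagram H) = H :=
  functor_ext rfl rfl HEq.rfl

/-- Pseudonatural transformations between 2-functors on `2[X]` are equal as soon as their
components at the two objects and their 2-cells at the objects of `X` are. -/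
lemma trans_heq {H K H' K' : StrictPseudofunctor (Susp X) B} (hH : H = H') (hK : K = K')
    (η : H.toPseudofunctor ⟶ K.toPseudofunctor) (η' : H'.toPseudofunctor ⟶ K'.toPseudofunctor)
    (h₀ : HEq (η.app src) (η'.app src)) (h₁ : HEq (η.app tgt) (η'.app tgt))
    (h : ∀ x : X, HEq (η.naturality (arr x)).hom (η'.naturality (arr x)).hom) : HEq η η' := by
  subst hH hK
  refine heq_of_eq ?_
  -- The 2-cells of a pseudonatural transformation at identities are determined by its components.
  have hid (x : Susp X) (hx : η.app x = η'.app x) :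
      HEq (η.naturality (𝟙 x)) (η'.naturality (𝟙 x)) := by
    rw [Pseudofunctor.StrongTrans.naturality_id_iso, Pseudofunctor.StrongTrans.naturality_id_iso,
      hx]
  obtain ⟨η0, η1, _, _, _⟩ := η
  obtain ⟨θ0, θ1, _, _, _⟩ := η'
  have e : ∀ x, η0 x = θ0 x := fun x => by
    cases x
    · exact eq_of_heq h₀
    · exact eq_of_heq h₁
  obtain rfl : η0 = θ0 := funext e
  obtain rfl : @η1 = @θ1 := by
    funext x y f
    cases x <;> cases y
    · exact eq_of_heq (hid src rfl)
    · exact Iso.ext (eq_of_heq (h f))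
    · exact (f : Discrete PEmpty).as.elim
    · exact eq_of_heq (hid tgt rfl)
  rfl

/-- Modifications between 2-functors on `2[X]` are equal as soon as their components at the two
objects are. -/
lemma mod_heq {H K H' K' : StrictPseudofunctor (Susp X) B} (hH : H = H') (hK : K = K')
    {η θ : H.toPseudofunctor ⟶ K.toPseudofunctor} {η' θ' : H'.toPseudofunctor ⟶ K'.toPseudofunctor}
    (hη : HEq η η') (hθ : HEq θ θ') (Γ : η ⟶ θ) (Γ' : η' ⟶ θ')
    (h₀ : HEq (Γ.as.app src) (Γ'.as.app src)) (h₁ : HEq (Γ.as.app tgt) (Γ'.as.app tgt)) :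
    HEq Γ Γ' := by
  subst hH hK; cases hη; cases hθ
  refine heq_of_eq ?_
  ext x
  cases x
  · exact eq_of_heq h₀
  · exact eq_of_heq h₁

lemma whiskerRight_vidSq {a b : B} (p : a ⟶ b) :
    𝟙 (𝟙 a) ▷ p ≫ ((λ_ p).hom ≫ (ρ_ p).inv) = ((λ_ p).hom ≫ (ρ_ p).inv) ≫ p ◁ 𝟙 (𝟙 b) := by
  simp

variable [Strict B]

/-- Pasting with an identity square on the left changes a square only by the unit constraints. -/
lemma eqToHom_hpaste_vidSq_left {a b a' b' : B} {f : a ⟶ b} {p : a ⟶ a'} {q : b ⟶ b'}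
    {g : a' ⟶ b'} (h : f = 𝟙 a ≫ f) (k : g = 𝟙 a' ≫ g) (s : f ≫ q ⟶ p ≫ g) :
    s ≫ p ◁ eqToHom k = eqToHom h ▷ q ≫ hpaste (vidSq p) s := by
  have e : eqToHom h = (λ_ f).inv := by simp [Strict.leftUnitor_eqToIso]
  have e' : eqToHom k = (λ_ g).inv := by simp [Strict.leftUnitor_eqToIso]
  rw [e, e']
  unfold hpaste vidSq
  bicategory

/-- Pasting with an identity square on the right changes a square only by the unit constraints. -/
lemma eqToHom_hpaste_vidSq_right {a b a' b' : B} {f : a ⟶ b} {p : a ⟶ a'} {q : b ⟶ b'}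
    {g : a' ⟶ b'} (h : f = f ≫ 𝟙 b) (k : g = g ≫ 𝟙 b') (s : f ≫ q ⟶ p ≫ g) :
    s ≫ p ◁ eqToHom k = eqToHom h ▷ q ≫ hpaste s (vidSq q) := by
  have e : eqToHom h = (ρ_ f).inv := by simp [Strict.rightUnitor_eqToIso]
  have e' : eqToHom k = (ρ_ g).inv := by simp [Strict.rightUnitor_eqToIso]
  rw [e, e']
  unfold hpaste vidSq
  bicategory

/-- The pseudonatural transformation between diagrams of shape `2[X]` with components `p` and `q`
and 2-cells `ν x`. -/
def transOfDiagram {a b a' b' : B} {E : X ⥤ (a ⟶ b)} {E' : X ⥤ (a' ⟶ b')} (p : a ⟶ a')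
    (q : b ⟶ b') (ν : ∀ x, E.obj x ≫ q ≅ p ≫ E'.obj x)
    (hν : ∀ {x y : X} (m : x ⟶ y), E.map m ▷ q ≫ (ν y).hom = (ν x).hom ≫ p ◁ E'.map m) :
    (ofDiagram a b E).toPseudofunctor ⟶ (ofDiagram a' b' E').toPseudofunctor where
  app x := match x with
    | src => p
    | tgt => q
  naturality {x y} := match x, y with
    | src, src => fun _ => λ_ p ≪≫ (ρ_ p).symm
    | src, tgt => fun x => ν x
    | tgt, src => fun f => (f : Discrete PEmpty).as.elim
    | tgt, tgt => fun _ => λ_ q ≪≫ (ρ_ q).symm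
  naturality_naturality {x y f g} γ := by
    cases x <;> cases y
    · exact whiskerRight_vidSq p
    · exact hν γ
    · exact (f : Discrete PEmpty).as.elim
    · exact whiskerRight_vidSq q
  naturality_id x := by
    cases x
    · exact (whiskerRight_vidSq p).symm
    · exact (whiskerRight_vidSq q).symm
  naturality_comp {x y z} f g := by
    cases x <;> cases y <;> cases z <;>
    first
    | exact (f : Discrete PEmpty).as.elim
    | exact (g : Discrete PEmpty).as.elim
    | skip
    · exact eqToHom_hpaste_vidSq_left (Strict.id_comp _).symm (Strict.id_comp _).symm (vidSq p)
    · exact eqToHom_hpaste_vidSq_left (Strict.id_comp _).symm (Strict.id_comp _).symm (ν g).hom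
    · exact eqToHom_hpaste_vidSq_right (Strict.comp_id _).symm (Strict.comp_id _).symm (ν f).hom
    · exact eqToHom_hpaste_vidSq_left (Strict.id_comp _).symm (Strict.id_comp _).symm (vidSq q)

/-- The modification with components `γ` and `δ` between pseudonatural transformations of diagrams
of shape `2[X]`. -/
def modOfDiagram {H K : StrictPseudofunctor (Susp X) B}
    {η θ : H.toPseudofunctor ⟶ K.toPseudofunctor}
    (γ : η.app src ⟶ θ.app src) (δ : η.app tgt ⟶ θ.app tgt)
    (h : ∀ x : X, H.map (arr x) ◁ δ ≫ (θ.naturality (arr x)).hom =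
      (η.naturality (arr x)).hom ≫ γ ▷ K.map (arr x)) : η ⟶ θ where
  as :=
    { app := fun x => match x with
        | src => γ
        | tgt => δ
      naturality := fun {x y} f => by
        cases x <;> cases y
        · exact modification_naturality_id η θ (x := src) γ
        · exact h f
        · exact (f : Discrete PEmpty).as.elim
        · exact modification_naturality_id η θ (x := tgt) δ }

end Susp
end diagrams

/-! ### Cells of powers -/

namespace Susp

section gray

variable {X : Type} [Category.{0} X] {B : Type u} [Bicategory.{u, u} B]

lemma gray_hom_heq {H K H' K' : Gray (Susp X) B} (hH : H = H') (hK : K = K')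
    (η : H ⟶ K) (η' : H' ⟶ K')
    (h₀ : HEq (η.hom.app src) (η'.hom.app src)) (h₁ : HEq (η.hom.app tgt) (η'.hom.app tgt))
    (h : ∀ x : X, HEq (η.hom.naturality (arr x)).hom (η'.hom.naturality (arr x)).hom) :
    HEq η η' := by
  subst hH hK
  exact heq_of_eq (InducedBicategory.hom_ext (eq_of_heq (trans_heq rfl rfl _ _ h₀ h₁ h)))

lemma gray_hom₂_heq {H K H' K' : Gray (Susp X) B} (hH : H = H') (hK : K = K')
    {η θ : H ⟶ K} {η' θ' : H' ⟶ K'} (hη : HEq η η') (hθ : HEq θ θ') (Γ : η ⟶ θ) (Γ' : η' ⟶ θ')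
    (h₀ : HEq (Γ.hom.as.app src) (Γ'.hom.as.app src))
    (h₁ : HEq (Γ.hom.as.app tgt) (Γ'.hom.as.app tgt)) :
    HEq Γ Γ' := by
  subst hH hK; cases hη; cases hθ
  exact heq_of_eq (InducedBicategory.hom₂_ext
    (eq_of_heq (mod_heq rfl rfl HEq.rfl HEq.rfl _ _ h₀ h₁)))

variable {P : Type v} [Bicategory.{v, v} P]

lemma gray_app_heq {H K H' K' : Gray P B} (hH : H = H') (hK : K = K')
    {η : H ⟶ K} {η' : H' ⟶ K'} (h : HEq η η') (x : P) : HEq (η.hom.app x) (η'.hom.app x) := by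
  subst hH hK; cases h; rfl

lemma gray_naturality_heq {H K H' K' : Gray P B} (hH : H = H') (hK : K = K')
    {η : H ⟶ K} {η' : H' ⟶ K'} (h : HEq η η') {x y : P} (f : x ⟶ y) :
    HEq (η.hom.naturality f) (η'.hom.naturality f) := by
  subst hH hK; cases h; rfl

lemma gray_as_app_heq {H K H' K' : Gray P B} (hH : H = H') (hK : K = K')
    {η θ : H ⟶ K} {η' θ' : H' ⟶ K'} (hη : HEq η η') (hθ : HEq θ θ') {Γ : η ⟶ θ} {Γ' : η' ⟶ θ'}
    (h : HEq Γ Γ') (x : P) : HEq (Γ.hom.as.app x) (Γ'.hom.as.app x) := by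
  subst hH hK; cases hη; cases hθ; cases h; rfl

end gray

end Susp

/-! ### Transposing diagrams of pseudonatural transformations -/

section curry

open Susp

variable {X : Type} [Category.{0} X] {Y : Type} [Category.{0} Y] {B C : Type u}
  [Bicategory.{u, u} B] [Bicategory.{u, u} C] {F G : StrictPseudofunctor C B}

/-- The diagram of components at `c` of a diagram of pseudonatural transformations. -/
def evalDiagram (D : X ⥤ (F.toPseudofunctor ⟶ G.toPseudofunctor)) (c : C) :
    X ⥤ (F.obj c ⟶ G.obj c) where
  obj x := (D.obj x).app c
  map m := (D.map m).as.app c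
  map_id x := by rw [D.map_id]; rfl
  map_comp m n := by rw [D.map_comp]; rfl

variable [Strict B] [Strict C]

/-- The value at a 1-cell `f` of the transpose of a diagram of pseudonatural transformations. -/
def curryMap (D : X ⥤ (F.toPseudofunctor ⟶ G.toPseudofunctor)) {c c' : C} (f : c ⟶ c') :
    Gray.of (ofDiagram (F.obj c) (G.obj c) (evalDiagram D c)) ⟶
      Gray.of (ofDiagram (F.obj c') (G.obj c') (evalDiagram D c')) :=
  InducedBicategory.mkHom
    (transOfDiagram (E := evalDiagram D c) (E' := evalDiagram D c') (F.map f) (G.map f)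
      (fun x => ((D.obj x).naturality f).symm) (fun {x y} m => by
        change (D.map m).as.app c ▷ G.map f ≫ ((D.obj y).naturality f).inv =
          ((D.obj x).naturality f).inv ≫ F.map f ◁ (D.map m).as.app c'
        rw [Iso.comp_inv_eq, Category.assoc, (D.map m).as.naturality f, Iso.inv_hom_id_assoc]))

/-- The value at a 2-cell `γ` of the transpose of a diagram of pseudonatural transformations. -/
def curryMap₂ (D : X ⥤ (F.toPseudofunctor ⟶ G.toPseudofunctor)) {c c' : C} {f g : c ⟶ c'}
    (γ : f ⟶ g) : curryMap D f ⟶ curryMap D g :=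
  InducedBicategory.Hom₂.mk
    (modOfDiagram (F.map₂ γ) (G.map₂ γ) (fun x => by
      change (D.obj x).app c ◁ G.map₂ γ ≫ ((D.obj x).naturality g).inv =
        ((D.obj x).naturality f).inv ≫ F.map₂ γ ▷ (D.obj x).app c'
      rw [Iso.comp_inv_eq, Category.assoc, (D.obj x).naturality_naturality,
        Iso.inv_hom_id_assoc]))

lemma curryMap_id (D : X ⥤ (F.toPseudofunctor ⟶ G.toPseudofunctor)) (c : C) :
    curryMap D (𝟙 c) = 𝟙 _ := by
  refine InducedBicategory.hom_ext (strongTrans_eq (fun x => ?_)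
    (modOfDiagram (F.mapId c).hom (G.mapId c).hom (fun x => ?_)) (fun x => ?_))
  · cases x
    · exact F.map_id c
    · exact G.map_id c
  · change (D.obj x).app c ◁ (G.mapId c).hom ≫
      ((ρ_ ((D.obj x).app c)).hom ≫ (λ_ ((D.obj x).app c)).inv) =
        ((D.obj x).naturality (𝟙 c)).inv ≫ (F.mapId c).hom ▷ (D.obj x).app c
    rw [Iso.eq_inv_comp, (D.obj x).naturality_id_assoc]
    simp
  · cases x
    · exact congrArg Iso.hom (F.mapId_eq_eqToIso c)
    · exact congrArg Iso.hom (G.mapId_eq_eqToIso c)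

lemma curryMap_comp (D : X ⥤ (F.toPseudofunctor ⟶ G.toPseudofunctor)) {c c' c'' : C}
    (f : c ⟶ c') (g : c' ⟶ c'') : curryMap D (f ≫ g) = curryMap D f ≫ curryMap D g := by
  refine InducedBicategory.hom_ext (strongTrans_eq (fun x => ?_)
    (modOfDiagram (F.mapComp f g).hom (G.mapComp f g).hom (fun x => ?_)) (fun x => ?_))
  · cases x
    · exact F.map_comp f g
    · exact G.map_comp f g
  · change (D.obj x).app c ◁ (G.mapComp f g).hom ≫
      vpaste ((D.obj x).naturality f).inv ((D.obj x).naturality g).inv =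
        ((D.obj x).naturality (f ≫ g)).inv ≫ (F.mapComp f g).hom ▷ (D.obj x).app c''
    rw [Iso.eq_inv_comp, (D.obj x).naturality_comp_assoc]
    unfold vpaste
    simp
  · cases x
    · exact congrArg Iso.hom (F.mapComp_eq_eqToIso f g)
    · exact congrArg Iso.hom (G.mapComp_eq_eqToIso f g)

/-- The 2-functor `C → B^{2[X]}` corresponding to an `X`-shaped diagram of pseudonatural
transformations `F ⇒ G` and modifications between them. -/
def curry (D : X ⥤ (F.toPseudofunctor ⟶ G.toPseudofunctor)) :
    StrictPseudofunctor C (Gray (Susp X) B) :=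
  StrictPseudofunctor.mk''
    { obj := fun c => Gray.of (ofDiagram (F.obj c) (G.obj c) (evalDiagram D c))
      map := curryMap D
      map₂ := curryMap₂ D
      map₂_id := fun {c c'} f => by
        refine eq_of_heq (gray_hom₂_heq rfl rfl HEq.rfl HEq.rfl _ _ ?_ ?_)
        · exact heq_of_eq (F.map₂_id f)
        · exact heq_of_eq (G.map₂_id f)
      map₂_comp := fun {c c' f g h} γ δ => by
        refine eq_of_heq (gray_hom₂_heq rfl rfl HEq.rfl HEq.rfl _ _ ?_ ?_)
        · exact heq_of_eq (F.map₂_comp γ δ)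
        · exact heq_of_eq (G.map₂_comp γ δ)
      map_id := curryMap_id D
      map_comp := curryMap_comp D
      map₂_whisker_left := fun {a b c} f {g h} γ => by
        refine eqToHom_conj_eq _ _ _ (gray_hom₂_heq rfl rfl (heq_of_eq (curryMap_comp D f g))
          (heq_of_eq (curryMap_comp D f h)) _ _ ?_ ?_)
        · exact map₂_whiskerLeft_heq F f γ
        · exact map₂_whiskerLeft_heq G f γ
      map₂_whisker_right := fun {a b c f g} γ h => by
        refine eqToHom_conj_eq _ _ _ (gray_hom₂_heq rfl rfl (heq_of_eq (curryMap_comp D f h))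
          (heq_of_eq (curryMap_comp D g h)) _ _ ?_ ?_)
        · exact map₂_whiskerRight_heq F γ h
        · exact map₂_whiskerRight_heq G γ h }

variable {I : Type u} [Bicategory.{u, u} I] [Strict I]

/-- Precomposition of a diagram of pseudonatural transformations with a 2-functor. -/
def precompDiagram (P : StrictPseudofunctor I C) (F G : StrictPseudofunctor C B) :
    (F.toPseudofunctor ⟶ G.toPseudofunctor) ⥤
      ((P.comp F).toPseudofunctor ⟶ (P.comp G).toPseudofunctor) where
  obj η := precompTrans P η
  map Γ :=
    { as :=
      { app := fun x => Γ.as.app (P.obj x)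
        naturality := fun f => Γ.as.naturality (P.map f) } }

/-- The transpose of a diagram `D'` over `I` restricts along `R` to the transpose of `D` as soon as
`D'` extends the restriction of `D` along `P`. -/
lemma curry_comp_precomp {P : StrictPseudofunctor I C} (R : X ⥤ Y)
    (D : X ⥤ (F.toPseudofunctor ⟶ G.toPseudofunctor))
    (D' : Y ⥤ ((P.comp F).toPseudofunctor ⟶ (P.comp G).toPseudofunctor))
    (h : R ⋙ D' = D ⋙ precompDiagram P F G) :
    (curry D').comp (precomp (Susp.map R)) = P.comp (curry D) := by
  have h₀ (z : I) : R ⋙ evalDiagram D' z = evalDiagram D (P.obj z) := by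
    change evalDiagram (R ⋙ D') z = _
    rw [h]
    rfl
  have hobj (z : I) : ((curry D').comp (precomp (Susp.map R))).obj z = (P.comp (curry D)).obj z :=
    Susp.functor_ext rfl rfl (heq_of_eq (h₀ z))
  have hmap {x y : I} (f : x ⟶ y) : HEq (((curry D').comp (precomp (Susp.map R))).map f)
      ((P.comp (curry D)).map f) := by
    refine gray_hom_heq (hobj x) (hobj y) _ _ HEq.rfl HEq.rfl (fun w => ?_)
    have e (η η' : (P.comp F).toPseudofunctor ⟶ (P.comp G).toPseudofunctor) (h : η = η') :
        HEq (η.naturality f).inv (η'.naturality f).inv := by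
      subst h; rfl
    exact e _ _ (Functor.congr_obj h w)
  exact strictPseudofunctor_ext hobj hmap fun γ =>
    gray_hom₂_heq (hobj _) (hobj _) (hmap _) (hmap _) _ _ HEq.rfl HEq.rfl

end curry

/-! ### Pullbacks of powers of the 2-functors `2[R]` -/

section criterion

open Susp

variable {X : Type} [Category.{0} X] {Y : Type} [Category.{0} Y] {I B C : Type u}
  [Bicategory.{u, u} B] [Bicategory.{u, u} C] [Bicategory.{u, u} I] [Strict I] [Strict B] [Strict C]
  {F G : StrictPseudofunctor C B}

/-- Every 1-cell of `B^{2[X]}` is given by its components and its 2-cells at the objects of `X`. -/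
lemma exists_eq_transOfDiagram {a b a' b' : B} {E : X ⥤ (a ⟶ b)} {E' : X ⥤ (a' ⟶ b')}
    (η : Gray.of (ofDiagram a b E) ⟶ Gray.of (ofDiagram a' b' E')) :
    ∃ (p : a ⟶ a') (q : b ⟶ b') (ν : ∀ x, E.obj x ≫ q ≅ p ≫ E'.obj x)
      (hν : ∀ {x y : X} (m : x ⟶ y), E.map m ▷ q ≫ (ν y).hom = (ν x).hom ≫ p ◁ E'.map m),
      η = InducedBicategory.mkHom (X := Gray.of (ofDiagram a b E))
        (Y := Gray.of (ofDiagram a' b' E')) (transOfDiagram p q ν hν) :=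
  ⟨η.hom.app src, η.hom.app tgt, fun x => η.hom.naturality (arr x),
    fun m => η.hom.naturality_naturality (arr₂ m),
    eq_of_heq (gray_hom_heq rfl rfl _ _ HEq.rfl HEq.rfl (fun _ => HEq.rfl))⟩

/-- Inverting two opposite sides of a commutative square. -/
lemma iso_square {C : Type*} [Category* C] {a b c d : C} (i : a ≅ b) (j : c ≅ d) {p : a ⟶ c}
    {q : b ⟶ d} (h : p ≫ j.hom = i.hom ≫ q) : q ≫ j.inv = i.inv ≫ p := by
  rw [Iso.comp_inv_eq, Category.assoc, h, Iso.inv_hom_id_assoc]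

/-- `P : I → C` is the pullback of `B^{2[R]}` along the transpose of the diagram `D` as soon as the
0-cells of `I` are the 0-cells `c` of `C` with an extension of the diagram of components of `D` at
`c` along `R`, its 1-cells are the 1-cells `g` of `C` with naturality isomorphisms at `g` extending
those of `D`, and its 2-cells are the 2-cells of `C` compatible with these isomorphisms. -/
lemma isCellwisePullback_curry {P : StrictPseudofunctor I C} (R : X ⥤ Y)
    (D : X ⥤ (F.toPseudofunctor ⟶ G.toPseudofunctor))
    (D' : Y ⥤ ((P.comp F).toPseudofunctor ⟶ (P.comp G).toPseudofunctor))
    (h : R ⋙ D' = D ⋙ precompDiagram P F G)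
    (inj₀ : ∀ z z' : I, P.obj z = P.obj z' →
      HEq (evalDiagram D' z) (evalDiagram D' z') → z = z')
    (surj₀ : ∀ (c : C) (E : Y ⥤ (F.obj c ⟶ G.obj c)), R ⋙ E = evalDiagram D c →
      ∃ z, P.obj z = c ∧ HEq (evalDiagram D' z) E)
    (inj₁ : ∀ {x y : I} (f f' : x ⟶ y), P.map f = P.map f' →
      (∀ w, HEq ((D'.obj w).naturality f) ((D'.obj w).naturality f')) → f = f')
    (surj₁ : ∀ {x y : I} (g : P.obj x ⟶ P.obj y)
      (ν : ∀ w : Y, F.map g ≫ (D'.obj w).app y ≅ (D'.obj w).app x ≫ G.map g),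
      (∀ {w w' : Y} (m : w ⟶ w'), F.map g ◁ (D'.map m).as.app y ≫ (ν w').hom =
        (ν w).hom ≫ (D'.map m).as.app x ▷ G.map g) →
      (∀ v : X, HEq (ν (R.obj v)) ((D.obj v).naturality g)) →
      ∃ f : x ⟶ y, P.map f = g ∧ ∀ w, HEq ((D'.obj w).naturality f) (ν w))
    (inj₂ : ∀ {x y : I} {f g : x ⟶ y} (γ γ' : f ⟶ g), P.map₂ γ = P.map₂ γ' → γ = γ')
    (surj₂ : ∀ {x y : I} {f g : x ⟶ y} (β : P.map f ⟶ P.map g),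
      (∀ w, F.map₂ β ▷ (D'.obj w).app y ≫ ((D'.obj w).naturality g).hom =
        ((D'.obj w).naturality f).hom ≫ (D'.obj w).app x ◁ G.map₂ β) →
      ∃ γ : f ⟶ g, P.map₂ γ = β) :
    IsCellwisePullback (curry D') P (precomp (Susp.map R)) (curry D) := by
  have hcomm := curry_comp_precomp R D D' h
  have ev {a b a' b' : B} {E : Y ⥤ (a ⟶ b)} {E' : Y ⥤ (a' ⟶ b')}
      (hE : ofDiagram a b E = ofDiagram a' b' E') : HEq E E' := by
    have key {H K : StrictPseudofunctor (Susp Y) B} (e : H = K) :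
        HEq (toDiagram H) (toDiagram K) := by
      subst e; rfl
    exact key hE
  have symmEq {a b : B} {f g f' g' : a ⟶ b} (hf : f = f') (hg : g = g') {θ : f ≅ g} {θ' : f' ≅ g'}
      (hθ : HEq θ θ') : HEq θ.symm θ'.symm := by
    subst hf hg; cases hθ; rfl
  refine ⟨hcomm, fun x x' h₁ h₂ => inj₀ x x' h₂ (ev h₁), fun d c hdc => ?_, fun {x y} f f' h₁ h₂ =>
    inj₁ f f' h₂ fun w => ?_, fun {x y} f g hfg => ?_, fun γ γ' _ h₂ => inj₂ γ γ' h₂,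
    fun {x y k l} α β hαβ => ?_⟩
  -- An object over `c` is a diagram that extends the diagram of components at `c`.
  · have aux (d : StrictPseudofunctor (Susp Y) B) {a b : B} {E₀ : X ⥤ (a ⟶ b)}
        (e : (Susp.map R).comp d = ofDiagram a b E₀) :
        ∃ E : Y ⥤ (a ⟶ b), d = ofDiagram a b E ∧ R ⋙ E = E₀ := by
      obtain rfl : d.obj src = a := obj_eq_of_eq e src
      obtain rfl : d.obj tgt = b := obj_eq_of_eq e tgt
      refine ⟨toDiagram d, (ofDiagram_toDiagram d).symm, ?_⟩
      have key {H K : StrictPseudofunctor (Susp X) B} (e : H = K) :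
          HEq (toDiagram H) (toDiagram K) := by
        subst e; rfl
      exact eq_of_heq (key e)
    obtain ⟨E, rfl, hE⟩ := aux d hdc
    obtain ⟨z, rfl, hz⟩ := surj₀ c E hE
    refine ⟨z, ?_, rfl⟩
    obtain rfl := eq_of_heq hz
    rfl
  · have e := gray_naturality_heq rfl rfl (heq_of_eq h₁) (arr w)
    exact symmEq (congrArg (fun p => (D'.obj w).app x ≫ G.map p) h₂)
      (congrArg (fun p => F.map p ≫ (D'.obj w).app y) h₂) e
  -- A 1-cell over `g` consists of `F g`, `G g` and naturality 2-cells, which are the inverses of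
  -- those of pseudonatural transformations on `I`.
  · have hx := obj_eq_of_eq hcomm x
    have hy := obj_eq_of_eq hcomm y
    obtain ⟨p, q, ν, hν, rfl⟩ := exists_eq_transOfDiagram f
    obtain rfl : p = F.map g := eq_of_heq (gray_app_heq hx hy hfg src)
    obtain rfl : q = G.map g := eq_of_heq (gray_app_heq hx hy hfg tgt)
    obtain ⟨k, rfl, hk⟩ := surj₁ g (fun w => (ν w).symm) (fun {w w'} m =>
      iso_square (ν w) (ν w') (hν m)) (fun v => by
        have e := gray_naturality_heq hx hy hfg (arr v)
        have e' : (D'.obj (R.obj v)) = precompTrans P (D.obj v) := Functor.congr_obj h v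
        refine symmEq (θ := ν (R.obj v)) (θ' := ((D.obj v).naturality g).symm) ?_ ?_ e
        · change (D'.obj (R.obj v)).app x ≫ G.map g = (D.obj v).app (P.obj x) ≫ G.map g
          rw [e']
          rfl
        · change F.map g ≫ (D'.obj (R.obj v)).app y = F.map g ≫ (D.obj v).app (P.obj y)
          rw [e']
          rfl)
    refine ⟨k, eq_of_heq (gray_hom_heq rfl rfl _ _ HEq.rfl HEq.rfl (fun w => ?_)), rfl⟩
    exact heq_of_eq (congrArg Iso.inv (eq_of_heq (hk w)))
  -- A 2-cell over `β` has the components `F β` and `G β`; its axiom is compatibility with `D'`.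
  · have hx := obj_eq_of_eq hcomm x
    have hy := obj_eq_of_eq hcomm y
    have hk := map_heq_of_eq hcomm k
    have hl := map_heq_of_eq hcomm l
    have h₀ : α.hom.as.app src = F.map₂ β := eq_of_heq (gray_as_app_heq hx hy hk hl hαβ src)
    have h₁ : α.hom.as.app tgt = G.map₂ β := eq_of_heq (gray_as_app_heq hx hy hk hl hαβ tgt)
    obtain ⟨γ, rfl⟩ := surj₂ β (fun w => by
      have e := α.hom.as.naturality (arr w)
      rw [h₀, h₁] at e
      change (D'.obj w).app x ◁ G.map₂ β ≫ ((D'.obj w).naturality l).inv =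
        ((D'.obj w).naturality k).inv ≫ F.map₂ β ▷ (D'.obj w).app y at e
      exact iso_square ((D'.obj w).naturality k).symm ((D'.obj w).naturality l).symm e)
    refine ⟨γ, eq_of_heq (gray_hom₂_heq rfl rfl HEq.rfl HEq.rfl _ _ ?_ ?_), rfl⟩
    · exact heq_of_eq h₀.symm
    · exact heq_of_eq h₁.symm

end criterion

/-! ### Locally full sub-2-categories -/

/-- Data for a 2-category over `C`, full on 2-cells and faithful on 1-cells: a family `ob` of
objects of `C`, and a class `mem` of 1-cells between its members that contains the identities and is
closed under composition. -/
structure Refinement (C : Type u) [Bicategory.{u, u} C] where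
  /-- The indexing type of the family of objects. -/
  Obj : Type u
  /-- The family of objects. -/
  ob : Obj → C
  /-- The class of 1-cells. -/
  mem {x y : Obj} : (ob x ⟶ ob y) → Prop
  id_mem (x : Obj) : mem (𝟙 (ob x))
  comp_mem {x y z : Obj} {f : ob x ⟶ ob y} {g : ob y ⟶ ob z} : mem f → mem g → mem (f ≫ g)

namespace Refinement

variable {C : Type u} [Bicategory.{u, u} C] (R : Refinement C)

/-- The 2-category described by a refinement: its 1-cells are the members of the chosen class, its
2-cells are those of `C`. -/
structure Total : Type u where
  /-- The index of an object. -/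
  as : R.Obj

variable {R}

/-- The 1-cells of the 2-category described by a refinement. -/
@[ext]
structure Hom (x y : R.Total) : Type u where
  /-- The underlying 1-cell. -/
  hom : R.ob x.as ⟶ R.ob y.as
  mem : R.mem hom

instance : CategoryStruct R.Total where
  Hom := Hom
  id x := ⟨𝟙 _, R.id_mem x.as⟩
  comp f g := ⟨f.hom ≫ g.hom, R.comp_mem f.mem g.mem⟩

/-- The 2-cells of the 2-category described by a refinement. -/
@[ext]
structure Hom₂ {x y : R.Total} (f g : x ⟶ y) : Type u where
  /-- The underlying 2-cell. -/
  hom : f.hom ⟶ g.hom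

instance homCategory (x y : R.Total) : Category (x ⟶ y) where
  Hom f g := Hom₂ f g
  id f := ⟨𝟙 f.hom⟩
  comp γ δ := ⟨γ.hom ≫ δ.hom⟩
  id_comp γ := Hom₂.ext (Category.id_comp γ.hom)
  comp_id γ := Hom₂.ext (Category.comp_id γ.hom)
  assoc γ δ κ := Hom₂.ext (Category.assoc γ.hom δ.hom κ.hom)

@[ext]
lemma hom₂_ext {x y : R.Total} {f g : x ⟶ y} {γ δ : f ⟶ g} (h : γ.hom = δ.hom) : γ = δ :=
  Hom₂.ext h

/-- An invertible 2-cell of `C`, as an invertible 2-cell of the 2-category of a refinement. -/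
def isoMk {x y : R.Total} {f g : x ⟶ y} (θ : f.hom ≅ g.hom) : f ≅ g where
  hom := Hom₂.mk θ.hom
  inv := Hom₂.mk θ.inv
  hom_inv_id := hom₂_ext θ.hom_inv_id
  inv_hom_id := hom₂_ext θ.inv_hom_id

instance : Bicategory R.Total where
  homCategory := homCategory
  whiskerLeft f _ _ γ := Hom₂.mk (f.hom ◁ γ.hom)
  whiskerRight γ h := Hom₂.mk (γ.hom ▷ h.hom)
  associator f g h := isoMk (α_ f.hom g.hom h.hom)
  leftUnitor f := isoMk (λ_ f.hom)
  rightUnitor f := isoMk (ρ_ f.hom)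
  whiskerLeft_id _ _ := hom₂_ext (whiskerLeft_id _ _)
  whiskerLeft_comp _ _ _ _ _ _ := hom₂_ext (whiskerLeft_comp _ _ _)
  id_whiskerLeft _ := hom₂_ext (id_whiskerLeft _)
  comp_whiskerLeft _ _ _ _ _ := hom₂_ext (comp_whiskerLeft _ _ _)
  id_whiskerRight _ _ := hom₂_ext (id_whiskerRight _ _)
  comp_whiskerRight _ _ _ := hom₂_ext (comp_whiskerRight _ _ _)
  whiskerRight_id _ := hom₂_ext (whiskerRight_id _)
  whiskerRight_comp _ _ _ := hom₂_ext (whiskerRight_comp _ _ _)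
  whisker_assoc _ _ _ _ _ := hom₂_ext (whisker_assoc _ _ _)
  whisker_exchange _ _ := hom₂_ext (whisker_exchange _ _)
  pentagon _ _ _ _ := hom₂_ext (pentagon _ _ _ _)
  triangle _ _ := hom₂_ext (triangle _ _)

lemma eqToIso_eq {x y : R.Total} {f g : x ⟶ y} (h : f = g) :
    eqToIso h = isoMk (eqToIso (congrArg Hom.hom h)) := by
  subst h; rfl

lemma hom_ext {x y : R.Total} {f g : x ⟶ y} (h : f.hom = g.hom) : f = g := Hom.ext h

instance [Strict C] : Strict R.Total where
  id_comp f := hom_ext (Strict.id_comp f.hom)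
  comp_id f := hom_ext (Strict.comp_id f.hom)
  assoc f g h := hom_ext (Strict.assoc f.hom g.hom h.hom)
  leftUnitor_eqToIso f := (congrArg isoMk (Strict.leftUnitor_eqToIso f.hom)).trans
    (eqToIso_eq _).symm
  rightUnitor_eqToIso f := (congrArg isoMk (Strict.rightUnitor_eqToIso f.hom)).trans
    (eqToIso_eq _).symm
  associator_eqToIso f g h := (congrArg isoMk (Strict.associator_eqToIso f.hom g.hom
    h.hom)).trans (eqToIso_eq _).symm

variable (R) in
/-- The projection to `C`. -/
def proj : StrictPseudofunctor R.Total C :=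
  StrictPseudofunctor.mk'
    { obj := fun x => R.ob x.as
      map := fun f => f.hom
      map₂ := fun γ => γ.hom
      map_id := fun _ => rfl
      map_comp := fun _ _ => rfl
      map₂_whisker_left := fun _ _ _ _ => eq_conj_id _
      map₂_whisker_right := fun _ _ => eq_conj_id _
      map₂_left_unitor := fun _ => (Category.id_comp _).symm
      map₂_right_unitor := fun _ => (Category.id_comp _).symm
      map₂_associator := fun _ _ _ => eq_conj_id _ }

end Refinement

/-! ### Inserters and equifiers of 3-cells -/

section inserters

variable {C B : Type u} [Bicategory.{u, u} C] [Bicategory.{u, u} B] {F G : StrictPseudofunctor C B}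

/-- The square of a pseudonatural transformation at a composite is the pasting of the two squares,
up to the constraints of the 2-functors. -/
lemma naturality_comp_eq_hpaste (η : F.toPseudofunctor ⟶ G.toPseudofunctor) {x y z : C}
    (f : x ⟶ y) (g : y ⟶ z) : (η.naturality (f ≫ g)).hom =
      (F.mapComp f g).hom ▷ η.app z ≫ hpaste (η.naturality f).hom (η.naturality g).hom ≫
        η.app x ◁ (G.mapComp f g).inv := by
  rw [Pseudofunctor.StrongTrans.naturality_comp_hom]
  simp [hpaste]

/-- Naturality at the 1-cell `f` of a pair of 2-cells `α_x ⟶ β_x` and `α_y ⟶ β_y`. -/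
def NaturalAt (α β : F.toPseudofunctor ⟶ G.toPseudofunctor) {x y : C} (s : α.app x ⟶ β.app x)
    (t : α.app y ⟶ β.app y) (f : x ⟶ y) : Prop :=
  F.map f ◁ t ≫ (β.naturality f).hom = (α.naturality f).hom ≫ s ▷ G.map f

variable {α β : F.toPseudofunctor ⟶ G.toPseudofunctor}

lemma NaturalAt.id {x : C} (s : α.app x ⟶ β.app x) : NaturalAt α β s s (𝟙 x) :=
  modification_naturality_id α β s

lemma NaturalAt.comp {x y z : C} {s : α.app x ⟶ β.app x} {t : α.app y ⟶ β.app y}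
    {r : α.app z ⟶ β.app z} {f : x ⟶ y} {g : y ⟶ z} (hf : NaturalAt α β s t f)
    (hg : NaturalAt α β t r g) : NaturalAt α β s r (f ≫ g) := by
  have e := hpaste_cell hf hg
  unfold NaturalAt
  rw [naturality_comp_eq_hpaste, naturality_comp_eq_hpaste, whisker_exchange_assoc, reassoc_of% e,
    Category.assoc, Category.assoc, whisker_exchange]

variable (α β)

/-- The 3-cell inserter of `α` and `β`: an object is an object `c` with a 2-cell `α_c ⟶ β_c`, and
the 1-cells are those at which these 2-cells are natural. -/
def inserter : Refinement C where
  Obj := Σ c : C, α.app c ⟶ β.app c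
  ob := Sigma.fst
  mem {x y} f := NaturalAt α β x.2 y.2 f
  id_mem x := NaturalAt.id x.2
  comp_mem := NaturalAt.comp

/-- The iso-3-cell inserter of `α` and `β`. -/
def isoInserter : Refinement C where
  Obj := Σ c : C, α.app c ≅ β.app c
  ob := Sigma.fst
  mem {x y} f := NaturalAt α β x.2.hom y.2.hom f
  id_mem x := NaturalAt.id x.2.hom
  comp_mem := NaturalAt.comp

variable {α β}

/-- The 3-cell equifier of `Γ` and `Γ'`: the full sub-2-category on the objects at which they
agree. -/
def equifier (Γ Γ' : α ⟶ β) : Refinement C where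
  Obj := { c : C // Γ.as.app c = Γ'.as.app c }
  ob := Subtype.val
  mem _ := True
  id_mem _ := trivial
  comp_mem _ _ := trivial

variable (α β)

/-- The universal modification on the 3-cell inserter. -/
def inserterMod : precompTrans (inserter α β).proj α ⟶ precompTrans (inserter α β).proj β where
  as :=
    { app := fun x => x.as.2
      naturality := fun f => f.mem }

/-- The universal invertible modification on the iso-3-cell inserter. -/
def isoInserterMod :
    precompTrans (isoInserter α β).proj α ≅ precompTrans (isoInserter α β).proj β where
  hom :=
    { as :=
      { app := fun x => x.as.2.hom
        naturality := fun f => f.mem } }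
  inv :=
    { as :=
      { app := fun x => x.as.2.inv
        naturality := fun {x y} f => by
          have e := f.mem
          change F.map f.hom ◁ y.as.2.inv ≫ (α.naturality f.hom).hom =
            (β.naturality f.hom).hom ≫ x.as.2.inv ▷ G.map f.hom
          have e' := iso_square (whiskerLeftIso (F.map f.hom) y.as.2)
            (whiskerRightIso x.as.2 (G.map f.hom)) e.symm
          exact e'.symm } }
  hom_inv_id := by
    ext x
    exact x.as.2.hom_inv_id
  inv_hom_id := by
    ext x
    exact x.as.2.inv_hom_id

variable {α β}

/-- A 2-functor that exhibits its source, up to isomorphism, as the full sub-2-category on the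
objects at which the modifications `Γ` and `Γ'` agree. -/
structure IsEquifierMap {E : Type u} [Bicategory.{u, u} E] (P : StrictPseudofunctor E C)
    (Γ Γ' : α ⟶ β) : Prop where
  obj_injective : Function.Injective P.obj
  app_eq (z : E) : Γ.as.app (P.obj z) = Γ'.as.app (P.obj z)
  exists_obj (c : C) : Γ.as.app c = Γ'.as.app c → ∃ z, P.obj z = c
  map_bijective (x y : E) : Function.Bijective (P.map : (x ⟶ y) → _)
  map₂_bijective {x y : E} (f g : x ⟶ y) : Function.Bijective (P.map₂ : (f ⟶ g) → _)

lemma isEquifierMap_proj (Γ Γ' : α ⟶ β) : IsEquifierMap (equifier Γ Γ').proj Γ Γ' where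
  obj_injective := by
    rintro ⟨x⟩ ⟨y⟩ h
    exact congrArg Refinement.Total.mk (Subtype.ext h)
  app_eq z := z.as.2
  exists_obj c h := ⟨⟨⟨c, h⟩⟩, rfl⟩
  map_bijective x y := ⟨fun _ _ h => Refinement.Hom.ext h, fun f => ⟨⟨f, trivial⟩, rfl⟩⟩
  map₂_bijective f g := ⟨fun _ _ h => Refinement.Hom₂.ext h, fun γ => ⟨⟨γ⟩, rfl⟩⟩

end inserters

/-! ### Functors on the shapes of the generating cofibrations -/

section shapes

variable {K : Type u} [Category.{v} K]

/-- The functor on the free isomorphism given by an isomorphism. -/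
def isoFunctor {a b : K} (θ : a ≅ b) : Codiscrete (Fin 2) ⥤ K where
  obj x := match x.as with
    | 0 => a
    | 1 => b
  map {x y} _ := match x, y with
    | ⟨0⟩, ⟨0⟩ => 𝟙 a
    | ⟨0⟩, ⟨1⟩ => θ.hom
    | ⟨1⟩, ⟨0⟩ => θ.inv
    | ⟨1⟩, ⟨1⟩ => 𝟙 b
  map_id x := by
    obtain ⟨i⟩ := x
    fin_cases i <;> rfl
  map_comp {x y z} _ _ := by
    obtain ⟨i⟩ := x
    obtain ⟨j⟩ := y
    obtain ⟨k⟩ := z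
    fin_cases i <;> fin_cases j <;> fin_cases k <;>
    first
      | exact (Category.id_comp _).symm
      | exact (Category.comp_id _).symm
      | exact θ.hom_inv_id.symm
      | exact θ.inv_hom_id.symm

lemma exists_eq_isoFunctor (E : Codiscrete (Fin 2) ⥤ K) :
    ∃ (a b : K) (θ : a ≅ b), E = isoFunctor θ := by
  refine ⟨_, _, E.mapIso (Codiscrete.iso ⟨0⟩ ⟨1⟩), CategoryTheory.Functor.ext ?_ ?_⟩
  · rintro ⟨i⟩
    fin_cases i <;> rfl
  · rintro ⟨i⟩ ⟨j⟩ f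
    fin_cases i <;> fin_cases j
    · exact (E.map_id _).trans ((Category.id_comp _).trans (Category.comp_id _)).symm
    · exact ((Category.id_comp _).trans (Category.comp_id _)).symm
    · exact ((Category.id_comp _).trans (Category.comp_id _)).symm
    · exact (E.map_id _).trans ((Category.id_comp _).trans (Category.comp_id _)).symm

/-- The diagram of shape `1 + 1` given by two objects. -/
abbrev pairDiagram (a b : K) : Discrete (Fin 2) ⥤ K := Discrete.functor ![a, b]

/-- The inclusion of two objects into the free morphism. -/
abbrev toFree : Discrete (Fin 2) ⥤ Fin 2 := Discrete.functor fun j => j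

/-- The inclusion of two objects into the free isomorphism. -/
abbrev toFreeIso : Discrete (Fin 2) ⥤ Codiscrete (Fin 2) := Discrete.functor Codiscrete.mk

/-- The identification of the two morphisms of the free parallel pair. -/
abbrev mergePair : Limits.WalkingParallelPair ⥤ Fin 2 :=
  Limits.parallelPair (homOfLE (Fin.zero_le (1 : Fin 2))) (homOfLE (Fin.zero_le 1))

/-- The morphism of the free morphism. -/
abbrev freeArrow : (0 : Fin 2) ⟶ 1 := homOfLE (Fin.zero_le 1)

end shapes

/-! ### Inserters and equifiers are pullbacks -/

section pullbacks

open Susp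

variable {C B : Type u} [Bicategory.{u, u} C] [Bicategory.{u, u} B] [Strict C] [Strict B]
  {F G : StrictPseudofunctor C B} (α β : F.toPseudofunctor ⟶ G.toPseudofunctor)

/-- The 3-cell inserter of `α` and `β` is the pullback of `B^{i₃}` along `(α, β)`. -/
lemma isCellwisePullback_inserter :
    IsCellwisePullback (curry (ComposableArrows.mk₁ (inserterMod α β))) (inserter α β).proj
      (precomp (Susp.map toFree)) (curry (pairDiagram α β)) := by
  refine isCellwisePullback_curry _ _ _ ?_ ?_ ?_ ?_ ?_ ?_ ?_
  · refine Discrete.functor_ext fun i => ?_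
    fin_cases i <;> rfl
  · rintro ⟨⟨c, s⟩⟩ ⟨⟨c', s'⟩⟩ h h'
    obtain rfl : c = c' := h
    obtain rfl : s = s' := eq_of_heq (Functor.hcongr_hom (eq_of_heq h') freeArrow)
    rfl
  · intro c E hE
    obtain ⟨a, b, t, rfl⟩ := ComposableArrows.mk₁_surjective E
    obtain rfl : a = α.app c := Functor.congr_obj hE ⟨0⟩
    obtain rfl : b = β.app c := Functor.congr_obj hE ⟨1⟩
    refine ⟨⟨⟨c, t⟩⟩, rfl, heq_of_eq (ComposableArrows.ext₁ rfl rfl ?_)⟩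
    exact eq_conj_id _
  · intro x y f f' h _
    exact Refinement.hom_ext h
  · intro x y g ν hν h
    have h₀ : ν 0 = α.naturality g := eq_of_heq (h ⟨0⟩)
    have h₁ : ν 1 = β.naturality g := eq_of_heq (h ⟨1⟩)
    refine ⟨⟨g, ?_⟩, rfl, fun w => ?_⟩
    · have e := hν freeArrow
      rw [h₀, h₁] at e
      exact e
    · fin_cases w
      · exact heq_of_eq h₀.symm
      · exact heq_of_eq h₁.symm
  · intro x y f g γ γ' h
    exact Refinement.hom₂_ext h
  · intro x y f g b _
    exact ⟨⟨b⟩, rfl⟩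

/-- The iso-3-cell inserter of `α` and `β` is the pullback of `B^k` along `(α, β)`. -/
lemma isCellwisePullback_isoInserter :
    IsCellwisePullback (curry (isoFunctor (isoInserterMod α β))) (isoInserter α β).proj
      (precomp (Susp.map toFreeIso)) (curry (pairDiagram α β)) := by
  refine isCellwisePullback_curry _ _ _ ?_ ?_ ?_ ?_ ?_ ?_ ?_
  · refine Discrete.functor_ext fun i => ?_
    fin_cases i <;> rfl
  · rintro ⟨⟨c, s⟩⟩ ⟨⟨c', s'⟩⟩ h h'
    obtain rfl : c = c' := h
    have e := eq_of_heq (Functor.hcongr_hom (eq_of_heq h')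
      (Codiscrete.iso (⟨0⟩ : Codiscrete (Fin 2)) ⟨1⟩).hom)
    obtain rfl : s = s' := Iso.ext e
    rfl
  · intro c E hE
    obtain ⟨a, b, t, rfl⟩ := exists_eq_isoFunctor E
    obtain rfl : a = α.app c := Functor.congr_obj hE ⟨0⟩
    obtain rfl : b = β.app c := Functor.congr_obj hE ⟨1⟩
    refine ⟨⟨⟨c, t⟩⟩, rfl, heq_of_eq (CategoryTheory.Functor.ext ?_ ?_)⟩
    · rintro ⟨i⟩
      fin_cases i <;> rfl
    · rintro ⟨i⟩ ⟨j⟩ f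
      fin_cases i <;> fin_cases j <;> exact eq_conj_id _
  · intro x y f f' h _
    exact Refinement.hom_ext h
  · intro x y g ν hν h
    have h₀ : ν ⟨0⟩ = α.naturality g := eq_of_heq (h ⟨0⟩)
    have h₁ : ν ⟨1⟩ = β.naturality g := eq_of_heq (h ⟨1⟩)
    refine ⟨⟨g, ?_⟩, rfl, fun w => ?_⟩
    · have e := hν (Codiscrete.iso ⟨0⟩ ⟨1⟩).hom
      rw [h₀, h₁] at e
      exact e
    · obtain ⟨i⟩ := w
      fin_cases i
      · exact heq_of_eq h₀.symm
      · exact heq_of_eq h₁.symm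
  · intro x y f g γ γ' h
    exact Refinement.hom₂_ext h
  · intro x y f g b _
    exact ⟨⟨b⟩, rfl⟩

variable {α β}

/-- The 3-cell equifier of `Γ` and `Γ'` is the pullback of `B^{i₄}` along `(Γ, Γ')`. -/
lemma IsEquifierMap.isCellwisePullback {E : Type u} [Bicategory.{u, u} E] [Strict E]
    {P : StrictPseudofunctor E C} {Γ Γ' : α ⟶ β} (hP : IsEquifierMap P Γ Γ') :
    IsCellwisePullback (curry (ComposableArrows.mk₁ ((precompDiagram P F G).map Γ))) P
      (precomp (Susp.map mergePair)) (curry (Limits.parallelPair Γ Γ')) := by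
  refine isCellwisePullback_curry _ _ _ ?_ ?_ ?_ ?_ ?_ ?_ ?_
  · refine CategoryTheory.Functor.ext ?_ ?_
    · rintro ⟨_⟩ <;> rfl
    · rintro _ _ ⟨_⟩
      · exact eq_conj_id _
      · refine Eq.trans ?_ (eq_conj_id _)
        ext x
        exact hP.app_eq x
      · rename_i x
        cases x <;> exact eq_conj_id _
  · intro z z' h _
    exact hP.obj_injective h
  · intro c E hE
    obtain ⟨a, b, t, rfl⟩ := ComposableArrows.mk₁_surjective E
    obtain rfl : a = α.app c := Functor.congr_obj hE .zero
    obtain rfl : b = β.app c := Functor.congr_obj hE .one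
    obtain rfl : t = Γ.as.app c := eq_of_heq (Functor.hcongr_hom hE .left)
    obtain ⟨z, rfl⟩ := hP.exists_obj c (eq_of_heq (Functor.hcongr_hom hE .right))
    refine ⟨z, rfl, heq_of_eq (ComposableArrows.ext₁ rfl rfl ?_)⟩
    exact eq_conj_id _
  · intro x y f f' h _
    exact (hP.map_bijective x y).1 h
  · intro x y g ν hν h
    obtain ⟨f, rfl⟩ := (hP.map_bijective x y).2 g
    refine ⟨f, rfl, fun w => ?_⟩
    fin_cases w
    · exact (h .zero).symm
    · exact (h .one).symm
  · intro x y f g γ γ' h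
    exact (hP.map₂_bijective f g).1 h
  · intro x y f g b _
    exact (hP.map₂_bijective f g).2 b

end pullbacks

/-! ### Algebras for an endo-2-functor -/

variable {A : Type u} [Bicategory.{u, u} A]

/-- An algebra `S X ⟶ X` for a 2-functor `S : A → A`, without any axioms. -/
structure PreAlgebra (S : StrictPseudofunctor A A) where
  /-- The underlying object. -/
  obj : A
  /-- The action. -/
  act : S.obj obj ⟶ obj

namespace PreAlgebra
variable {S : StrictPseudofunctor A A}

/-- A pseudomorphism of algebras for a 2-functor. -/
structure Hom (X Y : PreAlgebra S) where
  /-- The underlying 1-cell. -/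
  hom : X.obj ⟶ Y.obj
  /-- The invertible 2-cell that compares the two actions. -/
  cell : S.map hom ≫ Y.act ≅ X.act ≫ hom

/-- A 2-cell between pseudomorphisms of algebras for a 2-functor. -/
@[ext]
structure Hom₂ {X Y : PreAlgebra S} (f g : Hom X Y) where
  /-- The underlying 2-cell. -/
  hom : f.hom ⟶ g.hom
  coh : S.map₂ hom ▷ Y.act ≫ g.cell.hom = f.cell.hom ≫ X.act ◁ hom

instance : CategoryStruct (PreAlgebra S) where
  Hom := Hom
  id X :=
    { hom := 𝟙 X.obj
      cell := whiskerRightIso (S.mapId X.obj) X.act ≪≫ λ_ X.act ≪≫ (ρ_ X.act).symm }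
  comp {_ _ Z} f g :=
    { hom := f.hom ≫ g.hom
      cell := whiskerRightIso (S.mapComp f.hom g.hom) Z.act ≪≫ α_ _ _ _ ≪≫
        whiskerLeftIso (S.map f.hom) g.cell ≪≫ (α_ _ _ _).symm ≪≫
        whiskerRightIso f.cell g.hom ≪≫ α_ _ _ _ }

instance homCategory (X Y : PreAlgebra S) : Category (X ⟶ Y) where
  Hom f g := Hom₂ f g
  id f := ⟨𝟙 f.hom, by simp⟩
  comp γ δ := ⟨γ.hom ≫ δ.hom, by simp [δ.coh, reassoc_of% γ.coh]⟩
  id_comp γ := Hom₂.ext (Category.id_comp γ.hom)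
  comp_id γ := Hom₂.ext (Category.comp_id γ.hom)
  assoc γ δ κ := Hom₂.ext (Category.assoc γ.hom δ.hom κ.hom)

@[ext]
lemma hom₂_ext {X Y : PreAlgebra S} {f g : X ⟶ Y} {γ δ : f ⟶ g} (h : γ.hom = δ.hom) : γ = δ :=
  Hom₂.ext h

/-- An invertible 2-cell of `A` compatible with the actions, as an invertible 2-cell of algebras. -/
def isoMk {X Y : PreAlgebra S} {f g : X ⟶ Y} (γ : f.hom ≅ g.hom)
    (h : S.map₂ γ.hom ▷ Y.act ≫ g.cell.hom = f.cell.hom ≫ X.act ◁ γ.hom) : f ≅ g where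
  hom := Hom₂.mk γ.hom h
  inv := Hom₂.mk γ.inv (by
    rw [← cancel_mono (X.act ◁ γ.hom), Category.assoc, ← h]
    simp [← comp_whiskerRight_assoc, ← whiskerLeft_comp])
  hom_inv_id := hom₂_ext γ.hom_inv_id
  inv_hom_id := hom₂_ext γ.inv_hom_id

@[simp] lemma id_hom (X : PreAlgebra S) : (𝟙 X : X ⟶ X).hom = 𝟙 X.obj := rfl
@[simp] lemma comp_hom {X Y Z : PreAlgebra S} (f : X ⟶ Y) (g : Y ⟶ Z) :
    (f ≫ g).hom = f.hom ≫ g.hom := rfl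
lemma id_cell_hom (X : PreAlgebra S) : (𝟙 X : X ⟶ X).cell.hom =
    (S.mapId X.obj).hom ▷ X.act ≫ (λ_ X.act).hom ≫ (ρ_ X.act).inv := rfl
lemma comp_cell_hom {X Y Z : PreAlgebra S} (f : X ⟶ Y) (g : Y ⟶ Z) :
    (f ≫ g).cell.hom = (S.mapComp f.hom g.hom).hom ▷ Z.act ≫
      hpaste f.cell.hom g.cell.hom := rfl

/-- Left whiskering. -/
def whiskerLeft {X Y Z : PreAlgebra S} (f : X ⟶ Y) {g h : Y ⟶ Z} (γ : g ⟶ h) :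
    f ≫ g ⟶ f ≫ h :=
  Hom₂.mk (f.hom ◁ γ.hom) (by
    have e := γ.coh
    rw [comp_cell_hom, comp_cell_hom]
    simp only [hpaste, comp_hom]
    simp
    calc
      _ = (S.mapComp f.hom g.hom).hom ▷ Z.act ⊗≫
          S.map f.hom ◁ (S.map₂ γ.hom ▷ Z.act ≫ h.cell.hom) ⊗≫ f.cell.hom ▷ h.hom ⊗≫ 𝟙 _ := by
        bicategory
      _ = (S.mapComp f.hom g.hom).hom ▷ Z.act ⊗≫ S.map f.hom ◁ g.cell.hom ⊗≫
          ((S.map f.hom ≫ Y.act) ◁ γ.hom ≫ f.cell.hom ▷ h.hom) ⊗≫ 𝟙 _ := by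
        rw [e]; bicategory
      _ = _ := by rw [whisker_exchange]; bicategory)

/-- Right whiskering. -/
def whiskerRight {X Y Z : PreAlgebra S} {f g : X ⟶ Y} (γ : f ⟶ g) (h : Y ⟶ Z) :
    f ≫ h ⟶ g ≫ h :=
  Hom₂.mk (γ.hom ▷ h.hom) (by
    have e := γ.coh
    rw [comp_cell_hom, comp_cell_hom]
    simp only [hpaste, comp_hom]
    simp
    calc
      _ = (S.mapComp f.hom h.hom).hom ▷ Z.act ⊗≫
          (S.map₂ γ.hom ▷ (S.map h.hom ≫ Z.act) ≫ S.map g.hom ◁ h.cell.hom) ⊗≫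
          g.cell.hom ▷ h.hom ⊗≫ 𝟙 _ := by bicategory
      _ = (S.mapComp f.hom h.hom).hom ▷ Z.act ⊗≫ S.map f.hom ◁ h.cell.hom ⊗≫
          (S.map₂ γ.hom ▷ Y.act ≫ g.cell.hom) ▷ h.hom ⊗≫ 𝟙 _ := by
        rw [← whisker_exchange]; bicategory
      _ = _ := by rw [e]; bicategory)

/-- The associator, that of `A`. -/
def associator {W X Y Z : PreAlgebra S} (f : W ⟶ X) (g : X ⟶ Y) (h : Y ⟶ Z) :
    (f ≫ g) ≫ h ≅ f ≫ g ≫ h :=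
  isoMk (α_ f.hom g.hom h.hom) (by
    rw [comp_cell_hom, comp_cell_hom, comp_cell_hom, comp_cell_hom]
    simp only [hpaste, comp_hom]
    simp
    symm
    calc
      _ = (S.mapComp (f.hom ≫ g.hom) h.hom).hom ▷ Z.act ⊗≫
          (S.map (f.hom ≫ g.hom) ◁ h.cell.hom ≫
            (S.mapComp f.hom g.hom).hom ▷ (Y.act ≫ h.hom)) ⊗≫
          S.map f.hom ◁ g.cell.hom ▷ h.hom ⊗≫ f.cell.hom ▷ g.hom ▷ h.hom ⊗≫ 𝟙 _ := by bicategory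
      _ = _ := by rw [whisker_exchange]; bicategory)

/-- The left unitor, that of `A`. -/
def leftUnitor {X Y : PreAlgebra S} (f : X ⟶ Y) : 𝟙 X ≫ f ≅ f :=
  isoMk (λ_ f.hom) (by
    rw [comp_cell_hom, id_cell_hom]
    simp only [hpaste, id_hom]
    simp
    symm
    calc
      _ = (S.mapComp (𝟙 X.obj) f.hom).hom ▷ Y.act ⊗≫
          (S.map (𝟙 X.obj) ◁ f.cell.hom ≫ (S.mapId X.obj).hom ▷ (X.act ≫ f.hom)) ⊗≫ 𝟙 _ := by
        bicategory
      _ = _ := by rw [whisker_exchange]; bicategory)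

/-- The right unitor, that of `A`. -/
def rightUnitor {X Y : PreAlgebra S} (f : X ⟶ Y) : f ≫ 𝟙 Y ≅ f :=
  isoMk (ρ_ f.hom) (by
    rw [comp_cell_hom, id_cell_hom]
    simp only [hpaste, id_hom]
    simp)

/-- The 2-category of algebras for a 2-functor, pseudomorphisms and 2-cells. -/
instance : Bicategory (PreAlgebra S) where
  whiskerLeft := whiskerLeft
  whiskerRight := whiskerRight
  associator := associator
  leftUnitor := leftUnitor
  rightUnitor := rightUnitor
  whiskerLeft_id _ _ := hom₂_ext (whiskerLeft_id _ _)
  whiskerLeft_comp _ _ _ _ _ _ := hom₂_ext (whiskerLeft_comp _ _ _)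
  id_whiskerLeft _ := hom₂_ext (id_whiskerLeft _)
  comp_whiskerLeft _ _ _ _ _ := hom₂_ext (comp_whiskerLeft _ _ _)
  id_whiskerRight _ _ := hom₂_ext (id_whiskerRight _ _)
  comp_whiskerRight _ _ _ := hom₂_ext (comp_whiskerRight _ _ _)
  whiskerRight_id _ := hom₂_ext (whiskerRight_id _)
  whiskerRight_comp _ _ _ := hom₂_ext (whiskerRight_comp _ _ _)
  whisker_assoc _ _ _ _ _ := hom₂_ext (whisker_assoc _ _ _)
  whisker_exchange _ _ := hom₂_ext (whisker_exchange _ _)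
  pentagon _ _ _ _ := hom₂_ext (pentagon _ _ _ _)
  triangle _ _ := hom₂_ext (triangle _ _)

/-- Pseudomorphisms with the same underlying 1-cell are equal as soon as the identity of that 1-cell
is a 2-cell of algebras. -/
lemma hom_eq {X Y : PreAlgebra S} {f g : X ⟶ Y} (h : f.hom = g.hom) (Γ : f ⟶ g)
    (hΓ : Γ.hom = eqToHom h) : f = g := by
  obtain ⟨f, c⟩ := f
  obtain ⟨g, d⟩ := g
  obtain rfl : f = g := h
  obtain rfl : c = d := by
    have e := Γ.coh
    rw [hΓ] at e
    ext
    simpa using e.symm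
  rfl

lemma eqToIso_hom_hom {X Y : PreAlgebra S} {f g : X ⟶ Y} (h : f = g) :
    (eqToIso h).hom.hom = (eqToIso (congrArg Hom.hom h)).hom := by
  subst h; rfl

instance [Strict A] : Strict (PreAlgebra S) where
  id_comp f := hom_eq (Strict.id_comp f.hom) (leftUnitor f).hom
    (congrArg Iso.hom (Strict.leftUnitor_eqToIso f.hom))
  comp_id f := hom_eq (Strict.comp_id f.hom) (rightUnitor f).hom
    (congrArg Iso.hom (Strict.rightUnitor_eqToIso f.hom))
  assoc f g h := hom_eq (Strict.assoc f.hom g.hom h.hom) (associator f g h).hom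
    (congrArg Iso.hom (Strict.associator_eqToIso f.hom g.hom h.hom))
  leftUnitor_eqToIso f := by
    ext
    rw [eqToIso_hom_hom]
    exact (congrArg Iso.hom (Strict.leftUnitor_eqToIso f.hom))
  rightUnitor_eqToIso f := by
    ext
    rw [eqToIso_hom_hom]
    exact (congrArg Iso.hom (Strict.rightUnitor_eqToIso f.hom))
  associator_eqToIso f g h := by
    ext
    rw [eqToIso_hom_hom]
    exact (congrArg Iso.hom (Strict.associator_eqToIso f.hom g.hom h.hom))

variable (S) in
/-- The forgetful 2-functor from algebras for a 2-functor to `A`. -/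
def forget : StrictPseudofunctor (PreAlgebra S) A :=
  StrictPseudofunctor.mk'
    { obj := fun X => X.obj
      map := fun f => f.hom
      map₂ := fun γ => γ.hom
      map_id := fun _ => rfl
      map_comp := fun _ _ => rfl
      map₂_whisker_left := fun _ _ _ _ => eq_conj_id _
      map₂_whisker_right := fun _ _ => eq_conj_id _
      map₂_left_unitor := fun _ => (Category.id_comp _).symm
      map₂_right_unitor := fun _ => (Category.id_comp _).symm
      map₂_associator := fun _ _ _ => eq_conj_id _ }

variable {Z : Type u} [Bicategory.{u, u} Z]

/-- The action, as a pseudonatural transformation between restrictions of `S` and of the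
identity. -/
def actionTrans : ((forget S).comp S).toPseudofunctor ⟶
    ((forget S).comp (StrictPseudofunctor.id A)).toPseudofunctor where
  app X := X.act
  naturality f := f.cell
  naturality_naturality γ := γ.coh
  naturality_id X := by
    change ((S.mapId X.obj).hom ▷ X.act ≫ (λ_ X.act).hom ≫ (ρ_ X.act).inv) ≫
        X.act ◁ (𝟙 (𝟙 X.obj) ≫ 𝟙 (𝟙 X.obj)) =
      (S.map₂ (𝟙 (𝟙 X.obj)) ≫ (S.mapId X.obj).hom) ▷ X.act ≫ (λ_ X.act).hom ≫ (ρ_ X.act).inv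
    simp
  naturality_comp {X Y Z} f g := by
    change ((S.mapComp f.hom g.hom).hom ▷ Z.act ≫ hpaste f.cell.hom g.cell.hom) ≫
        X.act ◁ (𝟙 (f.hom ≫ g.hom) ≫ 𝟙 (f.hom ≫ g.hom)) =
      (S.map₂ (𝟙 (f.hom ≫ g.hom)) ≫ (S.mapComp f.hom g.hom).hom) ▷ Z.act ≫
        hpaste f.cell.hom g.cell.hom
    simp

/-- The constraint 2-cells of a composite with the forgetful 2-functor carry redundant identities;
this moves them out of the axiom of a 2-cell of algebras. -/
lemma whisker_comp_id_of_coh {X Y : A} {a : S.obj X ⟶ X} {b : S.obj Y ⟶ Y} {f g : X ⟶ Y}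
    {m : f ⟶ g} {h : S.obj X ⟶ S.obj Y} {k : S.map g ⟶ h} {c : S.map f ≫ b ⟶ a ≫ f}
    {r : h ≫ b ⟶ a ≫ g} (e : S.map₂ m ▷ b ≫ k ▷ b ≫ r = c ≫ a ◁ m) :
    c ≫ a ◁ (m ≫ 𝟙 g) = (S.map₂ (m ≫ 𝟙 g) ≫ k) ▷ b ≫ r := by
  rw [Category.comp_id, ← e, comp_whiskerRight_assoc]

/-- The action, as a pseudonatural transformation, restricted along a 2-functor `q`. -/
def action (q : StrictPseudofunctor Z (PreAlgebra S)) :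
    ((q.comp (forget S)).comp S).toPseudofunctor ⟶ (q.comp (forget S)).toPseudofunctor where
  app x := (q.obj x).act
  naturality f := (q.map f).cell
  naturality_naturality γ := (q.map₂ γ).coh
  naturality_id x := by
    have e := (q.mapId x).hom.coh
    change (q.map (𝟙 x)).cell.hom ≫ (q.obj x).act ◁ ((q.mapId x).hom.hom ≫ 𝟙 (𝟙 (q.obj x).obj)) =
      (S.map₂ ((q.mapId x).hom.hom ≫ 𝟙 (𝟙 (q.obj x).obj)) ≫ (S.mapId (q.obj x).obj).hom) ▷
        (q.obj x).act ≫ (λ_ (q.obj x).act).hom ≫ (ρ_ (q.obj x).act).inv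
    exact whisker_comp_id_of_coh e
  naturality_comp {x y z} f g := by
    have e := (q.mapComp f g).hom.coh
    change (q.map (f ≫ g)).cell.hom ≫ (q.obj x).act ◁
        ((q.mapComp f g).hom.hom ≫ 𝟙 ((q.map f).hom ≫ (q.map g).hom)) =
      (S.map₂ ((q.mapComp f g).hom.hom ≫ 𝟙 ((q.map f).hom ≫ (q.map g).hom)) ≫
        (S.mapComp (q.map f).hom (q.map g).hom).hom) ▷ (q.obj z).act ≫
          hpaste (q.map f).cell.hom (q.map g).cell.hom
    exact whisker_comp_id_of_coh e

lemma ext_of_heq {X Y : PreAlgebra S} (h : X.obj = Y.obj) (h' : HEq X.act Y.act) : X = Y := by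
  obtain ⟨X, a⟩ := X
  obtain ⟨Y, b⟩ := Y
  obtain rfl : X = Y := h
  cases h'
  rfl

lemma hom_ext {X Y : PreAlgebra S} {f g : X ⟶ Y} (h : f.hom = g.hom) (h' : HEq f.cell g.cell) :
    f = g := by
  obtain ⟨f, a⟩ := f
  obtain ⟨g, b⟩ := g
  obtain rfl : f = g := h
  cases h'
  rfl

/-- The 2-category of algebras for a 2-functor `S` is the 2-cell inserter of `S` and the
identity. -/
lemma isCellwisePullback_forget [Strict A] (S : StrictPseudofunctor A A) :
    IsCellwisePullback (curry (Discrete.functor fun _ : PUnit.{1} => actionTrans)) (forget S)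
      (precomp (Susp.map (Functor.empty (Discrete PUnit.{1}))))
      (curry (Functor.empty (S.toPseudofunctor ⟶ (StrictPseudofunctor.id A).toPseudofunctor))) := by
  refine isCellwisePullback_curry _ _ _ (Functor.empty_ext' _ _) ?_ ?_ ?_ ?_ ?_ ?_
  · intro X Y h h'
    refine ext_of_heq h ?_
    have aux {a b a' b' : A} (ha : a = a') (hb : b = b') {E : Discrete PUnit.{1} ⥤ (a ⟶ b)}
        {E' : Discrete PUnit.{1} ⥤ (a' ⟶ b')} (hE : HEq E E') : HEq (E.obj ⟨⟨⟩⟩) (E'.obj ⟨⟨⟩⟩) := by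
      subst ha hb; cases hE; rfl
    exact aux (congrArg S.obj h) h h'
  · intro c E _
    exact ⟨⟨c, E.obj ⟨⟨⟩⟩⟩, rfl, heq_of_eq (Discrete.functor_ext fun _ => rfl)⟩
  · intro X Y f f' h h'
    exact hom_ext h (h' ⟨⟨⟩⟩)
  · intro X Y g ν _ _
    exact ⟨⟨g, ν ⟨⟨⟩⟩⟩, rfl, fun _ => HEq.rfl⟩
  · intro X Y f g γ γ' h
    exact hom₂_ext h
  · intro X Y f g b h
    exact ⟨⟨b, h ⟨⟨⟩⟩⟩, rfl⟩

end PreAlgebra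

/-! ### Whiskering with a 2-functor at the target -/

section post

variable {A : Type u} [Bicategory.{u, u} A] (S : StrictPseudofunctor A A)

lemma mapSq_whisker {a a' b b' : A} {f e : a ⟶ a'} {g : b ⟶ b'} {k : a ⟶ b} {k' : a' ⟶ b'}
    (x : e ⟶ f) (s : f ≫ k' ⟶ k ≫ g) :
    mapSq S (x ▷ k' ≫ s) = S.map₂ x ▷ S.map k' ≫ mapSq S s := by
  unfold mapSq
  simp

lemma mapSq_slide {a a' b b' : A} {f : a ⟶ a'} {g d : b ⟶ b'} {k : a ⟶ b} {k' : a' ⟶ b'}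
    (s : f ≫ k' ⟶ k ≫ g) (y : g ⟶ d) :
    mapSq S (s ≫ k ◁ y) = mapSq S s ≫ S.map k ◁ S.map₂ y := by
  unfold mapSq
  simp

lemma mapSq_whiskerLeft {a a' b b' : A} {f : a ⟶ a'} {g : b ⟶ b'} {k : a ⟶ b} {k' l' : a' ⟶ b'}
    (x : l' ⟶ k') (s : f ≫ k' ⟶ k ≫ g) :
    mapSq S (f ◁ x ≫ s) = S.map f ◁ S.map₂ x ≫ mapSq S s := by
  unfold mapSq
  simp

lemma mapSq_whiskerRight {a a' b b' : A} {f : a ⟶ a'} {g : b ⟶ b'} {k l : a ⟶ b} {k' : a' ⟶ b'}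
    (s : f ≫ k' ⟶ k ≫ g) (y : k ⟶ l) :
    mapSq S (s ≫ y ▷ g) = mapSq S s ≫ S.map₂ y ▷ S.map g := by
  unfold mapSq
  simp

/-- A 2-functor preserves vertical pasting of squares. -/
lemma mapSq_vpaste {a a' b b' c c' : A} {f : a ⟶ a'} {g : b ⟶ b'} {h : c ⟶ c'} {k : a ⟶ b}
    {k' : a' ⟶ b'} {l : b ⟶ c} {l' : b' ⟶ c'} (s : f ≫ k' ⟶ k ≫ g) (t : g ≫ l' ⟶ l ≫ h) :
    S.map f ◁ (S.mapComp k' l').hom ≫ vpaste (mapSq S s) (mapSq S t) =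
      mapSq S (vpaste s t) ≫ (S.mapComp k l).hom ▷ S.map h := by
  have h₁ : (S.mapComp f (k' ≫ l')).inv ≫ S.map₂ (α_ f k' l').inv ≫ (S.mapComp (f ≫ k') l').hom =
      S.map f ◁ (S.mapComp k' l').hom ≫ (α_ (S.map f) (S.map k') (S.map l')).inv ≫
        (S.mapComp f k').inv ▷ S.map l' := by
    rw [Iso.inv_comp_eq, Pseudofunctor.mapComp_assoc_right_hom_assoc]
    simp
  have h₂ : (S.mapComp k (l ≫ h)).inv ≫ S.map₂ (α_ k l h).inv ≫ (S.mapComp (k ≫ l) h).hom ≫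
      (S.mapComp k l).hom ▷ S.map h =
        S.map k ◁ (S.mapComp l h).hom ≫ (α_ (S.map k) (S.map l) (S.map h)).inv := by
    rw [Iso.inv_comp_eq, Pseudofunctor.mapComp_assoc_right_hom_assoc]
    simp
  unfold mapSq vpaste
  simp [reassoc_of% h₁, h₂]

variable {C : Type u} [Bicategory.{u, u} C] {F G H : StrictPseudofunctor C A}

/-- Whiskering of a pseudonatural transformation with a 2-functor `S` at its target. -/
def postTrans (η : F.toPseudofunctor ⟶ G.toPseudofunctor) :
    (F.comp S).toPseudofunctor ⟶ (G.comp S).toPseudofunctor where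
  app x := S.map (η.app x)
  naturality f := (S.mapComp _ _).symm ≪≫ S.map₂Iso (η.naturality f) ≪≫ S.mapComp _ _
  naturality_naturality {x y f g} γ := by
    change S.map₂ (F.map₂ γ) ▷ S.map (η.app y) ≫ mapSq S (η.naturality g).hom =
      mapSq S (η.naturality f).hom ≫ S.map (η.app x) ◁ S.map₂ (G.map₂ γ)
    rw [← mapSq_whisker, ← mapSq_slide, η.naturality_naturality]
  naturality_id x := by
    change mapSq S (η.naturality (𝟙 x)).hom ≫
        S.map (η.app x) ◁ (S.map₂ (G.mapId x).hom ≫ (S.mapId _).hom) =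
      (S.map₂ (F.mapId x).hom ≫ (S.mapId _).hom) ▷ _ ≫ vidSq (S.map (η.app x))
    have e : (η.naturality (𝟙 x)).hom ≫ η.app x ◁ (G.mapId x).hom =
      (F.mapId x).hom ▷ η.app x ≫ vidSq (η.app x) := η.naturality_id x
    rw [whiskerLeft_comp, ← Category.assoc, ← mapSq_slide, e, mapSq_vidSq]
  naturality_comp {x y z} f g := by
    change mapSq S (η.naturality (f ≫ g)).hom ≫
        S.map (η.app x) ◁ (S.map₂ (G.mapComp f g).hom ≫ (S.mapComp _ _).hom) =
      (S.map₂ (F.mapComp f g).hom ≫ (S.mapComp _ _).hom) ▷ _ ≫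
        hpaste (mapSq S (η.naturality f).hom) (mapSq S (η.naturality g).hom)
    have e : (η.naturality (f ≫ g)).hom ≫ η.app x ◁ (G.mapComp f g).hom =
      (F.mapComp f g).hom ▷ η.app z ≫ hpaste (η.naturality f).hom (η.naturality g).hom :=
        η.naturality_comp f g
    rw [whiskerLeft_comp, ← Category.assoc, ← mapSq_slide, e, mapSq_hpaste]

/-- Whiskering of a modification with a 2-functor `S` at its target. -/
def postMod {η θ : F.toPseudofunctor ⟶ G.toPseudofunctor} (Γ : η ⟶ θ) :
    postTrans S η ⟶ postTrans S θ where
  as :=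
    { app := fun x => S.map₂ (Γ.as.app x)
      naturality := fun {x y} f => by
        change S.map (F.map f) ◁ S.map₂ (Γ.as.app y) ≫ mapSq S (θ.naturality f).hom =
          mapSq S (η.naturality f).hom ≫ S.map₂ (Γ.as.app x) ▷ S.map (G.map f)
        rw [← mapSq_whiskerLeft, ← mapSq_whiskerRight, Γ.as.naturality] }

/-- Whiskering with a 2-functor at the target preserves composites up to isomorphism. -/
def postComp (η : F.toPseudofunctor ⟶ G.toPseudofunctor)
    (θ : G.toPseudofunctor ⟶ H.toPseudofunctor) :
    postTrans S (η ≫ θ) ≅ postTrans S η ≫ postTrans S θ :=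
  Pseudofunctor.StrongTrans.isoMk (fun x => S.mapComp (η.app x) (θ.app x)) (fun f =>
    mapSq_vpaste S (η.naturality f).hom (θ.naturality f).hom)

/-- Whiskering with a 2-functor at the target preserves identities up to isomorphism. -/
def postId : postTrans S (𝟙 F.toPseudofunctor) ≅ 𝟙 (F.comp S).toPseudofunctor :=
  Pseudofunctor.StrongTrans.isoMk (fun x => S.mapId (F.obj x)) (fun {x y} f => by
    change S.map (F.map f) ◁ (S.mapId (F.obj y)).hom ≫ idSq (S.map (F.map f)) =
      mapSq S (idSq (F.map f)) ≫ (S.mapId (F.obj x)).hom ▷ S.map (F.map f)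
    have h : S.map₂ (λ_ (F.map f)).inv ≫ (S.mapComp (𝟙 (F.obj x)) (F.map f)).hom ≫
        (S.mapId (F.obj x)).hom ▷ S.map (F.map f) = (λ_ (S.map (F.map f))).inv := by
      have e : (S.mapComp (𝟙 (F.obj x)) (F.map f)).hom ≫
          (S.mapId (F.obj x)).hom ▷ S.map (F.map f) =
            S.map₂ (λ_ (F.map f)).hom ≫ (λ_ (S.map (F.map f))).inv := by
        rw [S.map₂_left_unitor]
        simp
      rw [e, ← S.map₂_comp_assoc]
      simp
    unfold mapSq idSq
    simp [h])

end post

/-! ### The structure of a pseudomonad, restricted along a 2-functor -/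

section restrict

variable {A : Type u} [Bicategory.{u, u} A] {C : Type u} [Bicategory.{u, u} C]

namespace PseudomonadData

variable (T : PseudomonadData A) (F : StrictPseudofunctor C A)

/-- The unit of a pseudomonad, restricted along a 2-functor. -/
def etaAt : F.toPseudofunctor ⟶ (F.comp T.S).toPseudofunctor where
  app x := T.η (F.obj x)
  naturality f := T.unitTrans.naturality (F.map f)
  naturality_naturality γ := T.unitTrans.naturality_naturality (F.map₂ γ)
  naturality_id x := by
    change T.ηSq (F.map (𝟙 x)) ≫ T.η (F.obj x) ◁ (T.S.map₂ (F.mapId x).hom ≫ (T.S.mapId _).hom) =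
      (F.mapId x).hom ▷ T.η (F.obj x) ≫ vidSq (T.η (F.obj x))
    have e : (F.mapId x).hom ▷ T.η (F.obj x) ≫ T.ηSq (𝟙 (F.obj x)) =
      T.ηSq (F.map (𝟙 x)) ≫ T.η (F.obj x) ◁ T.S.map₂ (F.mapId x).hom :=
        T.unitTrans.naturality_naturality (F.mapId x).hom
    rw [whiskerLeft_comp, ← reassoc_of% e, T.ηSq_id]
  naturality_comp {x y z} f g := by
    change T.ηSq (F.map (f ≫ g)) ≫
        T.η (F.obj x) ◁ (T.S.map₂ (F.mapComp f g).hom ≫ (T.S.mapComp _ _).hom) =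
      (F.mapComp f g).hom ▷ T.η (F.obj z) ≫ hpaste (T.ηSq (F.map f)) (T.ηSq (F.map g))
    have e : (F.mapComp f g).hom ▷ T.η (F.obj z) ≫ T.ηSq (F.map f ≫ F.map g) =
      T.ηSq (F.map (f ≫ g)) ≫ T.η (F.obj x) ◁ T.S.map₂ (F.mapComp f g).hom :=
        T.unitTrans.naturality_naturality (F.mapComp f g).hom
    rw [whiskerLeft_comp, ← reassoc_of% e, T.ηSq_comp]

lemma μSq_naturality {x y : A} {f g : x ⟶ y} (γ : f ⟶ g) :
    T.S.map₂ (T.S.map₂ γ) ▷ T.μ y ≫ T.μSq g = T.μSq f ≫ T.μ x ◁ T.S.map₂ γ :=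
  T.multTrans.naturality_naturality γ

/-- The multiplication at a composite, solved for the pasting of the two squares. -/
lemma hpaste_μSq {x y z : A} (f : x ⟶ y) (g : y ⟶ z) :
    hpaste (T.μSq f) (T.μSq g) =
      ((T.S.mapComp (T.S.map f) (T.S.map g)).inv ≫ T.S.map₂ (T.S.mapComp f g).inv) ▷ T.μ z ≫
        T.μSq (f ≫ g) ≫ T.μ x ◁ (T.S.mapComp f g).hom := by
  rw [T.μSq_comp, ← comp_whiskerRight_assoc]
  simp [← T.S.map₂_comp_assoc]

/-- The multiplication of a pseudomonad, restricted along a 2-functor. -/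
def muAt : ((F.comp T.S).comp T.S).toPseudofunctor ⟶ (F.comp T.S).toPseudofunctor where
  app x := T.μ (F.obj x)
  naturality f := T.multTrans.naturality (F.map f)
  naturality_naturality γ := T.multTrans.naturality_naturality (F.map₂ γ)
  naturality_id x := by
    change T.μSq (F.map (𝟙 x)) ≫ T.μ (F.obj x) ◁ (T.S.map₂ (F.mapId x).hom ≫ (T.S.mapId _).hom) =
      (T.S.map₂ (T.S.map₂ (F.mapId x).hom ≫ (T.S.mapId _).hom) ≫ (T.S.mapId _).hom) ▷
        T.μ (F.obj x) ≫ vidSq (T.μ (F.obj x))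
    rw [whiskerLeft_comp, ← Category.assoc, ← T.μSq_naturality, Category.assoc, T.μSq_id]
    simp
  naturality_comp {x y z} f g := by
    change T.μSq (F.map (f ≫ g)) ≫
        T.μ (F.obj x) ◁ (T.S.map₂ (F.mapComp f g).hom ≫ (T.S.mapComp _ _).hom) =
      (T.S.map₂ (T.S.map₂ (F.mapComp f g).hom ≫ (T.S.mapComp _ _).hom) ≫
        (T.S.mapComp _ _).hom) ▷ T.μ (F.obj z) ≫ hpaste (T.μSq (F.map f)) (T.μSq (F.map g))
    rw [whiskerLeft_comp, ← Category.assoc, ← T.μSq_naturality, Category.assoc, T.μSq_comp]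
    simp

variable {F} {G : StrictPseudofunctor C A}

/-- The pseudonaturality 2-cells of the multiplication at the components of a pseudonatural
transformation, as a modification. -/
def muMod (a : F.toPseudofunctor ⟶ G.toPseudofunctor) :
    postTrans T.S (postTrans T.S a) ≫ T.muAt G ⟶ T.muAt F ≫ postTrans T.S a where
  as :=
    { app := fun x => T.μSq (a.app x)
      naturality := fun {x y} f => by
        change T.S.map (T.S.map (F.map f)) ◁ T.μSq (a.app y) ≫
            vpaste (T.μSq (F.map f)) (mapSq T.S (a.naturality f).hom) =
          vpaste (mapSq T.S (mapSq T.S (a.naturality f).hom)) (T.μSq (G.map f)) ≫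
            T.μSq (a.app x) ▷ T.S.map (G.map f)
        have e₁ := T.hpaste_μSq (F.map f) (a.app y)
        have e₂ := T.hpaste_μSq (a.app x) (G.map f)
        have e := T.μSq_naturality (a.naturality f).hom
        -- The squares of `μ` paste to its squares at the composites `F f ≫ a_y` and `a_x ≫ G f`,
        -- which are related by the naturality of `μ` at the 2-cell `a_f` between them.
        calc
          _ = (α_ _ _ _).inv ≫ hpaste (T.μSq (F.map f)) (T.μSq (a.app y)) ≫
              T.μ (F.obj x) ◁ mapSq T.S (a.naturality f).hom ≫ (α_ _ _ _).inv := by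
            unfold hpaste vpaste
            simp
          _ = (α_ _ _ _).inv ≫ mapSq T.S (mapSq T.S (a.naturality f).hom) ▷ T.μ (G.obj y) ≫
              hpaste (T.μSq (a.app x)) (T.μSq (G.map f)) ≫ (α_ _ _ _).inv := by
            have e' : mapSq T.S (mapSq T.S (a.naturality f).hom) ▷ T.μ (G.obj y) ≫
                ((T.S.mapComp (T.S.map (a.app x)) (T.S.map (G.map f))).inv ≫
                  T.S.map₂ (T.S.mapComp (a.app x) (G.map f)).inv) ▷ T.μ (G.obj y) =
                ((T.S.mapComp (T.S.map (F.map f)) (T.S.map (a.app y))).inv ≫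
                  T.S.map₂ (T.S.mapComp (F.map f) (a.app y)).inv) ▷ T.μ (G.obj y) ≫
                T.S.map₂ (T.S.map₂ (a.naturality f).hom) ▷ T.μ (G.obj y) := by
              rw [← comp_whiskerRight, ← comp_whiskerRight]
              congr 1
              unfold mapSq
              simp only [Category.assoc, Iso.hom_inv_id_assoc, ← T.S.map₂_comp, Iso.hom_inv_id,
                Category.comp_id]
            rw [e₁, e₂]
            simp only [Category.assoc]
            rw [reassoc_of% e', reassoc_of% e]
            unfold mapSq
            simp
          _ = _ := by
            unfold hpaste vpaste
            simp }

end PseudomonadData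

namespace Pseudomonad

variable (T : Pseudomonad A) (F : StrictPseudofunctor C A)

/-- The modification `ρ` of a pseudomonad, restricted along a 2-functor. -/
def rhoMod : postTrans T.S (T.etaAt F) ≫ T.muAt F ⟶ 𝟙 (F.comp T.S).toPseudofunctor where
  as :=
    { app := fun x => (T.rho (F.obj x)).hom
      naturality := fun f => T.rho_modification (F.map f) }

/-- The modification `α` of a pseudomonad, restricted along a 2-functor. -/
def assocMod : postTrans T.S (T.muAt F) ≫ T.muAt F ⟶ T.muAt (F.comp T.S) ≫ T.muAt F where
  as :=
    { app := fun x => (T.assoc (F.obj x)).hom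
      naturality := fun f => T.assoc_modification (F.map f) }

variable {F} {a : (F.comp T.S).toPseudofunctor ⟶ F.toPseudofunctor}

/-- One of the two sides of the associativity coherence for an action `a` with multiplication `m`,
as a modification. -/
def assocLeft (m : postTrans T.S a ≫ a ⟶ T.muAt F ≫ a) :
    (postTrans T.S (postTrans T.S a) ≫ postTrans T.S a) ≫ a ⟶
      (T.muAt (F.comp T.S) ≫ T.muAt F) ≫ a :=
  ((postComp T.S _ _).inv ≫ postMod T.S m ≫ (postComp T.S _ _).hom) ▷ a ≫
    (α_ (postTrans T.S (T.muAt F)) (postTrans T.S a) a).hom ≫ postTrans T.S (T.muAt F) ◁ m ≫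
      (α_ (postTrans T.S (T.muAt F)) (T.muAt F) a).inv ≫ T.assocMod F ▷ a

/-- The other side of the associativity coherence for an action `a` with multiplication `m`, as a
modification. -/
def assocRight (m : postTrans T.S a ≫ a ⟶ T.muAt F ≫ a) :
    (postTrans T.S (postTrans T.S a) ≫ postTrans T.S a) ≫ a ⟶
      (T.muAt (F.comp T.S) ≫ T.muAt F) ≫ a :=
  (α_ (postTrans T.S (postTrans T.S a)) (postTrans T.S a) a).hom ≫
    postTrans T.S (postTrans T.S a) ◁ m ≫ (α_ (postTrans T.S (postTrans T.S a)) (T.muAt F) a).inv ≫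
      T.muMod a ▷ a ≫ (α_ (T.muAt (F.comp T.S)) (postTrans T.S a) a).hom ≫
        T.muAt (F.comp T.S) ◁ m ≫ (α_ (T.muAt (F.comp T.S)) (T.muAt F) a).inv

/-- The composite in the unit coherence for an action `a` with unit `u` and multiplication `m`, as
a modification. -/
def unitLeft (u : 𝟙 F.toPseudofunctor ⟶ T.etaAt F ≫ a)
    (m : postTrans T.S a ≫ a ⟶ T.muAt F ≫ a) : a ⟶ a :=
  (λ_ a).inv ≫ ((postId T.S).inv ≫ postMod T.S u ≫ (postComp T.S _ _).hom) ▷ a ≫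
    (α_ (postTrans T.S (T.etaAt F)) (postTrans T.S a) a).hom ≫ postTrans T.S (T.etaAt F) ◁ m ≫
      (α_ (postTrans T.S (T.etaAt F)) (T.muAt F) a).inv ≫ T.rhoMod F ▷ a ≫ (λ_ a).hom

end Pseudomonad

end restrict

/-! ### The tower of limits below the 2-category of pseudoalgebras -/

namespace Pseudomonad

variable {A : Type u} [Bicategory.{u, u} A] (T : Pseudomonad A)

/-- The iso-3-cell inserter that adjoins an invertible unit `𝟙 ⟶ η ≫ a` to an action `a`. -/
def unital : Refinement (PreAlgebra T.S) :=
  isoInserter (𝟙 ((StrictPseudofunctor.id _).comp (PreAlgebra.forget T.S)).toPseudofunctor)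
    (T.etaAt ((StrictPseudofunctor.id _).comp (PreAlgebra.forget T.S)) ≫
      PreAlgebra.action (StrictPseudofunctor.id _))

/-- The iso-3-cell inserter that adjoins an invertible multiplication `S a ≫ a ⟶ μ ≫ a` to an action
`a` with a unit. -/
def multiplicative : Refinement T.unital.Total :=
  isoInserter (postTrans T.S (PreAlgebra.action T.unital.proj) ≫ PreAlgebra.action T.unital.proj)
    (T.muAt (T.unital.proj.comp (PreAlgebra.forget T.S)) ≫ PreAlgebra.action T.unital.proj)

section

variable {Z : Type u} [Bicategory.{u, u} Z] (r : StrictPseudofunctor Z T.multiplicative.Total)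

/-- The underlying action of an action with unit and multiplication, along a 2-functor. -/
abbrev toPreAlgebra : StrictPseudofunctor Z (PreAlgebra T.S) :=
  (r.comp T.multiplicative.proj).comp T.unital.proj

/-- The universal unit, restricted along a 2-functor `r`. -/
def unitMod : 𝟙 ((T.toPreAlgebra r).comp (PreAlgebra.forget T.S)).toPseudofunctor ⟶
    T.etaAt ((T.toPreAlgebra r).comp (PreAlgebra.forget T.S)) ≫
      PreAlgebra.action (T.toPreAlgebra r) where
  as :=
    { app := fun x => ((r.comp T.multiplicative.proj).obj x).as.2.hom
      naturality := fun f => ((r.comp T.multiplicative.proj).map f).mem }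

/-- The universal multiplication, restricted along a 2-functor `r`. -/
def multMod : postTrans T.S (PreAlgebra.action (T.toPreAlgebra r)) ≫
      PreAlgebra.action (T.toPreAlgebra r) ⟶
    T.muAt ((T.toPreAlgebra r).comp (PreAlgebra.forget T.S)) ≫
      PreAlgebra.action (T.toPreAlgebra r) where
  as :=
    { app := fun x => (r.obj x).as.2.hom
      naturality := fun f => (r.map f).mem }

end

/-- The 3-cell equifier that imposes the unit coherence. -/
def unitCoherent : Refinement T.multiplicative.Total :=
  equifier (T.unitLeft (T.unitMod (StrictPseudofunctor.id _))
    (T.multMod (StrictPseudofunctor.id _))) (𝟙 _)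

/-- The 2-functor from pseudoalgebras that forgets the associativity coherence. -/
def toUnitCoherent : StrictPseudofunctor (Pseudoalgebra T) T.unitCoherent.Total :=
  StrictPseudofunctor.mk'
    { obj := fun X => ⟨⟨⟨⟨⟨⟨⟨X.obj, X.act⟩, X.unit⟩⟩, X.mult⟩⟩, X.unitCoh⟩⟩
      map := fun f => ⟨⟨⟨⟨f.hom, f.cell⟩, f.unit_coh⟩, f.mult_coh⟩, trivial⟩
      map₂ := fun γ => ⟨⟨⟨⟨γ.hom, γ.coh⟩⟩⟩⟩
      map_id := fun _ => rfl
      map_comp := fun _ _ => rfl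
      map₂_whisker_left := fun f _ _ γ => Refinement.hom₂_ext (Refinement.hom₂_ext
        (Refinement.hom₂_ext (PreAlgebra.hom₂_ext (eq_conj_id (f.hom ◁ γ.hom)))))
      map₂_whisker_right := fun γ h => Refinement.hom₂_ext (Refinement.hom₂_ext
        (Refinement.hom₂_ext (PreAlgebra.hom₂_ext (eq_conj_id (γ.hom ▷ h.hom)))))
      map₂_left_unitor := fun f => Refinement.hom₂_ext (Refinement.hom₂_ext
        (Refinement.hom₂_ext (PreAlgebra.hom₂_ext ((Category.id_comp (λ_ f.hom).hom).symm))))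
      map₂_right_unitor := fun f => Refinement.hom₂_ext (Refinement.hom₂_ext
        (Refinement.hom₂_ext (PreAlgebra.hom₂_ext ((Category.id_comp (ρ_ f.hom).hom).symm))))
      map₂_associator := fun f g h => Refinement.hom₂_ext (Refinement.hom₂_ext
        (Refinement.hom₂_ext (PreAlgebra.hom₂_ext (eq_conj_id (α_ f.hom g.hom h.hom).hom)))) }

/-- Pseudoalgebras are the full sub-2-category on the objects that satisfy the associativity
coherence. -/
lemma isEquifierMap_toUnitCoherent :
    IsEquifierMap T.toUnitCoherent (T.assocLeft (T.multMod T.unitCoherent.proj))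
      (T.assocRight (T.multMod T.unitCoherent.proj)) where
  obj_injective := by
    rintro ⟨x, a, u, m, _, _⟩ ⟨x', a', u', m', _, _⟩ h
    cases h
    rfl
  app_eq X := X.assocCoh
  exists_obj := by
    rintro ⟨⟨⟨⟨⟨⟨⟨x, a⟩, u⟩⟩, m⟩⟩, h⟩⟩ h'
    exact ⟨⟨x, a, u, m, h', h⟩, rfl⟩
  map_bijective X Y := by
    refine ⟨fun f f' h => ?_, ?_⟩
    · obtain ⟨f, c, _, _⟩ := f
      obtain ⟨f', c', _, _⟩ := f'
      cases h
      rfl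
    · rintro ⟨⟨⟨⟨f, c⟩, hu⟩, hm⟩, _⟩
      exact ⟨⟨f, c, hm, hu⟩, rfl⟩
  map₂_bijective {X Y} f g := by
    refine ⟨fun γ γ' h => Pseudoalgebra.hom₂_ext ?_, ?_⟩
    · exact congrArg (fun δ => δ.hom.hom.hom.hom) h
    · rintro ⟨⟨⟨⟨γ, h⟩⟩⟩⟩
      exact ⟨⟨γ, h⟩, rfl⟩

/-- The forgetful 2-functor of pseudoalgebras is the composite of the projections of the tower. -/
lemma toUnitCoherent_comp :
    T.toUnitCoherent.comp (T.unitCoherent.proj.comp (T.multiplicative.proj.comp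
      (T.unital.proj.comp (PreAlgebra.forget T.S)))) = Pseudoalgebra.forget T :=
  TwoCat.functor_ext rfl

end Pseudomonad

/-! ### Iso-3-cell inserters as composites of inserters and equifiers -/

section isoInserter

variable {C B : Type u} [Bicategory.{u, u} C] [Bicategory.{u, u} B] [Strict B]
  {F G : StrictPseudofunctor C B} (α β : F.toPseudofunctor ⟶ G.toPseudofunctor)

/-- The 3-cell inserter that adjoins a further 2-cell `β_c ⟶ α_c` to a 2-cell `α_c ⟶ β_c`. -/
abbrev backInserter : Refinement (inserter α β).Total :=
  inserter (precompTrans (inserter α β).proj β) (precompTrans (inserter α β).proj α)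

/-- The composite of the universal 2-cells `α_c ⟶ β_c ⟶ α_c`. -/
abbrev backInserterLoop :=
  (precompDiagram (backInserter α β).proj _ _).map (inserterMod α β) ≫
    inserterMod (precompTrans (inserter α β).proj β) (precompTrans (inserter α β).proj α)

/-- The composite of the universal 2-cells `β_c ⟶ α_c ⟶ β_c`. -/
abbrev backInserterLoop' :=
  inserterMod (precompTrans (inserter α β).proj β) (precompTrans (inserter α β).proj α) ≫
    (precompDiagram (backInserter α β).proj _ _).map (inserterMod α β)

/-- The 3-cell equifier that makes the composite `α_c ⟶ β_c ⟶ α_c` an identity. -/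
abbrev retractInserter : Refinement (backInserter α β).Total :=
  equifier (backInserterLoop α β) (𝟙 _)

/-- The comparison from the iso-3-cell inserter, sending an isomorphism to the pair of its two
directions. -/
def isoInserterToRetract : StrictPseudofunctor (isoInserter α β).Total
    (retractInserter α β).Total :=
  StrictPseudofunctor.mk'
    { obj := fun x => ⟨⟨⟨⟨⟨⟨x.as.1, x.as.2.hom⟩⟩, x.as.2.inv⟩⟩, x.as.2.hom_inv_id⟩⟩
      map := fun f => ⟨⟨⟨f.hom, f.mem⟩, (isoInserterMod α β).inv.as.naturality f⟩, trivial⟩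
      map₂ := fun γ => ⟨⟨⟨γ.hom⟩⟩⟩
      map_id := fun _ => rfl
      map_comp := fun _ _ => rfl
      map₂_whisker_left := fun f _ _ γ => Refinement.hom₂_ext (Refinement.hom₂_ext
        (Refinement.hom₂_ext (eq_conj_id (f.hom ◁ γ.hom))))
      map₂_whisker_right := fun γ h => Refinement.hom₂_ext (Refinement.hom₂_ext
        (Refinement.hom₂_ext (eq_conj_id (γ.hom ▷ h.hom))))
      map₂_left_unitor := fun f => Refinement.hom₂_ext (Refinement.hom₂_ext
        (Refinement.hom₂_ext (Category.id_comp (λ_ f.hom).hom).symm))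
      map₂_right_unitor := fun f => Refinement.hom₂_ext (Refinement.hom₂_ext
        (Refinement.hom₂_ext (Category.id_comp (ρ_ f.hom).hom).symm))
      map₂_associator := fun f g h => Refinement.hom₂_ext (Refinement.hom₂_ext
        (Refinement.hom₂_ext (eq_conj_id (α_ f.hom g.hom h.hom).hom))) }

/-- An isomorphism `α_c ≅ β_c` is a pair of 2-cells in opposite directions such that both composites
are identities. The second of these equations is imposed here. -/
lemma isEquifierMap_isoInserterToRetract : IsEquifierMap (isoInserterToRetract α β)
    ((precompDiagram (retractInserter α β).proj _ _).map (backInserterLoop' α β)) (𝟙 _) where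
  obj_injective := by
    rintro ⟨x, s⟩ ⟨x', s'⟩ h
    have h₁ := congrArg (fun z => z.as.1.as.1.as) h
    obtain ⟨rfl, h₂⟩ := Sigma.mk.inj h₁
    obtain rfl : s = s' := Iso.ext (eq_of_heq h₂)
    rfl
  app_eq x := x.as.2.inv_hom_id
  exists_obj := by
    rintro ⟨⟨⟨⟨⟨⟨x, s⟩⟩, t⟩⟩, h⟩⟩ h'
    exact ⟨⟨⟨x, ⟨s, t, h, h'⟩⟩⟩, rfl⟩
  map_bijective x y := by
    refine ⟨fun f f' h => Refinement.hom_ext ?_, ?_⟩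
    · exact congrArg (fun k => k.hom.hom.hom) h
    · rintro ⟨⟨⟨f, h⟩, _⟩, _⟩
      exact ⟨⟨f, h⟩, rfl⟩
  map₂_bijective f g := by
    refine ⟨fun γ γ' h => Refinement.hom₂_ext ?_, ?_⟩
    · exact congrArg (fun δ => δ.hom.hom.hom) h
    · rintro ⟨⟨⟨γ⟩⟩⟩
      exact ⟨⟨γ⟩, rfl⟩

/-- The iso-3-cell inserter is an iterated inserter and equifier. -/
lemma isoInserterToRetract_comp : (isoInserterToRetract α β).comp ((retractInserter α β).proj.comp
    ((backInserter α β).proj.comp (inserter α β).proj)) = (isoInserter α β).proj :=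
  TwoCat.functor_ext rfl

end isoInserter

namespace TwoCat

/-- A pullback of a power of a generating cofibration is a finite composite of such. -/
lemma finiteCompositesOfPullbacks_of_isPullback {I C B : TwoCat.{u}} {P Q : TwoCat.{0}} {i : P ⟶ Q}
    (hi : generatingCofibrations i) {Φ : I ⟶ B.power Q} {p : I ⟶ C} {V : C ⟶ B.power P}
    (h : IsPullback Φ p (B.powerMap i) V) : finiteCompositesOfPullbacks p :=
  .of _ (MorphismProperty.pullbacks_mk _ h (powersOfGeneratingCofibrations.mk B i hi))

lemma finiteCompositesOfPullbacks_comp {X Y Z : TwoCat.{u}} {f : X ⟶ Y} {g : Y ⟶ Z}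
    (hf : finiteCompositesOfPullbacks f) (hg : finiteCompositesOfPullbacks g) :
    finiteCompositesOfPullbacks (f ≫ g) :=
  MorphismProperty.comp_mem powersOfGeneratingCofibrations.pullbacks.multiplicativeClosure f g hf hg

variable {C B : Type u} [Bicategory.{u, u} C] [Bicategory.{u, u} B] [Strict C] [Strict B]
  {F G : StrictPseudofunctor C B} (α β : F.toPseudofunctor ⟶ G.toPseudofunctor)

lemma finiteCompositesOfPullbacks_inserter : finiteCompositesOfPullbacks
    (X := mk (inserter α β).Total) (Y := mk C) (inserter α β).proj :=
  finiteCompositesOfPullbacks_of_isPullback (B := mk B) .mk₃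
    (IsCellwisePullback.isPullback (isCellwisePullback_inserter α β))

lemma finiteCompositesOfPullbacks_of_isEquifierMap {E : Type u} [Bicategory.{u, u} E] [Strict E]
    {P : StrictPseudofunctor E C} {α β : F.toPseudofunctor ⟶ G.toPseudofunctor} {Γ Γ' : α ⟶ β}
    (hP : IsEquifierMap P Γ Γ') : finiteCompositesOfPullbacks (X := mk E) (Y := mk C) P :=
  finiteCompositesOfPullbacks_of_isPullback (B := mk B) .mk₄
    (IsCellwisePullback.isPullback hP.isCellwisePullback)

/-- The 2-functor `k` is not a generating cofibration, but the iso-3-cell inserter is obtained by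
inserting two 2-cells and equifying both composites with identities. -/
lemma finiteCompositesOfPullbacks_isoInserter : finiteCompositesOfPullbacks
    (X := mk (isoInserter α β).Total) (Y := mk C) (isoInserter α β).proj := by
  rw [← isoInserterToRetract_comp]
  exact finiteCompositesOfPullbacks_comp (Y := mk (retractInserter α β).Total)
    (finiteCompositesOfPullbacks_of_isEquifierMap (isEquifierMap_isoInserterToRetract α β))
    (finiteCompositesOfPullbacks_comp (Y := mk (backInserter α β).Total)
      (finiteCompositesOfPullbacks_of_isEquifierMap (isEquifierMap_proj _ _))
      (finiteCompositesOfPullbacks_comp (Y := mk (inserter α β).Total)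
        (finiteCompositesOfPullbacks_inserter _ _) (finiteCompositesOfPullbacks_inserter _ _)))

lemma finiteCompositesOfPullbacks_forget (S : StrictPseudofunctor C C) :
    finiteCompositesOfPullbacks (X := mk (PreAlgebra S)) (Y := mk C) (PreAlgebra.forget S) :=
  finiteCompositesOfPullbacks_of_isPullback (B := mk C) .mk₂
    (IsCellwisePullback.isPullback (PreAlgebra.isCellwisePullback_forget S))

end TwoCat

/-! ### Whiskering with equivalences -/

section whisker

variable {B : Type u} [Bicategory.{w, v} B]

/-- Postcomposition with the two 1-cells of an equivalence, as an equivalence of hom-categories. -/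
def postcompEquivalence (a : B) {b c : B} {k : b ⟶ c} {k' : c ⟶ b} (η : 𝟙 b ≅ k ≫ k')
    (θ : k' ≫ k ≅ 𝟙 c) : (a ⟶ b) ≌ (a ⟶ c) :=
  CategoryTheory.Equivalence.mk (postcomp a k) (postcomp a k')
    (NatIso.ofComponents
      (fun f => (ρ_ f).symm ≪≫ whiskerLeftIso f η ≪≫ (α_ f k k').symm)
      (fun {f g} γ => by
        change γ ≫ (ρ_ g).inv ≫ g ◁ η.hom ≫ (α_ g k k').inv =
          ((ρ_ f).inv ≫ f ◁ η.hom ≫ (α_ f k k').inv) ≫ γ ▷ k ▷ k'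
        rw [rightUnitor_inv_naturality_assoc, ← whisker_exchange_assoc]
        simp))
    (NatIso.ofComponents
      (fun f => (α_ f k' k) ≪≫ whiskerLeftIso f θ ≪≫ (ρ_ f))
      (fun {f g} γ => by
        change γ ▷ k' ▷ k ≫ (α_ g k' k).hom ≫ g ◁ θ.hom ≫ (ρ_ g).hom =
          ((α_ f k' k).hom ≫ f ◁ θ.hom ≫ (ρ_ f).hom) ≫ γ
        rw [associator_naturality_left_assoc, ← whisker_exchange_assoc, rightUnitor_naturality]
        simp))

lemma whiskerRight_cancel {a b c : B} {k : b ⟶ c} {k' : c ⟶ b} (η : 𝟙 b ≅ k ≫ k')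
    (θ : k' ≫ k ≅ 𝟙 c) {f g : a ⟶ b} {γ δ : f ⟶ g} (h : γ ▷ k = δ ▷ k) : γ = δ :=
  (postcompEquivalence a η θ).functor.map_injective h

lemma exists_whiskerRight_eq {a b c : B} {k : b ⟶ c} {k' : c ⟶ b} (η : 𝟙 b ≅ k ≫ k')
    (θ : k' ≫ k ≅ 𝟙 c) {f g : a ⟶ b} (γ : f ≫ k ⟶ g ≫ k) : ∃ δ : f ⟶ g, δ ▷ k = γ :=
  (postcompEquivalence a η θ).functor.map_surjective γ

lemma exists_whiskerRightIso_eq {a b c : B} {k : b ⟶ c} {k' : c ⟶ b} (η : 𝟙 b ≅ k ≫ k')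
    (θ : k' ≫ k ≅ 𝟙 c) {f g : a ⟶ b} (γ : f ≫ k ≅ g ≫ k) :
    ∃ δ : f ≅ g, whiskerRightIso δ k = γ :=
  ⟨(postcompEquivalence a η θ).functor.preimageIso γ, Iso.ext
    ((postcompEquivalence a η θ).functor.map_preimage γ.hom)⟩

variable {C : Type u} [Bicategory.{w, v} C]

/-- The image under a 2-functor of the unit of an equivalence. -/
def mapUnit (F : StrictPseudofunctor C B) {x y : C} (e : Bicategory.Equivalence x y) :
    𝟙 (F.obj x) ≅ F.map e.hom ≫ F.map e.inv :=
  (F.mapId x).symm ≪≫ F.map₂Iso e.unit ≪≫ F.mapComp e.hom e.inv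

/-- The image under a 2-functor of the counit of an equivalence. -/
def mapCounit (F : StrictPseudofunctor C B) {x y : C} (e : Bicategory.Equivalence x y) :
    F.map e.inv ≫ F.map e.hom ≅ 𝟙 (F.obj y) :=
  (F.mapComp e.inv e.hom).symm ≪≫ F.map₂Iso e.counit ≪≫ F.mapId y

end whisker

section natural

variable {C B : Type u} [Bicategory.{u, u} C] [Bicategory.{u, u} B]
  {F G : StrictPseudofunctor C B} {α β : F.toPseudofunctor ⟶ G.toPseudofunctor}

lemma NaturalAt.of_iso {x y : C} {s : α.app x ⟶ β.app x} {t : α.app y ⟶ β.app y} {f g : x ⟶ y}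
    (γ : f ≅ g) (h : NaturalAt α β s t f) : NaturalAt α β s t g := by
  unfold NaturalAt at h ⊢
  have hα := α.naturality_naturality γ.hom
  have hβ := β.naturality_naturality γ.hom
  rw [← cancel_epi (F.map₂ γ.hom ▷ α.app y), ← whisker_exchange_assoc, hβ, reassoc_of% h,
    reassoc_of% hα, whisker_exchange]

/-- A converse of `hpaste_cell`: if the pasting of two squares is natural with respect to the pair
`Γ`, `Γ''` and so is the second square with respect to `Γ'`, `Γ''`, then the first square is natural
with respect to `Γ`, `Γ'`, up to whiskering with the 1-cell `g'`. -/
lemma whiskerRight_eq_of_hpaste_cell {a a' a'' b b' b'' : B} {f : a ⟶ a'} {f' : a' ⟶ a''}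
    {g : b ⟶ b'} {g' : b' ⟶ b''} {k l : a ⟶ b} {k' l' : a' ⟶ b'} {k'' l'' : a'' ⟶ b''}
    {s : f ≫ k' ⟶ k ≫ g} {t : f' ≫ k'' ≅ k' ≫ g'}
    {p : f ≫ l' ⟶ l ≫ g} {q : f' ≫ l'' ⟶ l' ≫ g'}
    {Γ : k ⟶ l} {Γ' : k' ⟶ l'} {Γ'' : k'' ⟶ l''}
    (h' : f' ◁ Γ'' ≫ q = t.hom ≫ Γ' ▷ g')
    (h : (f ≫ f') ◁ Γ'' ≫ hpaste p q = hpaste s t.hom ≫ Γ ▷ (g ≫ g')) :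
    (f ◁ Γ' ≫ p) ▷ g' = (s ≫ Γ ▷ g) ▷ g' := by
  have e : (f ≫ f') ◁ Γ'' ≫ hpaste p q = (α_ f f' k'').hom ≫ f ◁ (f' ◁ Γ'' ≫ q) ≫
      (α_ f l' g').inv ≫ p ▷ g' ≫ (α_ l g g').hom := by
    unfold hpaste
    simp
  rw [e, h'] at h
  unfold hpaste at h
  rw [← cancel_epi (α_ f k' g').inv, ← cancel_epi (f ◁ t.hom), ← cancel_epi (α_ f f' k'').hom,
    ← cancel_mono (α_ l g g').hom]
  simpa using h

/-- A 2-cell `α_y ⟶ β_y` transports along an equivalence `e : x ≃ y`. Naturality at `e` forces the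
2-cell at `x`, since whiskering with `G e` is full and faithful; naturality at the inverse of `e`
then follows by cancellation from naturality at `e.inv ≫ e.hom ≅ 𝟙 y`. -/
lemma NaturalAt.exists_equivalence {x y : C} (e : Bicategory.Equivalence x y)
    (t : α.app y ⟶ β.app y) :
    ∃ s : α.app x ⟶ β.app x, NaturalAt α β s t e.hom ∧ NaturalAt α β t s e.inv := by
  obtain ⟨s, hs⟩ := exists_whiskerRight_eq (mapUnit G e) (mapCounit G e)
    ((α.naturality e.hom).inv ≫ F.map e.hom ◁ t ≫ (β.naturality e.hom).hom)
  have h : NaturalAt α β s t e.hom := by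
    unfold NaturalAt
    rw [hs, Iso.hom_inv_id_assoc]
  refine ⟨s, h, whiskerRight_cancel (mapUnit G e) (mapCounit G e) ?_⟩
  have h' : NaturalAt α β t t (e.inv ≫ e.hom) := (NaturalAt.id t).of_iso e.counit.symm
  unfold NaturalAt at h h'
  rw [naturality_comp_eq_hpaste, naturality_comp_eq_hpaste, whisker_exchange_assoc, Category.assoc,
    Category.assoc, cancel_epi, whisker_exchange, ← Category.assoc, ← Category.assoc, cancel_mono]
    at h'
  exact whiskerRight_eq_of_hpaste_cell (t := α.naturality e.hom) h h'

end natural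

section equifier

variable {C B E : Type u} [Bicategory.{u, u} C] [Bicategory.{u, u} B] [Bicategory.{u, u} E]
  {F G : StrictPseudofunctor C B}
  {α β : F.toPseudofunctor ⟶ G.toPseudofunctor}

/-- The 2-functor of a 3-cell equifier lifts invertible 2-cells. -/
lemma IsEquifierMap.exists_iso {P : StrictPseudofunctor E C} {Γ Γ' : α ⟶ β}
    (hP : IsEquifierMap P Γ Γ') {x y : E} {f g : x ⟶ y} (θ : P.map f ≅ P.map g) :
    ∃ θ' : f ≅ g, P.map₂Iso θ' = θ := by
  obtain ⟨γ, hγ⟩ := (hP.map₂_bijective f g).2 θ.hom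
  obtain ⟨δ, hδ⟩ := (hP.map₂_bijective g f).2 θ.inv
  refine ⟨⟨γ, δ, (hP.map₂_bijective _ _).1 ?_, (hP.map₂_bijective _ _).1 ?_⟩, Iso.ext hγ⟩
  · rw [P.map₂_comp, hγ, hδ, P.map₂_id, θ.hom_inv_id]
  · rw [P.map₂_comp, hγ, hδ, P.map₂_id, θ.inv_hom_id]

/-- Two modifications that agree at an object agree at every object equivalent to it: by naturality
they agree after whiskering with the equivalence, and this whiskering is faithful. -/
lemma as_app_eq_of_equivalence {Γ Γ' : α ⟶ β} {x y : C}
    (e : Bicategory.Equivalence x y) (h : Γ.as.app y = Γ'.as.app y) :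
    Γ.as.app x = Γ'.as.app x := by
  refine whiskerRight_cancel (mapUnit G e) (mapCounit G e) ?_
  rw [← cancel_epi (α.naturality e.hom).hom]
  exact (Γ.as.naturality e.hom).symm.trans ((congrArg (fun t => F.map e.hom ◁ t ≫ _) h).trans
    (Γ'.as.naturality e.hom))

end equifier

/-! ### Equiv-fibrations -/

namespace TwoCat

lemma IsEquivFibration.comp {D E B : TwoCat.{u}} {P : D ⟶ E} {Q : E ⟶ B} (hP : IsEquivFibration P)
    (hQ : IsEquivFibration Q) : IsEquivFibration (P ≫ Q) where
  lift_iso f g θ := by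
    obtain ⟨g', θ', rfl, h⟩ := hQ.lift_iso _ g θ
    obtain ⟨g'', θ'', rfl, h'⟩ := hP.lift_iso f g' θ'
    refine ⟨g'', θ'', rfl, ?_⟩
    have e := eq_of_heq h'
    exact (heq_of_eq (congrArg Q.map₂ e)).trans h
  lift_equivalence y b e := by
    obtain ⟨x', e', rfl, h₁, h₂, h₃, h₄⟩ := hQ.lift_equivalence _ b e
    obtain ⟨x, e'', rfl, k₁, k₂, k₃, k₄⟩ := hP.lift_equivalence y x' e'
    have k₁' := eq_of_heq k₁
    have k₂' := eq_of_heq k₂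
    have hid (z : D) : HEq (P.map (𝟙 z)) (𝟙 (P.obj z)) := heq_of_eq (P.map_id z)
    have hcomp {z z' z'' : D} (f : z ⟶ z') (g : z' ⟶ z'') :
        HEq (P.map (f ≫ g)) (P.map f ≫ P.map g) :=
      heq_of_eq (P.map_comp f g)
    refine ⟨x, e'', rfl, ?_, ?_, ?_, ?_⟩
    · exact (heq_of_eq (congrArg Q.map k₁')).trans h₁
    · exact (heq_of_eq (congrArg Q.map k₂')).trans h₂
    · exact (map₂_heq_map₂ Q rfl rfl (hid x)
        ((hcomp _ _).trans (comp_heq_comp rfl rfl rfl k₁ k₂)) k₃).trans h₃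
    · exact (map₂_heq_map₂ Q rfl rfl ((hcomp _ _).trans (comp_heq_comp rfl rfl rfl k₂ k₁)) (hid y)
        k₄).trans h₄

section refinement

variable {C B : Type u} [Bicategory.{u, u} C] [Bicategory.{u, u} B] [Strict C] [Strict B]

/-- The projection of a refinement is an equiv-fibration as soon as membership of 1-cells is
invariant under isomorphism and the data on objects lift along equivalences. Units and counits then
lift, a refinement being locally full. -/
lemma isEquivFibration_refinement (R : Refinement C)
    (hiso : ∀ {x y : R.Obj} {f g : R.ob x ⟶ R.ob y}, (f ≅ g) → R.mem f → R.mem g)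
    (hequiv : ∀ (y : R.Obj) (c : C) (e : Bicategory.Equivalence c (R.ob y)), ∃ x : R.Obj,
      ∃ h : R.ob x = c, R.mem (h ▸ e.hom : R.ob x ⟶ R.ob y) ∧ R.mem (h ▸ e.inv : R.ob y ⟶ R.ob x)) :
    IsEquivFibration (E := mk R.Total) (B := mk C) R.proj where
  lift_iso f g θ := ⟨⟨g, hiso θ f.mem⟩, Refinement.isoMk θ, rfl, HEq.rfl⟩
  lift_equivalence y c e := by
    obtain ⟨x, rfl, h, h'⟩ := hequiv y.as c e
    let e' : Bicategory.Equivalence (⟨x⟩ : R.Total) y :=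
      { hom := ⟨e.hom, h⟩
        inv := ⟨e.inv, h'⟩
        unit := Refinement.isoMk e.unit
        counit := Refinement.isoMk e.counit
        left_triangle := Iso.ext (Refinement.hom₂_ext e.left_triangle_hom) }
    exact ⟨⟨x⟩, e', rfl, HEq.rfl, HEq.rfl, HEq.rfl, HEq.rfl⟩

/-- A 3-cell inserter is an equiv-fibration: the inserted 2-cells transport along equivalences. -/
lemma isEquivFibration_inserter {F G : StrictPseudofunctor C B}
    (α β : F.toPseudofunctor ⟶ G.toPseudofunctor) :
    IsEquivFibration (E := mk (inserter α β).Total) (B := mk C) (inserter α β).proj :=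
  isEquivFibration_refinement _ (fun γ h => NaturalAt.of_iso γ h) (fun y _ e => by
    obtain ⟨s, h, h'⟩ := NaturalAt.exists_equivalence e y.2
    exact ⟨⟨_, s⟩, rfl, h, h'⟩)

end refinement

section equifier

variable {C B E : Type u} [Bicategory.{u, u} C] [Bicategory.{u, u} B] [Bicategory.{u, u} E]
  {F G : StrictPseudofunctor C B}
  {α β : F.toPseudofunctor ⟶ G.toPseudofunctor}

/-- Equifiers are equiv-fibrations. They are full on 1-cells and locally fully faithful, so only
objects have to be lifted, and the equation defining them is invariant under equivalence. -/
lemma isEquivFibration_of_isEquifierMap [Strict C] [Strict E] {P : StrictPseudofunctor E C}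
    {Γ Γ' : α ⟶ β} (hP : IsEquifierMap P Γ Γ') : IsEquivFibration (E := mk E) (B := mk C) P where
  lift_iso {x y} f g θ := by
    obtain ⟨g', rfl⟩ := (hP.map_bijective x y).2 g
    obtain ⟨θ', rfl⟩ := hP.exists_iso θ
    exact ⟨g', θ', rfl, HEq.rfl⟩
  lift_equivalence y c e := by
    obtain ⟨x, rfl⟩ := hP.exists_obj c (as_app_eq_of_equivalence e (hP.app_eq y))
    obtain ⟨f, g, η, θ, h⟩ := e
    obtain ⟨f, rfl⟩ := (hP.map_bijective x y).2 f
    obtain ⟨g, rfl⟩ := (hP.map_bijective y x).2 g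
    obtain ⟨η', hη⟩ := hP.exists_iso (P.mapId x ≪≫ η ≪≫ (P.mapComp f g).symm)
    obtain ⟨θ', hθ⟩ := hP.exists_iso (P.mapComp g f ≪≫ θ ≪≫ (P.mapId y).symm)
    have hη' := congrArg Iso.hom hη
    have hθ' := congrArg Iso.hom hθ
    have h' := congrArg Iso.hom h
    simp at hη' hθ'
    -- The triangle identity may be checked after applying `P`, which is locally faithful.
    let e' : Bicategory.Equivalence x y :=
      { hom := f
        inv := g
        unit := η'
        counit := θ'
        left_triangle := by
          refine Iso.ext ((hP.map₂_bijective _ _).1 ?_)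
          have e : (ρ_ (P.map f)).inv ≫ P.map f ◁ (P.mapId y).inv ≫ (P.mapComp f (𝟙 y)).inv =
              P.map₂ (ρ_ f).inv := by
            rw [P.mapComp_id_right_inv]
            simp
          simp [bicategoricalIsoComp] at h' ⊢
          simp [hη', hθ', reassoc_of% h', e] }
    refine ⟨x, e', rfl, HEq.rfl, HEq.rfl, ?_, ?_⟩
    · refine (heq_of_eq hη').trans ?_
      rw [P.mapId_eq_eqToIso, P.mapComp_eq_eqToIso]
      exact eqToHom_conj_heq (P.map_id x) η.hom (P.map_comp f g).symm
    · refine (heq_of_eq hθ').trans ?_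
      rw [P.mapId_eq_eqToIso, P.mapComp_eq_eqToIso]
      exact eqToHom_conj_heq (P.map_comp g f) θ.hom (P.map_id y).symm

end equifier

end TwoCat

/-! ### Equivalences of algebras for an endo-2-functor -/

namespace PreAlgebra

variable {A : Type u} [Bicategory.{u, u} A] {S : StrictPseudofunctor A A}

/-- The pseudomorphism of algebras given by a 1-cell and a comparison of the two actions. -/
def homMk {X Y : PreAlgebra S} (f : X.obj ⟶ Y.obj) (c : S.map f ≫ Y.act ≅ X.act ≫ f) : X ⟶ Y :=
  ⟨f, c⟩

/-- A 1-cell isomorphic to a pseudomorphism of algebras underlies an isomorphic pseudomorphism. -/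
lemma exists_iso {X Y : PreAlgebra S} (f : X ⟶ Y) {g : X.obj ⟶ Y.obj} (θ : f.hom ≅ g) :
    ∃ (c : S.map g ≫ Y.act ≅ X.act ≫ g) (θ' : f ≅ homMk g c), θ'.hom.hom = θ.hom := by
  refine ⟨whiskerRightIso (S.map₂Iso θ.symm) Y.act ≪≫ f.cell ≪≫ whiskerLeftIso X.act θ,
    isoMk θ ?_, rfl⟩
  change S.map₂ θ.hom ▷ Y.act ≫ S.map₂ θ.inv ▷ Y.act ≫ f.cell.hom ≫ X.act ◁ θ.hom =
    f.cell.hom ≫ X.act ◁ θ.hom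
  rw [← comp_whiskerRight_assoc, ← S.map₂_comp, θ.hom_inv_id, S.map₂_id, id_whiskerRight,
    Category.id_comp]

/-- The algebra structure transported along an equivalence `e` from `x` to the underlying object of
an algebra. -/
def transport (Y : PreAlgebra S) {x : A} (e : Bicategory.Equivalence x Y.obj) : PreAlgebra S where
  obj := x
  act := S.map e.hom ≫ Y.act ≫ e.inv

/-- The equivalence along which an algebra structure is transported underlies a pseudomorphism. -/
def transportCell (Y : PreAlgebra S) {x : A} (e : Bicategory.Equivalence x Y.obj) :
    S.map e.hom ≫ Y.act ≅ (Y.transport e).act ≫ e.hom :=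
  whiskerLeftIso (S.map e.hom) ((ρ_ Y.act).symm ≪≫ whiskerLeftIso Y.act e.counit.symm ≪≫
    (α_ Y.act e.inv e.hom).symm) ≪≫ (α_ (S.map e.hom) (Y.act ≫ e.inv) e.hom).symm

/-- A 2-cell is compatible with the actions as soon as its whiskering with an equivalence is. -/
lemma coh_of_whiskerRight {X Y Z : PreAlgebra S} {f g : X ⟶ Y} {k : Y ⟶ Z}
    {k' : Z.obj ⟶ Y.obj} (η : 𝟙 Y.obj ≅ k.hom ≫ k') (θ : k' ≫ k.hom ≅ 𝟙 Z.obj)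
    (γ : f.hom ⟶ g.hom) (ζ : f ≫ k ⟶ g ≫ k) (h : ζ.hom = γ ▷ k.hom) :
    S.map₂ γ ▷ Y.act ≫ g.cell.hom = f.cell.hom ≫ X.act ◁ γ := by
  refine whiskerRight_cancel η θ ?_
  have e := ζ.coh
  rw [h, comp_cell_hom, comp_cell_hom] at e
  unfold hpaste at e
  rw [← cancel_mono (α_ X.act g.hom k.hom).hom, ← cancel_epi (α_ (S.map f.hom) Y.act k.hom).inv,
    ← cancel_epi (S.map f.hom ◁ k.cell.hom),
    ← cancel_epi (α_ (S.map f.hom) (S.map k.hom) Z.act).hom,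
    ← cancel_epi ((S.mapComp f.hom k.hom).hom ▷ Z.act)]
  simp at e ⊢
  rw [← e, associator_naturality_left_assoc, ← whisker_exchange_assoc,
    associator_inv_naturality_left_assoc]

/-- The inverse of an equivalence of underlying objects is a pseudomorphism, in such a way that the
counit is a 2-cell of algebras. -/
lemma exists_inverse_cell {X Y : PreAlgebra S} (e : Bicategory.Equivalence X.obj Y.obj)
    (c : S.map e.hom ≫ Y.act ≅ X.act ≫ e.hom) :
    ∃ d : S.map e.inv ≫ X.act ≅ Y.act ≫ e.inv,
      S.map₂ e.counit.hom ▷ Y.act ≫ (𝟙 Y : Y ⟶ Y).cell.hom =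
        (homMk e.inv d ≫ homMk e.hom c).cell.hom ≫ Y.act ◁ e.counit.hom := by
  -- Solving the required equation for `d ▷ e.hom` determines `d`.
  obtain ⟨d, hd⟩ := exists_whiskerRightIso_eq e.unit e.counit
    (α_ (S.map e.inv) X.act e.hom ≪≫ whiskerLeftIso (S.map e.inv) c.symm ≪≫
      (α_ (S.map e.inv) (S.map e.hom) Y.act).symm ≪≫
      whiskerRightIso ((S.mapComp e.inv e.hom).symm ≪≫ S.map₂Iso e.counit ≪≫ S.mapId Y.obj) Y.act ≪≫
      λ_ Y.act ≪≫ (ρ_ Y.act).symm ≪≫ whiskerLeftIso Y.act e.counit.symm ≪≫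
      (α_ Y.act e.inv e.hom).symm)
  refine ⟨d, ?_⟩
  have hd' := congrArg Iso.hom hd
  simp at hd'
  rw [id_cell_hom, comp_cell_hom]
  change _ = ((S.mapComp e.inv e.hom).hom ▷ Y.act ≫ (α_ (S.map e.inv) (S.map e.hom) Y.act).hom ≫
    S.map e.inv ◁ c.hom ≫ (α_ (S.map e.inv) X.act e.hom).inv ≫ d.hom ▷ e.hom ≫
      (α_ Y.act e.inv e.hom).hom) ≫ Y.act ◁ e.counit.hom
  simp [hd']

/-- A pseudomorphism whose underlying 1-cell is part of an adjoint equivalence is part of an adjoint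
equivalence of algebras. -/
lemma exists_equivalence {X Y : PreAlgebra S} (e : Bicategory.Equivalence X.obj Y.obj)
    (c : S.map e.hom ≫ Y.act ≅ X.act ≫ e.hom) :
    ∃ (d : S.map e.inv ≫ X.act ≅ Y.act ≫ e.inv)
      (η : 𝟙 X ≅ homMk e.hom c ≫ homMk e.inv d)
      (θ : homMk e.inv d ≫ homMk e.hom c ≅ 𝟙 Y),
      leftZigzagIso η θ = λ_ (homMk e.hom c) ≪≫ (ρ_ (homMk e.hom c)).symm ∧
      η.hom.hom = e.unit.hom ∧ θ.hom.hom = e.counit.hom := by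
  obtain ⟨d, hd⟩ := exists_inverse_cell e c
  let k : X ⟶ Y := homMk e.hom c
  let k' : Y ⟶ X := homMk e.inv d
  let θ : k' ≫ k ≅ 𝟙 Y := isoMk e.counit hd
  -- By the triangle identity, the unit whiskered with `k` is a 2-cell of algebras.
  let ζ : 𝟙 X ≫ k ⟶ (k ≫ k') ≫ k := (λ_ k).hom ≫ (ρ_ k).inv ≫ k ◁ θ.inv ≫ (α_ k k' k).inv
  have hζ : ζ.hom = e.unit.hom ▷ e.hom := by
    have h := e.left_triangle_hom
    simp only [leftZigzag, bicategoricalComp] at h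
    change (λ_ e.hom).hom ≫ (ρ_ e.hom).inv ≫ e.hom ◁ e.counit.inv ≫ (α_ e.hom e.inv e.hom).inv = _
    simp at h
    rw [← reassoc_of% h]
    simp
  let η : 𝟙 X ≅ k ≫ k' := isoMk e.unit (coh_of_whiskerRight e.unit e.counit e.unit.hom ζ hζ)
  exact ⟨d, η, θ, Iso.ext (hom₂_ext e.left_triangle_hom), rfl, rfl⟩

end PreAlgebra

namespace TwoCat

variable {A : Type u} [Bicategory.{u, u} A] [Strict A]

/-- The forgetful 2-functor from algebras for an endo-2-functor is an equiv-fibration: the action is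
transported along the equivalence. -/
lemma isEquivFibration_forget (S : StrictPseudofunctor A A) :
    IsEquivFibration (E := mk (PreAlgebra S)) (B := mk A) (PreAlgebra.forget S) where
  lift_iso {X Y} f g θ := by
    obtain ⟨c, θ', h⟩ := PreAlgebra.exists_iso f θ
    exact ⟨PreAlgebra.homMk g c, θ', rfl, heq_of_eq h⟩
  lift_equivalence Y x e := by
    obtain ⟨d, η, θ, h, hη, hθ⟩ := PreAlgebra.exists_equivalence (X := Y.transport e) e
      (PreAlgebra.transportCell Y e)
    exact ⟨Y.transport e, ⟨_, _, η, θ, h⟩, rfl, HEq.rfl, HEq.rfl, heq_of_eq hη, heq_of_eq hθ⟩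

end TwoCat

/-! ### Limits of 2-functors and equiv-fibrations -/

namespace TwoCat

section

variable {C B : Type u} [Bicategory.{u, u} C] [Bicategory.{u, u} B] [Strict C] [Strict B]
  {F G : StrictPseudofunctor C B} (α β : F.toPseudofunctor ⟶ G.toPseudofunctor)

/-- An iso-3-cell inserter, as a composite of two 3-cell inserters and two 3-cell equifiers, is an
equiv-fibration. -/
lemma isEquivFibration_isoInserter :
    IsEquivFibration (E := mk (isoInserter α β).Total) (B := mk C) (isoInserter α β).proj := by
  rw [← isoInserterToRetract_comp]
  exact IsEquivFibration.comp (E := mk (retractInserter α β).Total)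
    (isEquivFibration_of_isEquifierMap (isEquifierMap_isoInserterToRetract α β))
    (IsEquivFibration.comp (E := mk (backInserter α β).Total)
      (isEquivFibration_of_isEquifierMap (isEquifierMap_proj _ _))
      (IsEquivFibration.comp (E := mk (inserter α β).Total)
        (isEquivFibration_inserter _ _) (isEquivFibration_inserter _ _)))

/-- The equalities `hF` and `hG` allow for a different bracketing of composite 2-functors. -/
lemma isIsoThreeCellInserter {F' G' : mk C ⟶ mk B} (hF : F = F') (hG : G = G') :
    IsIsoThreeCellInserter (I := mk (isoInserter α β).Total) F' G' (isoInserter α β).proj := by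
  subst hF hG
  exact ⟨_, _, ⟨functor_ext rfl, functor_ext rfl⟩, (isCellwisePullback_isoInserter α β).isPullback⟩

variable {α β} in
lemma _root_.GrayPsAlg.IsEquifierMap.isThreeCellEquifier {E : Type u} [Bicategory.{u, u} E]
    [Strict E] {P : StrictPseudofunctor E C} {Γ Γ' : α ⟶ β} (hP : IsEquifierMap P Γ Γ')
    {F' G' : mk C ⟶ mk B} (hF : F = F') (hG : G = G') :
    IsThreeCellEquifier (I := mk E) F' G' P := by
  subst hF hG
  exact ⟨_, _, ⟨functor_ext rfl, functor_ext rfl⟩, hP.isCellwisePullback.isPullback⟩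

lemma isTwoCellInserter_forget (S : StrictPseudofunctor C C) :
    IsTwoCellInserter (A := mk C) (I := mk (PreAlgebra S)) S (𝟙 (mk C)) (PreAlgebra.forget S) :=
  ⟨_, _, ⟨functor_ext rfl, functor_ext rfl⟩, (PreAlgebra.isCellwisePullback_forget S).isPullback⟩

end

end TwoCat

end GrayPsAlg

theorem mainTheorem4 (A : TwoCat.{u}) (T : Pseudomonad A) :
    (∃ (I₁ I₂ I₃ E₁ : TwoCat.{u}) (p₁ : I₁ ⟶ A) (p₂ : I₂ ⟶ I₁) (p₃ : I₃ ⟶ I₂)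
        (p₄ : E₁ ⟶ I₃) (p₅ : TwoCat.algebras T ⟶ E₁),
      TwoCat.IsTwoCellInserter (TwoCat.endo T) (𝟙 A) p₁ ∧
      TwoCat.IsIsoThreeCellInserter p₁ p₁ p₂ ∧
      TwoCat.IsIsoThreeCellInserter
        (p₂ ≫ p₁ ≫ TwoCat.endo T ≫ TwoCat.endo T) (p₂ ≫ p₁) p₃ ∧
      TwoCat.IsThreeCellEquifier
        (p₃ ≫ p₂ ≫ p₁ ≫ TwoCat.endo T) (p₃ ≫ p₂ ≫ p₁) p₄ ∧
      TwoCat.IsThreeCellEquifier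
        (p₄ ≫ p₃ ≫ p₂ ≫ p₁ ≫ TwoCat.endo T ≫ TwoCat.endo T ≫
          TwoCat.endo T) (p₄ ≫ p₃ ≫ p₂ ≫ p₁) p₅ ∧
      p₅ ≫ p₄ ≫ p₃ ≫ p₂ ≫ p₁ = TwoCat.forget T) ∧
    TwoCat.finiteCompositesOfPullbacks (TwoCat.forget T) ∧
    TwoCat.IsEquivFibration (TwoCat.forget T) := by
  let I₁ : TwoCat.{u} := TwoCat.mk (PreAlgebra T.S)
  let I₂ : TwoCat.{u} := TwoCat.mk T.unital.Total
  let I₃ : TwoCat.{u} := TwoCat.mk T.multiplicative.Total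
  let E₁ : TwoCat.{u} := TwoCat.mk T.unitCoherent.Total
  let p₁ : I₁ ⟶ A := PreAlgebra.forget T.S
  let p₂ : I₂ ⟶ I₁ := T.unital.proj
  let p₃ : I₃ ⟶ I₂ := T.multiplicative.proj
  let p₄ : E₁ ⟶ I₃ := T.unitCoherent.proj
  let p₅ : TwoCat.algebras T ⟶ E₁ := T.toUnitCoherent
  have hp : p₅ ≫ p₄ ≫ p₃ ≫ p₂ ≫ p₁ = TwoCat.forget T := T.toUnitCoherent_comp
  refine ⟨⟨I₁, I₂, I₃, E₁, p₁, p₂, p₃, p₄, p₅, ?_, ?_, ?_, ?_, ?_, hp⟩, ?_, ?_⟩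
  · exact TwoCat.isTwoCellInserter_forget T.S
  · exact TwoCat.isIsoThreeCellInserter _ _ (TwoCat.functor_ext rfl) (TwoCat.functor_ext rfl)
  · exact TwoCat.isIsoThreeCellInserter _ _ (TwoCat.functor_ext rfl) (TwoCat.functor_ext rfl)
  · exact (isEquifierMap_proj _ _).isThreeCellEquifier (TwoCat.functor_ext rfl)
      (TwoCat.functor_ext rfl)
  · exact T.isEquifierMap_toUnitCoherent.isThreeCellEquifier (TwoCat.functor_ext rfl)
      (TwoCat.functor_ext rfl)
  · rw [← hp]
    exact TwoCat.finiteCompositesOfPullbacks_comp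
      (TwoCat.finiteCompositesOfPullbacks_of_isEquifierMap T.isEquifierMap_toUnitCoherent)
      (TwoCat.finiteCompositesOfPullbacks_comp
        (TwoCat.finiteCompositesOfPullbacks_of_isEquifierMap (isEquifierMap_proj _ _))
        (TwoCat.finiteCompositesOfPullbacks_comp
          (TwoCat.finiteCompositesOfPullbacks_isoInserter _ _)
          (TwoCat.finiteCompositesOfPullbacks_comp
            (TwoCat.finiteCompositesOfPullbacks_isoInserter _ _)
            (TwoCat.finiteCompositesOfPullbacks_forget T.S))))
  · rw [← hp]
    exact (TwoCat.isEquivFibration_of_isEquifierMap T.isEquifierMap_toUnitCoherent).comp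
      ((TwoCat.isEquivFibration_of_isEquifierMap (isEquifierMap_proj _ _)).comp
        ((TwoCat.isEquivFibration_isoInserter _ _).comp
          ((TwoCat.isEquivFibration_isoInserter _ _).comp (TwoCat.isEquivFibration_forget T.S))))
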